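/- **Setting.** Let $\mathcal S$ be a countable state space, $\mathcal A$ a finite non-empty action space with $A=|\mathcal A|$, and let $H,L\ge 1$ be integers. A latent MDP (LMDP) $M$ consists of mixing weights $\rho\in\Delta([L])$, initial laws $\nu_m\in\Delta(\mathcal S)$ and transition kernels $\mathbb T_m:\mathcal S\times\mathcal A\to\Delta(\mathcal S)$, $m\in[L]$. In an episode a hidden index $m^\star\sim\rho$ and $s_1\sim\nu_{m^\star}$ are drawn; at steps $h=1,\dots,H$ the agent takes an action $a_h$, and $s_{h+1}\sim\mathbb T_{m^\star}(\cdot|s_h,a_h)$. A policy $\pi$ draws $a_h\sim\pi_h(\cdot|s_1,a_1,\dots,s_{h-1},a_{h-1},s_h)$; $\Pi_{\rm RND}$ is the set of all policies. A mixture of policies draws one policy before the episode and follows it throughout. Let $\{M_\theta\}_{\theta\in\Theta}$ be a class of LMDPs with common $\mathcal S,\mathcal A,H,L$, let $\theta^\star\in\Theta$ be the true model, let $\Pi\subseteq\Pi_{\rm RND}$ be a policy class, and let $R_h:\mathcal S\times\mathcal A\to[0,1]$ be known rewards with $\sum_{h=1}^H\sup_{s,a}R_h(s,a)\le 1$. Write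 $\mathbb P^\pi_\theta$ for the law of $\tau_H=(s_1,a_1,\dots,s_H,a_H)$ under $\pi$ in $M_\theta$, $\widetilde{\mathbb P}^\pi_\theta$ for the joint law of $(m^\star,\tau_H)$, and $V_\theta(\pi)=\mathbb E^\pi_\theta[\sum_h R_h(s_h,a_h)]$. A policy (or mixture) $\hat\pi$ is $\varepsilon$-optimal if $\sup_{\pi\in\Pi}V_{\theta^\star}(\pi)-V_{\theta^\star}(\hat\pi)\le\varepsilon$. **Separation.** Let $\varpi:\mathbb N\to[-\infty,\infty]$ be non-decreasing and $\varpi^{-1}(x)=\min\{h\ge1:\varpi(h)\ge x\}$ ($=\infty$ if there is no such $h$). For $h\ge 1$ let $\mathbb M^\theta_{m,h}(\pi,s)$ be the law of $(a_1,s_2,\dots,a_{h-1},s_h)$ given $s_1=s$ in the $m$-th MDP of $M_\theta$ under $\pi$, and let $D_{\rm B}(p,q)=-\log\sum_x\sqrt{p(x)q(x)}$. The model $\theta$ is $\varpi$-separated under $\pi$ if $D_{\rm B}(\mathbb M^\theta_{m,h}(\pi,s),\mathbb M^\theta_{l,h}(\pi,s))\ge\varpi(h)$ for all $m\ne l$ in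 $\mathrm{supp}(\rho_\theta)$, all $1\le h\le H$ and all $s\in\mathcal S$. **Covering number.** An optimistic $r$-cover of $\Theta$ is a finite set $\Theta_0\subseteq\Theta$ with functions $\hat{\mathbb P}^\pi_{\theta_0}\ge 0$ on trajectories ($\theta_0\in\Theta_0$, $\pi\in\Pi_{\rm RND}$) such that every $\theta\in\Theta$ has a $\theta_0\in\Theta_0$ with $\hat{\mathbb P}^\pi_{\theta_0}(\tau)\ge\mathbb P^\pi_\theta(\tau)$ for all $\tau,\pi$, and $\|\mathbb P^\pi_{\theta_0}-\hat{\mathbb P}^\pi_{\theta_0}\|_1\le r^2$ for all $\theta_0\in\Theta_0$ and all $\pi$. $N_\Theta(r)$ is the least cardinality of such a $\Theta_0$ ($\infty$ if there is none). **Algorithm (OMLE).** For $W\ge1$ let $m_\theta(s_1,a_1,\dots,s_W)$ be a maximizer over $m\in\mathrm{supp}(\rho_\theta)$ of $\log\rho_\theta(m)+\log\nu_{\theta,m}(s_1)+\sum_{h=1}^{W-1}\log\mathbb T_{\theta,m}(s_{h+1}|s_h,a_h)$, and let $e_{\theta,W}(\pi)=\widetilde{\mathbb P}^\pi_\theta(m_\theta(s_1,a_1,\dots,s_W)\ne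 m^\star)$. Let $\pi\circ_h\pi'$ follow $\pi$ at the steps before $h$ and run $\pi'$ afresh from step $h$ on, forgetting $s_1,a_1,\dots,s_{h-1},a_{h-1}$. Given $\pi_{\rm exp}\in\Pi$, let $\varphi_h(\pi)=\pi\circ_h\mathrm{Unif}(\mathcal A)\circ_{h+1}\pi_{\rm exp}$ for $0\le h\le H-1$, and let $\mathsf{p}(\pi)$ be the mixture of policies $\frac12(\pi\circ_W\pi_{\rm exp})+\frac1{2H}\sum_{h=0}^{H-1}\varphi_h(\pi)$. Start with $\Theta^1=\Theta$. In episode $k=1,\dots,K$ choose $(\theta^k,\pi^k)$ maximizing $V_\theta(\pi)$ over $\theta\in\Theta^k$ and $\pi\in\Pi$ with $e_{\theta,W}(\pi)\le\varepsilon_{\rm s}$ (the maximizers are assumed to exist and are chosen as a function of the past records), execute $\mathsf p(\pi^k)$ in $M_{\theta^\star}$, observe $\tau^k$, and put $$\Theta^{k+1}=\Big\{\theta\in\Theta:\ \sum_{t\le k}\log\mathbb P^{\mathsf p(\pi^t)}_\theta(\tau^t)\ \ge\ \sup_{\theta'\in\Theta}\sum_{t\le k}\log\mathbb P^{\mathsf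 p(\pi^t)}_{\theta'}(\tau^t)-\beta\Big\}.$$ Output the uniform mixture $\hat\pi=\mathrm{Unif}(\{\pi^1,\dots,\pi^K\})$. **Theorem.** There is an absolute constant $C_1>0$ such that the following holds for every $C_0\ge C_1$. Suppose that the true model has rank at most $d<\infty$, i.e. $\max_{m\in[L]}\mathrm{rank}(\mathbb T_{\theta^\star,m})\le d$ where $\mathbb T_{\theta^\star,m}$ is viewed as an $\mathcal S\times(\mathcal S\times\mathcal A)$ matrix, and that every $\theta\in\Theta$ is $\varpi$-separated under every $\pi\in\Pi$. Let $0<\varepsilon\le1$, $0<p<1$, let $\pi_{\rm exp}\in\Pi$ be arbitrary, let $\iota=\log(LdH/\varepsilon)$, and let $K\ge 1$, $\beta$, $\varepsilon_{\rm s}$ satisfy $$\beta\ge 2\log N_\Theta(1/K)+2\log(1/p)+2,\qquad K=\Big\lceil C_0\,\frac{Ld^2AH^2\iota\beta}{\varepsilon^2}\Big\rceil,\qquad \varepsilon_{\rm s}=\frac{\varepsilon^2}{C_0Ld^2H^2\iota}.$$ If the integer $W$ satisfies $$W\ge\varpi^{-1}(\log(L/\varepsilon_{\rm s})),\qquad H-W\ge\varpi^{-1}(\log(2L)),$$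 then, with probability at least $1-p$ over its $K$ episodes, OMLE outputs an $\varepsilon$-optimal policy $\hat\pi$. -/

import Mathlib

open scoped ENNReal NNReal

noncomputable section

namespace LatentMDP

/-- A history-dependent randomized policy.  `π hist s` is the law of the action taken at step
`h = hist.length + 1`, where `hist = [(s₁, a₁), …, (s_{h-1}, a_{h-1})]` and `s = s_h`.
In an episode of length `H` only the histories with `hist.length < H` are ever consulted. -/
abbrev Policy (S A : Type*) := List (S × A) → S → PMF A

/-- A complete trajectory `(s₁, a₁, …, s_H, a_H)`; steps are numbered from `0` in Lean. -/
abbrev Traj (S A : Type*) (H : ℕ) := Fin H → S × A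

/-- The law of `(s_h, a_h, …, s_{h+n-1}, a_{h+n-1})` in the MDP with transition kernel `T`, when
the past is `hist` and the current state is `s`. (The state drawn after the last action is
discarded.) -/
def rollout {S A : Type*} (T : S → A → PMF S) (π : Policy S A) :
    (n : ℕ) → List (S × A) → S → PMF (Fin n → S × A)
  | 0, _, _ => PMF.pure Fin.elim0
  | n + 1, hist, s =>
      (π hist s).bind fun a => (T s a).bind fun s' =>
        (rollout T π n (hist ++ [(s, a)]) s').map
          fun τ => (Fin.cons (s, a) τ : Fin (n + 1) → S × A)

/-- The law of `(a_h, s_{h+1}, …, a_{h+n-1}, s_{h+n})` in the MDP with transition kernel `T`, when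
the past is `hist` and the current state is `s`. -/
def futureLaw {S A : Type*} (T : S → A → PMF S) (π : Policy S A) :
    (n : ℕ) → List (S × A) → S → PMF (Fin n → A × S)
  | 0, _, _ => PMF.pure Fin.elim0
  | n + 1, hist, s =>
      (π hist s).bind fun a => (T s a).bind fun s' =>
        (futureLaw T π n (hist ++ [(s, a)]) s').map
          fun τ => (Fin.cons (a, s') τ : Fin (n + 1) → A × S)

/-- The Bhattacharyya divergence `-log ∑ₓ √(p(x) q(x))`, with values in `[0, ∞]`. -/
def bhattacharyya {X : Type*} (p q : PMF X) : EReal :=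
  -ENNReal.log (∑' x, (p x * q x) ^ (1 / 2 : ℝ))

/-- A mixture of `L` MDPs on the state space `S` with action space `A`: mixing weights, initial
state laws and transition kernels. -/
structure LMDP (S A : Type*) (L : ℕ) where
  ρ : PMF (Fin L)
  ν : Fin L → PMF S
  T : Fin L → S → A → PMF S

namespace LMDP

variable {S A : Type*} {L : ℕ}

/-- The joint law of the latent index and the `H`-step trajectory under the policy `π`. -/
def jointLaw (M : LMDP S A L) (H : ℕ) (π : Policy S A) : PMF (Fin L × Traj S A H) :=
  M.ρ.bind fun m => (M.ν m).bind fun s => (rollout (M.T m) π H [] s).map fun τ => (m, τ)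

/-- The law of the `H`-step trajectory under the policy `π`. -/
def trajLaw (M : LMDP S A L) (H : ℕ) (π : Policy S A) : PMF (Traj S A H) :=
  (M.jointLaw H π).map Prod.snd

/-- The law of the `H`-step trajectory under a mixture of policies: a policy is drawn from `q`
before the episode and is followed throughout the episode. -/
def mixLaw (M : LMDP S A L) (H : ℕ) (q : PMF (Policy S A)) : PMF (Traj S A H) :=
  q.bind (M.trajLaw H)

/-- The law `𝕄_{m,h}(π, s)` of `(a₁, s₂, …, a_{h-1}, s_h)` given `s₁ = s` in the `m`-th MDP under
the policy `π` (for `h ≥ 1`). -/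
def obsLaw (M : LMDP S A L) (m : Fin L) (h : ℕ) (π : Policy S A) (s : S) :
    PMF (Fin (h - 1) → A × S) :=
  futureLaw (M.T m) π (h - 1) [] s

/-- `ϖ`-separation under `π`, at all the steps `1 ≤ h ≤ H` of an episode. -/
def SeparatedUnder (M : LMDP S A L) (H : ℕ) (ϖ : ℕ → EReal) (π : Policy S A) : Prop :=
  ∀ m ∈ M.ρ.support, ∀ l ∈ M.ρ.support, m ≠ l →
    ∀ h : ℕ, 1 ≤ h → h ≤ H → ∀ s : S,
      ϖ h ≤ bhattacharyya (M.obsLaw m h π s) (M.obsLaw l h π s)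

/-- The rank of an LMDP: the largest rank of a transition matrix `𝕋_m ∈ ℝ^{S × (S × A)}`. -/
def rank (M : LMDP S A L) : ℕ∞ :=
  ⨆ m : Fin L, (Matrix.of fun (s' : S) (x : S × A) => (M.T m x.1 x.2 s').toReal).eRank

/-- The conditional probability, in the `m`-th MDP, of the state of `τ` at a step given the
preceding state and action (given nothing at the first step). -/
def stateLik (M : LMDP S A L) (m : Fin L) {H : ℕ} (τ : Traj S A H) : Fin H → ℝ≥0∞
  | ⟨0, h0⟩ => M.ν m (τ ⟨0, h0⟩).1
  | ⟨h + 1, hh⟩ =>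
      M.T m (τ ⟨h, Nat.lt_of_succ_lt hh⟩).1 (τ ⟨h, Nat.lt_of_succ_lt hh⟩).2 (τ ⟨h + 1, hh⟩).1

/-- `log ρ(m) + log ν_m(s₁) + ∑_{h=1}^{W-1} log 𝕋_m(s_{h+1} | s_h, a_h)`, in `[-∞, 0]`. -/
def latentLogLik (M : LMDP S A L) (W : ℕ) {H : ℕ} (τ : Traj S A H) (m : Fin L) : EReal :=
  ENNReal.log (M.ρ m) +
    ∑ h ∈ Finset.univ.filter (fun h : Fin H => (h : ℕ) < W), ENNReal.log (M.stateLik m τ h)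

theorem exists_mleIndex (M : LMDP S A L) (W : ℕ) {H : ℕ} (τ : Traj S A H) :
    ∃ m ∈ M.ρ.support, ∀ l ∈ M.ρ.support, M.latentLogLik W τ l ≤ M.latentLogLik W τ m :=
  Set.exists_max_image _ _ (Set.toFinite _) M.ρ.support_nonempty

/-- The maximum likelihood latent index `m_θ(s₁, a₁, …, s_W)`, with an arbitrary choice in case of
ties. -/
def mleIndex (M : LMDP S A L) (W : ℕ) {H : ℕ} (τ : Traj S A H) : Fin L :=
  (M.exists_mleIndex W τ).choose

/-- The decoding error `e_{θ,W}(π)`: the probability that the maximum likelihood index computed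
from `(s₁, a₁, …, s_W)` differs from the latent index. -/
def decodingError (M : LMDP S A L) (H W : ℕ) (π : Policy S A) : ℝ :=
  ((M.jointLaw H π).toOuterMeasure {x | M.mleIndex W x.2 ≠ x.1}).toReal

end LMDP

section Values

variable {S A : Type*} {L H : ℕ}

/-- The expected total reward of a random trajectory. -/
def expectedReturn (R : Fin H → S → A → ℝ) (P : PMF (Traj S A H)) : ℝ :=
  ∑' τ, (P τ).toReal * ∑ h, R h (τ h).1 (τ h).2

/-- The value `V_θ(π)` of a policy. -/
def LMDP.value (M : LMDP S A L) (R : Fin H → S → A → ℝ) (π : Policy S A) : ℝ :=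
  expectedReturn R (M.trajLaw H π)

/-- The value of a mixture of policies. -/
def LMDP.mixValue (M : LMDP S A L) (R : Fin H → S → A → ℝ) (q : PMF (Policy S A)) : ℝ :=
  expectedReturn R (M.mixLaw H q)

end Values

/-- `ϖ⁻¹(x) = min {h ≥ 1 : ϖ(h) ≥ x}`, which is `∞` if there is no such `h`. -/
def growthInv (ϖ : ℕ → EReal) (x : EReal) : ℕ∞ :=
  ⨅ h : {h : ℕ // 1 ≤ h ∧ x ≤ ϖ h}, ((h : ℕ) : ℕ∞)

section Exploration

variable {S A : Type*}

/-- `π ∘_h π'`: follow `π` at the steps before `h`, and from step `h` on run `π'` afresh,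
discarding the first `h - 1` steps of the history. -/
def Policy.switch (h : ℕ) (π π' : Policy S A) : Policy S A := fun hist s =>
  if hist.length + 1 < h then π hist s else π' (hist.drop (h - 1)) s

/-- The policy that takes uniformly random actions. -/
def unifPolicy [Fintype A] [Nonempty A] : Policy S A := fun _ _ => PMF.uniformOfFintype A

/-- `φ_h(π) = π ∘_h Unif(A) ∘_{h+1} π_exp`. -/
def exploreAt [Fintype A] [Nonempty A] (πexp : Policy S A) (h : ℕ) (π : Policy S A) :
    Policy S A :=
  Policy.switch (h + 1) (Policy.switch h π unifPolicy) πexp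

/-- The exploration strategy `½ (π ∘_W π_exp) + (1 / 2H) ∑_{h=0}^{H-1} φ_h(π)`, a mixture of
policies. -/
def explore [Fintype A] [Nonempty A] (H : ℕ) [NeZero H] (W : ℕ) (πexp π : Policy S A) :
    PMF (Policy S A) :=
  (PMF.uniformOfFintype Bool).bind fun b =>
    if b then PMF.pure (Policy.switch W π πexp)
    else (PMF.uniformOfFintype (Fin H)).map fun h => exploreAt πexp h π

end Exploration

section Covering

variable {S A Θ : Type*} {L : ℕ}

/-- `(Phat, Θ₀)` is an optimistic `r`-cover of the model class `M : Θ → LMDP S A L`. -/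
def IsOptimisticCover (M : Θ → LMDP S A L) (H : ℕ) (r : ℝ) (Θ₀ : Finset Θ)
    (Phat : Θ → Policy S A → Traj S A H → ℝ≥0) : Prop :=
  (∀ θ, ∃ θ₀ ∈ Θ₀, ∀ τ π, (M θ).trajLaw H π τ ≤ (Phat θ₀ π τ : ℝ≥0∞)) ∧
  ∀ θ ∈ Θ₀, ∀ π,
    ∑' τ, ENNReal.ofReal |((M θ).trajLaw H π τ).toReal - (Phat θ π τ : ℝ)|
      ≤ ENNReal.ofReal (r ^ 2)

/-- The optimistic covering number `N_Θ(r)`, which is `∞` if there is no finite cover. -/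
def coveringNumber (M : Θ → LMDP S A L) (H : ℕ) (r : ℝ) : ℕ∞ :=
  ⨅ Θ₀ : {Θ₀ : Finset Θ // ∃ Phat, IsOptimisticCover M H r Θ₀ Phat}, ((Θ₀ : Finset Θ).card : ℕ∞)

end Covering

section OMLE

/-- What the learner records in one episode: the optimistic model and policy `(θ^k, π^k)`, and the
trajectory that was observed when executing the explorative version of `π^k`. -/
structure Round (Θ S A : Type*) (H : ℕ) where
  model : Θ
  policy : Policy S A
  traj : Traj S A H

variable {S A Θ : Type*} {L H : ℕ} [Fintype A] [Nonempty A] [NeZero H]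

/-- The log-likelihood under `θ` of the data `(π_exp^t, τ^t)`, `t ≤ k`, in `[-∞, 0]`. -/
def dataLogLik (M : Θ → LMDP S A L) (W : ℕ) (πexp : Policy S A) {k : ℕ}
    (D : Fin k → Round Θ S A H) (θ : Θ) : EReal :=
  ∑ t, ENNReal.log ((M θ).mixLaw H (explore H W πexp (D t).policy) (D t).traj)

/-- The confidence set after the episodes recorded in `D`. -/
def confidenceSet (M : Θ → LMDP S A L) (W : ℕ) (πexp : Policy S A) (β : ℝ) {k : ℕ}
    (D : Fin k → Round Θ S A H) : Set Θ :=
  {θ | (⨆ θ', dataLogLik M W πexp D θ') - (β : EReal) ≤ dataLogLik M W πexp D θ}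

/-- The pairs `(θ, π)` among which the algorithm optimizes in the next episode. -/
def feasiblePairs (M : Θ → LMDP S A L) (Pol : Set (Policy S A)) (W : ℕ) (πexp : Policy S A)
    (β εs : ℝ) {k : ℕ} (D : Fin k → Round Θ S A H) : Set (Θ × Policy S A) :=
  {x | x.1 ∈ confidenceSet M W πexp β D ∧ x.2 ∈ Pol ∧ (M x.1).decodingError H W x.2 ≤ εs}

/-- The law of the records of the first `k` episodes, when the environment is `M θstar` and the
pair `(θ, π)` of each episode is computed from the records of the preceding ones by `sel`. -/
def omleRun (M : Θ → LMDP S A L) (θstar : Θ) (W : ℕ) (πexp : Policy S A)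
    (sel : (k : ℕ) → (Fin k → Round Θ S A H) → Θ × Policy S A) :
    (k : ℕ) → PMF (Fin k → Round Θ S A H)
  | 0 => PMF.pure Fin.elim0
  | k + 1 =>
      (omleRun M θstar W πexp sel k).bind fun D =>
        ((M θstar).mixLaw H (explore H W πexp (sel k D).2)).map fun τ =>
          (Fin.snoc D ⟨(sel k D).1, (sel k D).2, τ⟩ : Fin (k + 1) → Round Θ S A H)

/-- `sel` carries out the optimization step of OMLE in the episodes `1, …, K`: on all records that
can arise it picks a maximizer of `V_θ(π)` over the feasible pairs. -/
def IsOMLESelection (M : Θ → LMDP S A L) (θstar : Θ) (R : Fin H → S → A → ℝ)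
    (Pol : Set (Policy S A)) (W : ℕ) (πexp : Policy S A) (β εs : ℝ) (K : ℕ)
    (sel : (k : ℕ) → (Fin k → Round Θ S A H) → Θ × Policy S A) : Prop :=
  ∀ k < K, ∀ D ∈ (omleRun M θstar W πexp sel k).support,
    sel k D ∈ feasiblePairs M Pol W πexp β εs D ∧
    ∀ x ∈ feasiblePairs M Pol W πexp β εs D,
      (M x.1).value R x.2 ≤ (M (sel k D).1).value R (sel k D).2

/-- The output `Unif({π^1, …, π^K})` of OMLE. -/
def omleOutput {K : ℕ} [NeZero K] (D : Fin K → Round Θ S A H) : PMF (Policy S A) :=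
  (PMF.uniformOfFintype (Fin K)).map fun k => (D k).policy

/-- A mixture of policies is `ε`-optimal relative to the policy class `Pol`. -/
def IsEpsOptimal (M : LMDP S A L) (R : Fin H → S → A → ℝ) (Pol : Set (Policy S A)) (ε : ℝ)
    (q : PMF (Policy S A)) : Prop :=
  sSup (M.value R '' Pol) - M.mixValue R q ≤ ε

end OMLE

end LatentMDP

end

/-! This is an optimistic maximum likelihood argument: a regret bound over the `K` rounds is turned
into a statement about the uniform mixture of the played policies. The probability of a trajectory
is a product of action probabilities, common to all models, and of a policy-free likelihood of its
states. Hence every distance between two models under a policy is a sum over histories (`hsum`) of a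
distance of likelihoods.

Confidence. For each element of an optimistic cover, the product of the roots of the likelihood
ratios of its envelope to the truth, each normalized by `exp (1 - affinity)`, is a nonnegative
supermartingale. By Ville's inequality and a union bound (`exists_confidence_event`), outside an
event of probability `p` the true model lies in every confidence set, and every model in the `k`-th
set has squared Hellinger distances to the truth, over the mixtures executed before, of sum at most
`2 * β`.

Optimism. Separation at step `W` makes the decoding error of every policy in the class at most `εs`
(`hsum_pairSum_le`, `LMDP.decodingError_le`). So the true model is feasible with every policy of the
class, and the suboptimality of the output is at most the mean `ℓ¹` distance between the optimistic
and the true law of a trajectory under `π^k` (`isEpsOptimal_of_sum_l1_le`). These distances have to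
sum to at most `K * ε`.

Before step `W` the latent index is unknown, but separation of the last `H - W` steps under `πexp`
makes the latent weights a stable linear function of the law of the future (`exists_latent_map`).
Comparing the weights in the optimistic model with the linear image of the true ones gives a
telescoping sum (`LMDP.hsum_futL1_le`) of seminorms of the true posterior, which depend only on the
current state. After step `W` the index is decoded up to `εs`. The indices of the two models are
paired by their laws of the future from the state at step `W`, and the new errors are those of the
paired transition laws (`LMDP.hsum_absDiff_le`).

In both regimes an error under `π^k` is controlled by squared errors under the earlier `π^t`, by an
elliptic potential for each context (`sq_sum_error_le`). The context is the state before `W`, and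
the pair of index and state at step `W` afterwards. Although there may be infinitely many contexts,
rank `d` supplies a bounded spanner of the transition laws (`exists_spanner`), hence a measure of
mass `2 * d` that dominates the occupancy of every policy (`LMDP.exists_occupancy`). Mass times
dimension is at most `2 * d ^ 2 * L` each time. The past squared errors are Hellinger distances seen
by the exploratory policies, where the uniform action costs the factor `A`.
`LMDP.sum_hsum_absDiff_le` adds everything up and `regret_bound_le` fits the constants. -/

noncomputable section

namespace LatentMDP

/-! ### Sums over histories; splitting probabilities into policy and model factors -/

section Paths

set_option linter.unusedSectionVars false

variable {S A : Type*} [Fintype A]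

/-- One backward step of the sum of `c` over the histories, weighted with the action probabilities
of `π`. -/
def step (π : Policy S A) (c : List (S × A) → S → ℝ≥0∞) : List (S × A) → S → ℝ≥0∞ :=
  fun hist s => ∑ a, π hist s a * ∑' t, c (hist ++ [(s, a)]) t

/-- The sum of `c` over the histories with `n` actions, weighted with the action probabilities. -/
def hsum (π : Policy S A) (n : ℕ) (c : List (S × A) → S → ℝ≥0∞) : ℝ≥0∞ :=
  ∑' s, (step π)^[n] c [] s

theorem hsum_zero (π : Policy S A) (c : List (S × A) → S → ℝ≥0∞) :
    hsum π 0 c = ∑' s, c [] s := rfl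

theorem hsum_succ (π : Policy S A) (n : ℕ) (c : List (S × A) → S → ℝ≥0∞) :
    hsum π (n + 1) c = hsum π n (step π c) := rfl

theorem hsum_iterate (π : Policy S A) (n m : ℕ) (c : List (S × A) → S → ℝ≥0∞) :
    hsum π (n + m) c = hsum π n ((step π)^[m] c) := by
  simp only [hsum, Function.iterate_add_apply]

theorem sum_policy (π : Policy S A) (hist : List (S × A)) (s : S) :
    ∑ a, π hist s a = 1 := by
  have := PMF.tsum_coe (π hist s)
  rwa [tsum_fintype] at this

theorem step_mono_of_length {π : Policy S A} {c c' : List (S × A) → S → ℝ≥0∞} {j : ℕ}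
    (h : ∀ hist s, hist.length = j + 1 → c hist s ≤ c' hist s) (hist : List (S × A)) (s : S)
    (hj : hist.length = j) : step π c hist s ≤ step π c' hist s := by
  unfold step
  gcongr with a _ s'
  exact h _ _ (by simp [hj])

theorem iterate_step_mono_of_length {π : Policy S A} {c c' : List (S × A) → S → ℝ≥0∞} {j : ℕ}
    (n : ℕ) (h : ∀ hist s, hist.length = j + n → c hist s ≤ c' hist s) (hist : List (S × A))
    (s : S) (hj : hist.length = j) : (step π)^[n] c hist s ≤ (step π)^[n] c' hist s := by
  induction n generalizing j hist s with
  | zero => exact h hist s (by simpa using hj)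
  | succ n ih =>
    rw [Function.iterate_succ_apply', Function.iterate_succ_apply']
    refine step_mono_of_length (fun hist s hl => ih (fun hist s hl => h hist s ?_) hist s hl)
      hist s hj
    omega

theorem hsum_mono {π : Policy S A} {n : ℕ} {c c' : List (S × A) → S → ℝ≥0∞}
    (h : ∀ hist s, hist.length = n → c hist s ≤ c' hist s) : hsum π n c ≤ hsum π n c' := by
  unfold hsum
  gcongr with s
  exact iterate_step_mono_of_length n (j := 0) (fun hist s hl => h hist s (by simpa using hl))
    [] s rfl

theorem hsum_congr {π : Policy S A} {n : ℕ} {c c' : List (S × A) → S → ℝ≥0∞}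
    (h : ∀ hist s, hist.length = n → c hist s = c' hist s) : hsum π n c = hsum π n c' :=
  le_antisymm (hsum_mono fun hist s hl => (h hist s hl).le)
    (hsum_mono fun hist s hl => (h hist s hl).ge)

theorem hsum_congr_policy {π π' : Policy S A} {n : ℕ} (c : List (S × A) → S → ℝ≥0∞)
    (h : ∀ hist s, hist.length < n → π hist s = π' hist s) : hsum π n c = hsum π' n c := by
  induction n generalizing c with
  | zero => rfl
  | succ n ih =>
    rw [hsum_succ, hsum_succ, ih _ fun hist s hl => h hist s (by omega)]
    refine hsum_congr fun hist s hl => ?_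
    unfold step
    rw [h hist s (by omega)]

theorem step_tsum {ι : Type*} (π : Policy S A) (c : ι → List (S × A) → S → ℝ≥0∞) :
    step π (fun hist s => ∑' i, c i hist s) = fun hist s => ∑' i, step π (c i) hist s := by
  funext hist s
  unfold step
  rw [Summable.tsum_finsetSum fun _ _ => ENNReal.summable]
  refine Finset.sum_congr rfl fun a _ => ?_
  rw [ENNReal.tsum_comm, ENNReal.tsum_mul_left]

theorem hsum_tsum {ι : Type*} (π : Policy S A) (n : ℕ) (c : ι → List (S × A) → S → ℝ≥0∞) :
    hsum π n (fun hist s => ∑' i, c i hist s) = ∑' i, hsum π n (c i) := by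
  induction n generalizing c with
  | zero => simp only [hsum_zero]; rw [ENNReal.tsum_comm]
  | succ n ih => simp only [hsum_succ, step_tsum, ih]

theorem hsum_add (π : Policy S A) (n : ℕ) (c c' : List (S × A) → S → ℝ≥0∞) :
    hsum π n (fun hist s => c hist s + c' hist s) = hsum π n c + hsum π n c' := by
  have := hsum_tsum π n (fun b : Bool => if b then c else c')
  simpa [tsum_fintype] using this

theorem hsum_finset_sum {ι : Type*} (π : Policy S A) (n : ℕ) (t : Finset ι)
    (c : ι → List (S × A) → S → ℝ≥0∞) :
    hsum π n (fun hist s => ∑ i ∈ t, c i hist s) = ∑ i ∈ t, hsum π n (c i) := by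
  classical
  have h0 : hsum π n (fun _ _ => 0) = 0 := by
    have := hsum_tsum π n (fun (i : Empty) => (i.elim : List (S × A) → S → ℝ≥0∞))
    simpa using this
  induction t using Finset.induction_on with
  | empty => simpa using h0
  | insert a t ha ih => simp only [Finset.sum_insert ha, hsum_add, ih]

theorem step_const_mul (π : Policy S A) (r : ℝ≥0∞) (c : List (S × A) → S → ℝ≥0∞) :
    step π (fun hist s => r * c hist s) = fun hist s => r * step π c hist s := by
  funext hist s
  unfold step
  simp only [ENNReal.tsum_mul_left, Finset.mul_sum]
  exact Finset.sum_congr rfl fun a _ => by ring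

theorem hsum_const_mul (π : Policy S A) (n : ℕ) (r : ℝ≥0∞) (c : List (S × A) → S → ℝ≥0∞) :
    hsum π n (fun hist s => r * c hist s) = r * hsum π n c := by
  induction n generalizing c with
  | zero => simp only [hsum_zero, ENNReal.tsum_mul_left]
  | succ n ih => simp only [hsum_succ, step_const_mul, ih]

open Classical in
/-- The product of the action probabilities along a history with `n` actions. -/
def histWt (π : Policy S A) (n : ℕ) (y : List (S × A) × S) : ℝ≥0∞ :=
  hsum π n fun hist s => if (hist, s) = y then 1 else 0

/-- Linearity in `c`, decomposed into point masses. All policies become weights on one index set,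
which is the form needed by the potential argument. -/
theorem hsum_eq_tsum (π : Policy S A) (n : ℕ) (c : List (S × A) → S → ℝ≥0∞) :
    hsum π n c = ∑' y : List (S × A) × S, histWt π n y * c y.1 y.2 := by
  classical
  have h : c = fun hist s => ∑' y : List (S × A) × S,
      c y.1 y.2 * (if (hist, s) = y then 1 else 0) := by
    funext hist s
    rw [tsum_eq_single (hist, s)]
    · simp
    · intro y hy
      rw [if_neg (Ne.symm hy), mul_zero]
  conv_lhs => rw [h, hsum_tsum]
  refine tsum_congr fun y => ?_
  rw [hsum_const_mul, mul_comm]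
  unfold histWt
  congr!

/-- The history and the last state of a trajectory that extends `hist`. -/
def pathEnd : (n : ℕ) → List (S × A) → (Fin (n + 1) → S × A) → List (S × A) × S
  | 0, hist, τ => (hist, (τ 0).1)
  | n + 1, hist, τ => pathEnd n (hist ++ [τ 0]) (Fin.tail τ)

/-- The product of the action probabilities along a trajectory that extends `hist`. -/
def pathWt (π : Policy S A) : (n : ℕ) → List (S × A) → (Fin (n + 1) → S × A) → ℝ≥0∞
  | 0, hist, τ => π hist (τ 0).1 (τ 0).2
  | n + 1, hist, τ => π hist (τ 0).1 (τ 0).2 * pathWt π n (hist ++ [τ 0]) (Fin.tail τ)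

theorem tsum_fin_cons {X : Type*} (n : ℕ) (f : (Fin (n + 1) → X) → ℝ≥0∞) :
    ∑' τ, f τ = ∑' x, ∑' τ : Fin n → X, f (Fin.cons x τ : Fin (n + 1) → X) := by
  rw [← (Fin.consEquiv fun _ : Fin (n + 1) => X).tsum_eq f, ENNReal.tsum_prod']
  rfl

/-- `c` does not see the last action, whose probabilities add up to one; hence `n` backward steps
for `n + 1` state-action pairs. -/
theorem tsum_pathWt (π : Policy S A) (c : List (S × A) → S → ℝ≥0∞) (n : ℕ)
    (hist : List (S × A)) :
    ∑' τ, pathWt π n hist τ * c (pathEnd n hist τ).1 (pathEnd n hist τ).2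
      = ∑' s, (step π)^[n] c hist s := by
  induction n generalizing hist with
  | zero =>
    rw [tsum_fin_cons]
    simp only [pathWt, pathEnd, Fin.cons_zero, tsum_fintype, Finset.univ_unique,
      Finset.sum_singleton, Function.iterate_zero, id_eq]
    rw [ENNReal.tsum_prod']
    refine tsum_congr fun s => ?_
    simp only [ENNReal.tsum_mul_right, PMF.tsum_coe, one_mul]
  | succ n ih =>
    rw [tsum_fin_cons, ENNReal.tsum_prod']
    refine tsum_congr fun s => ?_
    rw [Function.iterate_succ_apply', step, tsum_fintype]
    refine Finset.sum_congr rfl fun a _ => ?_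
    simp only [pathWt, pathEnd, Fin.cons_zero, Fin.tail_cons, mul_assoc]
    rw [ENNReal.tsum_mul_left, ih]

/-- The weights `b` of the histories grow along the kernel `T`. -/
def Follows (T : S → A → PMF S) (b : List (S × A) → S → ℝ≥0∞) : Prop :=
  ∀ hist s a s', b (hist ++ [(s, a)]) s' = b hist s * T s a s'

theorem rollout_succ_apply (T : S → A → PMF S) (π : Policy S A) (n : ℕ) (hist : List (S × A))
    (s : S) (x : S × A) (τ : Fin n → S × A) :
    rollout T π (n + 1) hist s (Fin.cons x τ : Fin (n + 1) → S × A)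
      = open Classical in if x.1 = s then
        π hist x.1 x.2 * ∑' s', T x.1 x.2 s' * rollout T π n (hist ++ [x]) s' τ else 0 := by
  classical
  rw [rollout, PMF.bind_apply, tsum_eq_single x.2]
  · rw [PMF.bind_apply]
    split_ifs with h
    · obtain ⟨x1, x2⟩ := x
      simp only at h
      subst h
      congr 1
      refine tsum_congr fun s' => ?_
      congr 1
      rw [PMF.map_apply, tsum_eq_single τ]
      · simp
      · intro τ' hτ'
        rw [if_neg]
        intro h
        exact hτ' (Fin.cons_injective2 h).2.symm
    · have : ∀ s', (PMF.map (fun τ => (Fin.cons (s, x.2) τ : Fin (n + 1) → S × A))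
          (rollout T π n (hist ++ [(s, x.2)]) s')) (Fin.cons x τ) = 0 := by
        intro s'
        rw [PMF.map_apply]
        refine ENNReal.tsum_eq_zero.2 fun τ' => if_neg fun h' => h ?_
        rw [(Fin.cons_injective2 h').1]
      simp [this]
  · intro a ha
    rw [PMF.bind_apply]
    refine mul_eq_zero_of_right _ (ENNReal.tsum_eq_zero.2 fun s' => mul_eq_zero_of_right _ ?_)
    rw [PMF.map_apply]
    refine ENNReal.tsum_eq_zero.2 fun τ' => if_neg fun h' => ha ?_
    rw [(Fin.cons_injective2 h').1]

/-- The factorization into action probabilities and likelihood, by peeling off the first pair. The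
state drawn after the last action is summed out. -/
theorem tsum_mul_rollout {T : S → A → PMF S} {b : List (S × A) → S → ℝ≥0∞} (hb : Follows T b)
    (π : Policy S A) (n : ℕ) (hist : List (S × A)) (τ : Fin (n + 1) → S × A) :
    ∑' s, b hist s * rollout T π (n + 1) hist s τ
      = pathWt π n hist τ * b (pathEnd n hist τ).1 (pathEnd n hist τ).2 := by
  classical
  induction n generalizing hist with
  | zero =>
    rw [← Fin.cons_self_tail τ]
    simp only [rollout_succ_apply]
    rw [tsum_eq_single (τ 0).1 (fun s hs => by rw [if_neg (Ne.symm hs), mul_zero])]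
    have h0 : ∀ s', rollout T π 0 (hist ++ [τ 0]) s' (Fin.tail τ) = 1 := by
      intro s'
      rw [rollout, Subsingleton.elim (Fin.tail τ) Fin.elim0]
      simp
    simp only [if_true, h0, mul_one, PMF.tsum_coe, pathWt, pathEnd, Fin.cons_zero]
    rw [mul_comm]
  | succ n ih =>
    rw [← Fin.cons_self_tail τ]
    simp only [rollout_succ_apply]
    rw [tsum_eq_single (τ 0).1 (fun s hs => by rw [if_neg (Ne.symm hs), mul_zero])]
    simp only [if_true, pathWt, pathEnd, Fin.cons_zero, Fin.tail_cons, mul_assoc]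
    rw [← ih, mul_left_comm]
    congr 1
    rw [← ENNReal.tsum_mul_left]
    refine tsum_congr fun s' => ?_
    rw [show b (hist ++ [τ 0]) s' = _ from hb hist (τ 0).1 (τ 0).2 s', mul_assoc]

/-- The history and the last state reached from `(hist, s)` by the observations `ω`. -/
def obsEnd : (n : ℕ) → List (S × A) → S → (Fin n → A × S) → List (S × A) × S
  | 0, hist, s, _ => (hist, s)
  | n + 1, hist, s, ω => obsEnd n (hist ++ [(s, (ω 0).1)]) (ω 0).2 (Fin.tail ω)

/-- The product of the action probabilities along the observations `ω`. -/
def obsWt (π : Policy S A) : (n : ℕ) → List (S × A) → S → (Fin n → A × S) → ℝ≥0∞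
  | 0, _, _, _ => 1
  | n + 1, hist, s, ω =>
      π hist s (ω 0).1 * obsWt π n (hist ++ [(s, (ω 0).1)]) (ω 0).2 (Fin.tail ω)

theorem tsum_obsWt (π : Policy S A) (c : List (S × A) → S → ℝ≥0∞) (n : ℕ)
    (hist : List (S × A)) (s : S) :
    ∑' ω, obsWt π n hist s ω * c (obsEnd n hist s ω).1 (obsEnd n hist s ω).2
      = (step π)^[n] c hist s := by
  induction n generalizing hist s with
  | zero => simp [obsWt, obsEnd, tsum_fintype]
  | succ n ih =>
    rw [tsum_fin_cons, ENNReal.tsum_prod', tsum_fintype, Function.iterate_succ_apply', step]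
    refine Finset.sum_congr rfl fun a _ => ?_
    simp only [obsWt, obsEnd, Fin.cons_zero, Fin.tail_cons, mul_assoc]
    rw [← ENNReal.tsum_mul_left]
    refine tsum_congr fun s' => ?_
    rw [ENNReal.tsum_mul_left, ih]

theorem obsWt_fresh {π π' : Policy S A} {hist : List (S × A)}
    (h : ∀ r s, π (hist ++ r) s = π' r s) (n : ℕ) (r : List (S × A)) (s : S)
    (ω : Fin n → A × S) : obsWt π n (hist ++ r) s ω = obsWt π' n r s ω := by
  induction n generalizing r s with
  | zero => rfl
  | succ n ih => rw [obsWt, obsWt, h, List.append_assoc, ih]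

theorem futureLaw_succ_apply (T : S → A → PMF S) (π : Policy S A) (n : ℕ) (hist : List (S × A))
    (s : S) (x : A × S) (ω : Fin n → A × S) :
    futureLaw T π (n + 1) hist s (Fin.cons x ω : Fin (n + 1) → A × S)
      = π hist s x.1 * (T s x.1 x.2 * futureLaw T π n (hist ++ [(s, x.1)]) x.2 ω) := by
  classical
  rw [futureLaw, PMF.bind_apply, tsum_eq_single x.1]
  · rw [PMF.bind_apply, tsum_eq_single x.2]
    · rw [PMF.map_apply, tsum_eq_single ω]
      · simp
      · intro ω' hω'
        rw [if_neg]
        intro h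
        exact hω' (Fin.cons_injective2 h).2.symm
    · intro s' hs'
      rw [PMF.map_apply]
      refine mul_eq_zero_of_right _ (ENNReal.tsum_eq_zero.2 fun τ' => if_neg fun h' => hs' ?_)
      rw [(Fin.cons_injective2 h').1]
  · intro a ha
    rw [PMF.bind_apply]
    refine mul_eq_zero_of_right _ (ENNReal.tsum_eq_zero.2 fun s' => mul_eq_zero_of_right _ ?_)
    rw [PMF.map_apply]
    refine ENNReal.tsum_eq_zero.2 fun τ' => if_neg fun h' => ha ?_
    rw [(Fin.cons_injective2 h').1]

/-- The policy reads `r` while the likelihood continues `hist`: transitions depend on the current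
state only, so policies restarted after `hist` are covered. -/
theorem mul_futureLaw {T : S → A → PMF S} {b : List (S × A) → S → ℝ≥0∞} (hb : Follows T b)
    (π : Policy S A) (n : ℕ) (hist r : List (S × A)) (s : S) (ω : Fin n → A × S) :
    b hist s * futureLaw T π n r s ω
      = obsWt π n r s ω * b (obsEnd n hist s ω).1 (obsEnd n hist s ω).2 := by
  induction n generalizing hist r s with
  | zero =>
    rw [futureLaw, Subsingleton.elim ω Fin.elim0]
    simp [obsWt, obsEnd]
  | succ n ih =>
    rw [← Fin.cons_self_tail ω, futureLaw_succ_apply]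
    simp only [obsWt, obsEnd, Fin.cons_zero, Fin.tail_cons]
    rw [mul_assoc, ← ih, hb]
    ring

end Paths

/-! ### The `ℓ¹` distance and the unnormalized squared Hellinger distance -/

section Distances

variable {X : Type*}

/-- A real-valued probability mass function. -/
def IsProb (p : X → ℝ) : Prop := (∀ x, 0 ≤ p x) ∧ HasSum p 1

theorem isProb_toReal (p : PMF X) : IsProb fun x => (p x).toReal := by
  refine ⟨fun x => ENNReal.toReal_nonneg, ?_⟩
  have h := p.tsum_coe
  have h2 := ENNReal.hasSum_toReal (f := fun x => p x) (by rw [h]; simp)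
  rw [← ENNReal.tsum_toReal_eq (fun x => p.apply_ne_top x), h] at h2
  simpa using h2

/-- The `ℓ¹` distance of two functions, in `[0, ∞]`. -/
def l1 (p q : X → ℝ) : ℝ≥0∞ := ∑' x, ENNReal.ofReal |p x - q x|

/-- The squared Hellinger distance of two nonnegative functions, in `[0, ∞]`. -/
def hell (p q : X → ℝ) : ℝ≥0∞ := ∑' x, ENNReal.ofReal ((√(p x) - √(q x)) ^ 2)

theorem l1_comm (p q : X → ℝ) : l1 p q = l1 q p := by
  simp only [l1, abs_sub_comm]

theorem l1_triangle (p q r : X → ℝ) : l1 p r ≤ l1 p q + l1 q r := by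
  unfold l1
  rw [← ENNReal.tsum_add]
  gcongr with x
  rw [← ENNReal.ofReal_add (abs_nonneg _) (abs_nonneg _)]
  exact ENNReal.ofReal_le_ofReal (abs_sub_le _ _ _)

theorem IsProb.tsum_ofReal {p : X → ℝ} (hp : IsProb p) : ∑' x, ENNReal.ofReal (p x) = 1 := by
  rw [← ENNReal.ofReal_tsum_of_nonneg hp.1 hp.2.summable, hp.2.tsum_eq, ENNReal.ofReal_one]

theorem l1_le_two {p q : X → ℝ} (hp : IsProb p) (hq : IsProb q) : l1 p q ≤ 2 := by
  calc l1 p q ≤ ∑' x, (ENNReal.ofReal (p x) + ENNReal.ofReal (q x)) := by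
        unfold l1
        gcongr with x
        rw [← ENNReal.ofReal_add (hp.1 x) (hq.1 x)]
        refine ENNReal.ofReal_le_ofReal ?_
        rw [abs_le]
        constructor <;> linarith [hp.1 x, hq.1 x]
    _ = 2 := by rw [ENNReal.tsum_add, hp.tsum_ofReal, hq.tsum_ofReal]; norm_num

theorem ennreal_tsum_mul_sq_le (f g : X → ℝ≥0∞) :
    (∑' x, f x * g x) ^ 2 ≤ (∑' x, f x ^ 2) * ∑' x, g x ^ 2 := by
  have key : ∀ t : Finset X, ∑ x ∈ t, f x * g x ≤
      ((∑' x, f x ^ 2) * ∑' x, g x ^ 2) ^ (1 / 2 : ℝ) := by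
    intro t
    refine (ENNReal.inner_le_Lp_mul_Lq t f g (Real.HolderConjugate.two_two)).trans ?_
    rw [ENNReal.mul_rpow_of_nonneg _ _ (by norm_num)]
    gcongr
    · refine (le_of_eq ?_).trans (ENNReal.sum_le_tsum t)
      simp
    · refine (le_of_eq ?_).trans (ENNReal.sum_le_tsum t)
      simp
  have h2 : ∑' x, f x * g x ≤ ((∑' x, f x ^ 2) * ∑' x, g x ^ 2) ^ (1 / 2 : ℝ) := by
    rw [ENNReal.tsum_eq_iSup_sum]
    exact iSup_le key
  calc (∑' x, f x * g x) ^ 2 ≤ (((∑' x, f x ^ 2) * ∑' x, g x ^ 2) ^ (1 / 2 : ℝ)) ^ 2 := by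
        gcongr
    _ = _ := by
        rw [← ENNReal.rpow_natCast, ← ENNReal.rpow_mul]
        norm_num

theorem summable_sqrt_mul {p q : X → ℝ} (hp : ∀ x, 0 ≤ p x) (hq : ∀ x, 0 ≤ q x)
    (sp : Summable p) (sq : Summable q) : Summable fun x => √(p x) * √(q x) := by
  refine Summable.of_nonneg_of_le (fun x => by positivity) (fun x => ?_) (sp.add sq)
  nlinarith [sq_nonneg (√(p x) - √(q x)), Real.sq_sqrt (hp x), Real.sq_sqrt (hq x),
    hp x, hq x, Real.sqrt_nonneg (p x), Real.sqrt_nonneg (q x)]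

theorem hell_scaled {p q : X → ℝ} (hp : IsProb p) (hq : IsProb q) {a b : ℝ} (ha : 0 ≤ a)
    (hb : 0 ≤ b) : hell (fun x => a * p x) (fun x => b * q x)
      = ENNReal.ofReal (a + b - 2 * (√a * √b) * ∑' x, √(p x) * √(q x)) := by
  have hs := summable_sqrt_mul hp.1 hq.1 hp.2.summable hq.2.summable
  have hsum : HasSum (fun x => (√(a * p x) - √(b * q x)) ^ 2)
      (a * 1 + b * 1 - 2 * (√a * √b) * ∑' x, √(p x) * √(q x)) := by
    refine (((hp.2.mul_left a).add (hq.2.mul_left b)).sub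
      (hs.hasSum.mul_left (2 * (√a * √b)))).congr_fun ?_
    intro x
    rw [Real.sqrt_mul ha, Real.sqrt_mul hb, sub_sq, mul_pow, mul_pow, Real.sq_sqrt ha,
      Real.sq_sqrt hb, Real.sq_sqrt (hp.1 x), Real.sq_sqrt (hq.1 x)]
    ring
  unfold hell
  rw [← ENNReal.ofReal_tsum_of_nonneg (fun x => sq_nonneg _) hsum.summable, hsum.tsum_eq]
  simp

/-- With `β` the affinity, Cauchy–Schwarz gives `l1² ≤ 4 (1 - β²)`, and `a + b - 2√a√b β ≥ b (1 -
β²)` by completing the square `(√a - √b β)²`. Thus only the second mass has to be kept on the left.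
-/
theorem mul_l1_sq_le_hell {p q : X → ℝ} (hp : IsProb p) (hq : IsProb q) {a b : ℝ} (ha : 0 ≤ a)
    (hb : 0 ≤ b) :
    ENNReal.ofReal b * l1 p q ^ 2 ≤ 4 * hell (fun x => a * p x) (fun x => b * q x) := by
  set β := ∑' x, √(p x) * √(q x) with hβ
  have hβ0 : 0 ≤ β := tsum_nonneg fun x => by positivity
  have hs := summable_sqrt_mul hp.1 hq.1 hp.2.summable hq.2.summable
  have h1 : l1 p q ^ 2 ≤ ENNReal.ofReal (2 - 2 * β) * ENNReal.ofReal (2 + 2 * β) := by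
    have e1 : ∑' x, ENNReal.ofReal |√(p x) - √(q x)| ^ 2 = ENNReal.ofReal (2 - 2 * β) := by
      have := hell_scaled hp hq (a := 1) (b := 1) zero_le_one zero_le_one
      simp only [hell, one_mul, Real.sqrt_one, mul_one] at this
      rw [show (2 : ℝ) - 2 * β = 1 + 1 - 2 * β by ring, ← this]
      refine tsum_congr fun x => ?_
      rw [← ENNReal.ofReal_pow (abs_nonneg _), sq_abs]
    have e2 : ∑' x, ENNReal.ofReal (√(p x) + √(q x)) ^ 2 = ENNReal.ofReal (2 + 2 * β) := by
      have hsum : HasSum (fun x => (√(p x) + √(q x)) ^ 2) (1 + 1 + 2 * β) := by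
        refine ((hp.2.add hq.2).add (hs.hasSum.mul_left 2)).congr_fun ?_
        intro x
        rw [add_sq, Real.sq_sqrt (hp.1 x), Real.sq_sqrt (hq.1 x)]
        ring
      rw [show (2 : ℝ) + 2 * β = 1 + 1 + 2 * β by ring, ← hsum.tsum_eq,
        ENNReal.ofReal_tsum_of_nonneg (fun x => sq_nonneg _) hsum.summable]
      refine tsum_congr fun x => ?_
      rw [← ENNReal.ofReal_pow (by positivity)]
    rw [← e1, ← e2]
    refine le_trans (le_of_eq ?_) (ennreal_tsum_mul_sq_le _ _)
    congr 1
    refine tsum_congr fun x => ?_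
    rw [← ENNReal.ofReal_mul (abs_nonneg _)]
    congr 1
    have : 0 ≤ √(p x) + √(q x) := by positivity
    conv_rhs => rw [← abs_of_nonneg this, ← abs_mul]
    congr 1
    rw [mul_comm, ← sq_sub_sq, Real.sq_sqrt (hp.1 x), Real.sq_sqrt (hq.1 x)]
  rw [hell_scaled hp hq ha hb, ← hβ]
  calc ENNReal.ofReal b * l1 p q ^ 2
      ≤ ENNReal.ofReal b * (ENNReal.ofReal (2 - 2 * β) * ENNReal.ofReal (2 + 2 * β)) := by gcongr
    _ = ENNReal.ofReal (b * ((2 - 2 * β) * (2 + 2 * β))) := by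
        rw [ENNReal.ofReal_mul hb, ENNReal.ofReal_mul' (by positivity)]
    _ ≤ ENNReal.ofReal (4 * (a + b - 2 * (√a * √b) * β)) := by
        refine ENNReal.ofReal_le_ofReal ?_
        have e : b * β ^ 2 = (√b * β) ^ 2 := by rw [mul_pow, Real.sq_sqrt hb]
        nlinarith [sq_nonneg (√a - √b * β), Real.sq_sqrt ha]
    _ = _ := by rw [ENNReal.ofReal_mul (by norm_num)]; simp

theorem sq_sqrt_sub_sqrt_le {a b : ℝ} (ha : 0 ≤ a) (hb : 0 ≤ b) : (√a - √b) ^ 2 ≤ |a - b| := by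
  have h1 := Real.sq_sqrt ha
  have h2 := Real.sq_sqrt hb
  have h3 := Real.sqrt_nonneg a
  have h4 := Real.sqrt_nonneg b
  rcases le_total b a with h | h
  · rw [abs_of_nonneg (by linarith)]
    nlinarith [Real.sqrt_le_sqrt h]
  · rw [abs_of_nonpos (by linarith)]
    nlinarith [Real.sqrt_le_sqrt h]

theorem hell_le_l1 {p q : X → ℝ} (hp : ∀ x, 0 ≤ p x) (hq : ∀ x, 0 ≤ q x) :
    hell p q ≤ l1 p q := by
  unfold hell l1
  gcongr with x
  exact sq_sqrt_sub_sqrt_le (hp x) (hq x)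

/-- Data processing for the map to a point: Cauchy–Schwarz bounds the affinity by `√a * √b`. -/
theorem sq_sub_le_hell {p q : X → ℝ} (hp : ∀ x, 0 ≤ p x) (hq : ∀ x, 0 ≤ q x)
    {a b : ℝ} (ha : HasSum p a) (hb : HasSum q b) :
    ENNReal.ofReal ((√a - √b) ^ 2) ≤ hell p q := by
  have hs := summable_sqrt_mul hp hq ha.summable hb.summable
  have ha0 : 0 ≤ a := ha.nonneg hp
  have hb0 : 0 ≤ b := hb.nonneg hq
  set β := ∑' x, √(p x) * √(q x) with hβ
  have hβ0 : 0 ≤ β := tsum_nonneg fun x => by positivity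
  have hsum : HasSum (fun x => (√(p x) - √(q x)) ^ 2) (a + b - 2 * β) := by
    refine ((ha.add hb).sub (hs.hasSum.mul_left 2)).congr_fun ?_
    intro x
    rw [sub_sq, Real.sq_sqrt (hp x), Real.sq_sqrt (hq x)]
    ring
  have hcs : β ≤ √a * √b := by
    rw [← ENNReal.ofReal_le_ofReal_iff (by positivity), ← ENNReal.pow_le_pow_left_iff two_ne_zero]
    rw [hβ, ENNReal.ofReal_tsum_of_nonneg (fun x => by positivity) hs]
    have := ennreal_tsum_mul_sq_le (fun x => ENNReal.ofReal √(p x)) (fun x => ENNReal.ofReal √(q x))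
    simp only [← ENNReal.ofReal_pow (Real.sqrt_nonneg _), Real.sq_sqrt (hp _),
      Real.sq_sqrt (hq _), ← ENNReal.ofReal_mul (Real.sqrt_nonneg _)] at this
    rw [← ENNReal.ofReal_tsum_of_nonneg hp ha.summable,
      ← ENNReal.ofReal_tsum_of_nonneg hq hb.summable, ha.tsum_eq, hb.tsum_eq] at this
    refine this.trans (le_of_eq ?_)
    rw [← ENNReal.ofReal_mul ha0, ← ENNReal.ofReal_pow (by positivity), mul_pow,
      Real.sq_sqrt ha0, Real.sq_sqrt hb0]
  unfold hell
  rw [← ENNReal.ofReal_tsum_of_nonneg (fun x => sq_nonneg _) hsum.summable, hsum.tsum_eq]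
  refine ENNReal.ofReal_le_ofReal ?_
  rw [sub_sq, Real.sq_sqrt ha0, Real.sq_sqrt hb0]
  linarith

/-! ### Mixtures dominated by one component -/

section Mixtures

variable {L : ℕ}

theorem isProb_mix {p : Fin L → X → ℝ} (hp : ∀ i, IsProb (p i)) {b : Fin L → ℝ}
    (hb : ∀ i, 0 ≤ b i) (hsum : ∑ i, b i = 1) : IsProb fun x => ∑ i, b i * p i x := by
  refine ⟨fun x => Finset.sum_nonneg fun i _ => mul_nonneg (hb i) ((hp i).1 x), ?_⟩
  have := hasSum_sum (s := Finset.univ) fun i _ => (hp i).2.mul_left (b i)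
  simpa [hsum] using this

theorem l1_sum_le {p : Fin L → X → ℝ} (hp : ∀ i, IsProb (p i)) (z : Fin L → ℝ) :
    ∑' x, ENNReal.ofReal |∑ i, z i * p i x| ≤ ENNReal.ofReal (∑ i, |z i|) := by
  calc ∑' x, ENNReal.ofReal |∑ i, z i * p i x|
      ≤ ∑' x, ∑ i, ENNReal.ofReal |z i| * ENNReal.ofReal (p i x) := by
        gcongr with x
        simp only [← ENNReal.ofReal_mul (abs_nonneg _)]
        rw [← ENNReal.ofReal_sum_of_nonneg fun i _ => mul_nonneg (abs_nonneg _) ((hp i).1 x)]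
        refine ENNReal.ofReal_le_ofReal ((Finset.abs_sum_le_sum_abs _ _).trans (le_of_eq ?_))
        exact Finset.sum_congr rfl fun i _ => by rw [abs_mul, abs_of_nonneg ((hp i).1 x)]
    _ = ENNReal.ofReal (∑ i, |z i|) := by
        rw [Summable.tsum_finsetSum fun _ _ => ENNReal.summable,
          ENNReal.ofReal_sum_of_nonneg fun i _ => abs_nonneg _]
        refine Finset.sum_congr rfl fun i _ => ?_
        rw [ENNReal.tsum_mul_left, (hp i).tsum_ofReal, mul_one]

theorem l1_mix_component_le {p : Fin L → X → ℝ} (hp : ∀ i, IsProb (p i)) {b : Fin L → ℝ}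
    (hb : ∀ i, 0 ≤ b i) (hsum : ∑ i, b i = 1) (l : Fin L) :
    l1 (p l) (fun x => ∑ i, b i * p i x) ≤ ENNReal.ofReal (2 * (1 - b l)) := by
  classical
  have h := l1_sum_le hp (fun i => (if i = l then 1 else 0) - b i)
  refine le_trans (le_of_eq ?_) (h.trans (ENNReal.ofReal_le_ofReal ?_))
  · unfold l1
    refine tsum_congr fun x => ?_
    simp [sub_mul, Finset.sum_sub_distrib]
  · rw [← Finset.add_sum_erase _ _ (Finset.mem_univ l)]
    have h1 : b l ≤ 1 := hsum ▸ Finset.single_le_sum (fun i _ => hb i) (Finset.mem_univ l)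
    have h2 := Finset.add_sum_erase _ b (Finset.mem_univ l)
    rw [hsum] at h2
    have h3 : ∑ i ∈ Finset.univ.erase l, |(if i = l then (1 : ℝ) else 0) - b i|
        = ∑ i ∈ Finset.univ.erase l, b i := by
      refine Finset.sum_congr rfl fun i hi => ?_
      rw [if_neg (Finset.ne_of_mem_erase hi), zero_sub, abs_neg, abs_of_nonneg (hb i)]
    rw [h3, if_pos rfl, abs_of_nonneg (by linarith)]
    linarith

/-- Components `l`, `m` that carry most of the mass of two mixtures are close to each other if the
mixtures are. -/
theorem mul_l1_component_sq_le {p q : Fin L → X → ℝ} (hp : ∀ i, IsProb (p i))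
    (hq : ∀ i, IsProb (q i)) {b c : Fin L → ℝ} (hb : ∀ i, 0 ≤ b i) (hc : ∀ i, 0 ≤ c i)
    (l m : Fin L) :
    ENNReal.ofReal (∑ i, c i) * l1 (p l) (q m) ^ 2 ≤
      ENNReal.ofReal (24 * (∑ i, b i - b l) + 12 * (∑ i, c i - c m)
        + 24 * (√(∑ i, b i) - √(∑ i, c i)) ^ 2)
      + 12 * hell (fun x => ∑ i, b i * p i x) (fun x => ∑ i, c i * q i x) := by
  set B := ∑ i, b i with hB
  set C := ∑ i, c i with hC
  have hB0 : 0 ≤ B := Finset.sum_nonneg fun i _ => hb i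
  have hC0 : 0 ≤ C := Finset.sum_nonneg fun i _ => hc i
  have hbl : b l ≤ B := Finset.single_le_sum (fun i _ => hb i) (Finset.mem_univ l)
  have hcm : c m ≤ C := Finset.single_le_sum (fun i _ => hc i) (Finset.mem_univ m)
  rcases hC0.eq_or_lt with hC1 | hC1
  · simp [← hC1]
  -- With `B = 0` the first mixture cannot be normalized; then `24 (√B - √C)² = 24 C` absorbs the
  -- trivial bound `4 C`.
  rcases hB0.eq_or_lt with hB1 | hB1
  · have h1 : l1 (p l) (q m) ^ 2 ≤ ENNReal.ofReal 4 := by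
      calc l1 (p l) (q m) ^ 2 ≤ 2 ^ 2 := by gcongr; exact l1_le_two (hp l) (hq m)
        _ = _ := by norm_num
    calc _ ≤ ENNReal.ofReal C * ENNReal.ofReal 4 := by gcongr
      _ = ENNReal.ofReal (C * 4) := by rw [ENNReal.ofReal_mul hC0]
      _ ≤ _ := by
        refine le_add_right (ENNReal.ofReal_le_ofReal ?_)
        rw [← hB1, Real.sqrt_zero, show (0 - √C) ^ 2 = √C ^ 2 by ring, Real.sq_sqrt hC0]
        have : b l = 0 := le_antisymm (hB1 ▸ hbl) (hb l)
        linarith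
  set P : X → ℝ := fun x => ∑ i, b i / B * p i x with hP
  set Q : X → ℝ := fun x => ∑ i, c i / C * q i x with hQ
  have sb : ∑ i, b i / B = 1 := by rw [← Finset.sum_div, div_self hB1.ne']
  have sc : ∑ i, c i / C = 1 := by rw [← Finset.sum_div, div_self hC1.ne']
  have nb : ∀ i, 0 ≤ b i / B := fun i => div_nonneg (hb i) hB0
  have nc : ∀ i, 0 ≤ c i / C := fun i => div_nonneg (hc i) hC0
  have iP : IsProb P := isProb_mix hp nb sb
  have iQ : IsProb Q := isProb_mix hq nc sc
  set η := 1 - b l / B with hη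
  set ζ := 1 - c m / C with hζ
  have hη0 : 0 ≤ η := by rw [hη, sub_nonneg, div_le_one hB1]; exact hbl
  have hζ0 : 0 ≤ ζ := by rw [hζ, sub_nonneg, div_le_one hC1]; exact hcm
  have hη1 : η ≤ 1 := by rw [hη]; linarith [nb l]
  have hζ1 : ζ ≤ 1 := by rw [hζ]; linarith [nc m]
  have eη : B * η = B - b l := by rw [hη]; field_simp
  have eζ : C * ζ = C - c m := by rw [hζ]; field_simp
  -- Triangle inequality through the normalized mixtures; each component is within twice the missing
  -- mass of its mixture.
  have t1 : l1 (p l) (q m) ≤ ENNReal.ofReal (2 * η) + l1 P Q + ENNReal.ofReal (2 * ζ) := by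
    refine (l1_triangle _ Q _).trans (add_le_add ((l1_triangle _ P _).trans ?_) ?_)
    · gcongr
      exact l1_mix_component_le hp nb sb l
    · rw [l1_comm]
      exact l1_mix_component_le hq nc sc m
  have key := mul_l1_sq_le_hell iP iQ hB0 hC0
  have eqP : (fun x => B * P x) = fun x => ∑ i, b i * p i x := by
    funext x
    simp only [hP, Finset.mul_sum]
    exact Finset.sum_congr rfl fun i _ => by field_simp
  have eqQ : (fun x => C * Q x) = fun x => ∑ i, c i * q i x := by
    funext x
    simp only [hQ, Finset.mul_sum]
    exact Finset.sum_congr rfl fun i _ => by field_simp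
  rw [eqP, eqQ] at key
  have hfin : l1 P Q ≠ ∞ := ((l1_le_two iP iQ).trans_lt (by norm_num)).ne
  set D := (l1 P Q).toReal with hD
  have hD' : l1 P Q = ENNReal.ofReal D := (ENNReal.ofReal_toReal hfin).symm
  have hD0 : 0 ≤ D := ENNReal.toReal_nonneg
  rw [hD'] at t1 key
  rw [← ENNReal.ofReal_add (by positivity) hD0, ← ENNReal.ofReal_add (by positivity)
    (by positivity)] at t1
  calc ENNReal.ofReal C * l1 (p l) (q m) ^ 2
      ≤ ENNReal.ofReal C * ENNReal.ofReal (2 * η + D + 2 * ζ) ^ 2 := by gcongr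
    _ = ENNReal.ofReal (C * (2 * η + D + 2 * ζ) ^ 2) := by
        rw [ENNReal.ofReal_mul hC0, ENNReal.ofReal_pow (by positivity)]
    _ ≤ ENNReal.ofReal ((24 * (B - b l) + 12 * (C - c m) + 24 * (√B - √C) ^ 2)
          + 3 * (C * D ^ 2)) := by
        refine ENNReal.ofReal_le_ofReal ?_
        have s1 : (2 * η + D + 2 * ζ) ^ 2 ≤ 12 * η ^ 2 + 3 * D ^ 2 + 12 * ζ ^ 2 := by
          nlinarith [sq_nonneg (2 * η - D), sq_nonneg (2 * η - 2 * ζ), sq_nonneg (D - 2 * ζ)]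
        have s2 : C * ζ ^ 2 ≤ C - c m := by rw [← eζ]; nlinarith [mul_nonneg hC0 hζ0]
        -- `C` is traded for `B`, since the mass missed by `l` is `B * η` and not `C * η`.
        have s3 : C ≤ 2 * B + 2 * (√B - √C) ^ 2 := by
          nlinarith [sq_nonneg (2 * √B - √C), Real.sq_sqrt hB0, Real.sq_sqrt hC0]
        have s4 : C * η ^ 2 ≤ 2 * (B - b l) + 2 * (√B - √C) ^ 2 := by
          have : C * η ^ 2 ≤ (2 * B + 2 * (√B - √C) ^ 2) * η := by
            calc C * η ^ 2 ≤ C * η := by nlinarith [mul_nonneg hC0 hη0]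
              _ ≤ _ := by gcongr
          have h5 : (√B - √C) ^ 2 * η ≤ (√B - √C) ^ 2 :=
            mul_le_of_le_one_right (sq_nonneg _) hη1
          linarith
        have := mul_le_mul_of_nonneg_left s1 hC0
        linarith
    _ = ENNReal.ofReal (24 * (B - b l) + 12 * (C - c m) + 24 * (√B - √C) ^ 2)
          + 3 * (ENNReal.ofReal C * ENNReal.ofReal D ^ 2) := by
        rw [ENNReal.ofReal_add (by nlinarith [sq_nonneg (√B - √C)]) (by positivity),
          ENNReal.ofReal_mul (by norm_num), ENNReal.ofReal_mul hC0, ENNReal.ofReal_pow hD0]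
        simp
    _ ≤ _ := by
        refine add_le_add le_rfl ?_
        calc 3 * (ENNReal.ofReal C * ENNReal.ofReal D ^ 2) ≤ 3 * (4 * _) := by
              gcongr
          _ = _ := by rw [← mul_assoc]; norm_num

end Mixtures

end Distances

/-! ### Recovering mixture weights by a linear map bounded in `ℓ¹` -/

section LeftInverse

variable {X : Type*} {L : ℕ}

/-- Diagonal dominance of the columns: column `j` loses at most `G j j - 1 / 2` off the diagonal.
This gives invertibility and the norm bound `2` of the inverse at once. -/
theorem half_sum_abs_le_mulVec {G : Matrix (Fin L) (Fin L) ℝ}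
    (hG : ∀ j, 1 / 2 + ∑ i ∈ Finset.univ.erase j, |G i j| ≤ G j j) (z : Fin L → ℝ) :
    1 / 2 * ∑ i, |z i| ≤ ∑ i, |G.mulVec z i| := by
  have h1 : ∀ i, G i i * |z i| - ∑ j ∈ Finset.univ.erase i, |G i j| * |z j| ≤ |G.mulVec z i| := by
    intro i
    have e : G.mulVec z i = G i i * z i + ∑ j ∈ Finset.univ.erase i, G i j * z j := by
      simp only [Matrix.mulVec, dotProduct]
      rw [Finset.add_sum_erase _ (fun j => G i j * z j) (Finset.mem_univ i)]
    have h0 : 0 ≤ G i i := le_trans (by positivity) (hG i)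
    have h2 : |∑ j ∈ Finset.univ.erase i, G i j * z j|
        ≤ ∑ j ∈ Finset.univ.erase i, |G i j| * |z j| :=
      (Finset.abs_sum_le_sum_abs _ _).trans (le_of_eq (Finset.sum_congr rfl fun j _ => abs_mul _ _))
    have h3 : |G i i * z i| = G i i * |z i| := by rw [abs_mul, abs_of_nonneg h0]
    have h4 := abs_sub_abs_le_abs_sub (G i i * z i) (-(∑ j ∈ Finset.univ.erase i, G i j * z j))
    rw [abs_neg, sub_neg_eq_add, ← e, h3] at h4
    linarith
  have h2 : ∑ i, ∑ j ∈ Finset.univ.erase i, |G i j| * |z j|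
      = ∑ j, ∑ i ∈ Finset.univ.erase j, |G i j| * |z j| := by
    refine Finset.sum_comm' ?_
    intro i j
    simp [ne_comm]
  calc 1 / 2 * ∑ i, |z i| = ∑ j, 1 / 2 * |z j| := Finset.mul_sum _ _ _
    _ ≤ ∑ j, (G j j * |z j| - ∑ i ∈ Finset.univ.erase j, |G i j| * |z j|) := by
        refine Finset.sum_le_sum fun j _ => ?_
        rw [← Finset.sum_mul, ← sub_mul]
        exact mul_le_mul_of_nonneg_right (by linarith [hG j]) (abs_nonneg _)
    _ = ∑ i, (G i i * |z i| - ∑ j ∈ Finset.univ.erase i, |G i j| * |z j|) := by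
        rw [Finset.sum_sub_distrib, Finset.sum_sub_distrib, h2]
    _ ≤ _ := Finset.sum_le_sum fun i _ => h1 i

/-- The mixture weights of well separated laws `p i`, `i ∈ t`, are recovered from the mixture by a
linear map that is bounded in `ℓ¹`; it is applied here to the mixtures of the laws `q j`. -/
theorem exists_latent_map {p q : Fin L → X → ℝ} (hp : ∀ i, IsProb (p i)) (hq : ∀ i, IsProb (q i))
    (t : Finset (Fin L))
    (hsep : ∀ i ∈ t, ∀ j ∈ t, i ≠ j → ∑' x, √(p i x) * √(p j x) ≤ 1 / (2 * L)) :
    ∃ J : Matrix (Fin L) (Fin L) ℝ, ∀ c u : Fin L → ℝ, (∀ i ∉ t, c i = 0) →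
      ENNReal.ofReal (∑ i, |J.mulVec u i - c i|)
        ≤ 2 * l1 (fun x => ∑ j, u j * q j x) (fun x => ∑ i, c i * p i x) := by
  -- `Y` is the posterior of the index for uniform weights on `t`, used as a soft classifier.
  classical
  set Y : Fin L → X → ℝ := fun i x => if i ∈ t then p i x / ∑ k ∈ t, p k x else 0 with hY
  have hden : ∀ x, 0 ≤ ∑ k ∈ t, p k x := fun x => Finset.sum_nonneg fun k _ => (hp k).1 x
  have hY0 : ∀ i x, 0 ≤ Y i x := by
    intro i x
    simp only [hY]
    split_ifs
    · exact div_nonneg ((hp i).1 x) (hden x)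
    · exact le_rfl
  have hYsum : ∀ x, ∑ i, Y i x = if ∑ k ∈ t, p k x = 0 then 0 else 1 := by
    intro x
    simp only [hY, Finset.sum_ite_mem, Finset.univ_inter]
    rw [← Finset.sum_div]
    split_ifs with h
    · rw [h, div_zero]
    · exact div_self h
  have hYsum1 : ∀ x, ∑ i, Y i x ≤ 1 := by
    intro x
    rw [hYsum]
    split_ifs <;> norm_num
  have hY1 : ∀ i x, Y i x ≤ 1 := fun i x =>
    (Finset.single_le_sum (fun j _ => hY0 j x) (Finset.mem_univ i)).trans (hYsum1 x)
  have hsm : ∀ i (f : X → ℝ), Summable f → (∀ x, 0 ≤ f x) → Summable fun x => Y i x * f x :=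
    fun i f hf hf0 => Summable.of_nonneg_of_le (fun x => mul_nonneg (hY0 i x) (hf0 x))
      (fun x => mul_le_of_le_one_left (hf0 x) (hY1 i x)) hf
  have hsp : ∀ i j, Summable fun x => Y i x * p j x :=
    fun i j => hsm i _ (hp j).2.summable (hp j).1
  have hsq : ∀ i j, Summable fun x => Y i x * q j x :=
    fun i j => hsm i _ (hq j).2.summable (hq j).1
  -- The confusion matrix of the classifier, completed by unit columns outside `t` to stay
  -- invertible.
  set G : Matrix (Fin L) (Fin L) ℝ := Matrix.of fun i j =>
    if j ∈ t then ∑' x, Y i x * p j x else if i = j then 1 else 0 with hG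
  have hoff : ∀ j ∈ t, ∀ i, i ≠ j → G i j ≤ 1 / (4 * L) := by
    intro j hj i hij
    simp only [hG, Matrix.of_apply, if_pos hj]
    by_cases hi : i ∈ t
    -- Confusion is at most half the affinity, from `p i * p j / (p i + p j) ≤ √(p i * p j) / 2`.
    · calc ∑' x, Y i x * p j x ≤ ∑' x, 1 / 2 * (√(p i x) * √(p j x)) := by
            refine Summable.tsum_le_tsum (fun x => ?_) (hsp i j)
              ((summable_sqrt_mul (hp i).1 (hp j).1 (hp i).2.summable (hp j).2.summable).mul_left _)
            simp only [hY, if_pos hi]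
            rcases (hden x).eq_or_lt with h | h
            · rw [← h, div_zero, zero_mul]; positivity
            have hle : p i x + p j x ≤ ∑ k ∈ t, p k x := by
              rw [← Finset.sum_pair (f := fun k => p k x) hij]
              exact Finset.sum_le_sum_of_subset_of_nonneg (by
                intro k hk
                simp only [Finset.mem_insert, Finset.mem_singleton] at hk
                rcases hk with rfl | rfl <;> assumption) fun k _ _ => (hp k).1 x
            rw [div_mul_eq_mul_div, div_le_iff₀ h]
            have a1 := Real.sq_sqrt ((hp i).1 x)
            have a2 := Real.sq_sqrt ((hp j).1 x)
            set a := √(p i x)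
            set b := √(p j x)
            have ha : 0 ≤ a := Real.sqrt_nonneg _
            have hb : 0 ≤ b := Real.sqrt_nonneg _
            rw [← a1, ← a2] at hle
            rw [← a1, ← a2]
            calc a ^ 2 * b ^ 2 ≤ 1 / 2 * (a * b) * (a ^ 2 + b ^ 2) := by
                  nlinarith [mul_nonneg (mul_nonneg ha hb) (sq_nonneg (a - b))]
              _ ≤ _ := by gcongr
        _ = 1 / 2 * ∑' x, √(p i x) * √(p j x) := tsum_mul_left
        _ ≤ 1 / 2 * (1 / (2 * L)) := by gcongr; exact hsep i hi j hj hij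
        _ = 1 / (4 * L) := by ring
    · simp only [hY, if_neg hi, zero_mul, tsum_zero]
      positivity
  have hG0 : ∀ i j, 0 ≤ G i j := by
    intro i j
    simp only [hG, Matrix.of_apply]
    split_ifs
    · exact tsum_nonneg fun x => mul_nonneg (hY0 i x) ((hp j).1 x)
    · exact zero_le_one
    · exact le_rfl
  have hcol : ∀ j ∈ t, ∑ i, G i j = 1 := by
    intro j hj
    simp only [hG, Matrix.of_apply, if_pos hj]
    rw [← Summable.tsum_finsetSum fun i _ => hsp i j, ← (hp j).2.tsum_eq]
    refine tsum_congr fun x => ?_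
    rw [← Finset.sum_mul, hYsum]
    split_ifs with h
    · rw [Finset.sum_eq_zero_iff_of_nonneg fun k _ => (hp k).1 x] at h
      rw [h j hj, mul_zero]
    · rw [one_mul]
  have hdom : ∀ j, 1 / 2 + ∑ i ∈ Finset.univ.erase j, |G i j| ≤ G j j := by
    intro j
    have hL : (0 : ℝ) < L := by exact_mod_cast (Fin.pos j)
    simp only [abs_of_nonneg (hG0 _ _)]
    by_cases hj : j ∈ t
    · have h1 : ∑ i ∈ Finset.univ.erase j, G i j ≤ 1 / 4 := by
        calc ∑ i ∈ Finset.univ.erase j, G i j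
            ≤ ∑ _i ∈ Finset.univ.erase j, 1 / (4 * (L : ℝ)) :=
              Finset.sum_le_sum fun i hi => hoff j hj i (Finset.ne_of_mem_erase hi)
          _ ≤ ∑ _i : Fin L, 1 / (4 * (L : ℝ)) :=
              Finset.sum_le_sum_of_subset_of_nonneg (Finset.erase_subset _ _)
                fun _ _ _ => by positivity
          _ = 1 / 4 := by
              rw [Finset.sum_const, Finset.card_univ, Fintype.card_fin, nsmul_eq_mul]
              field_simp
      have h2 := Finset.add_sum_erase _ (fun i => G i j) (Finset.mem_univ j)
      simp only [hcol j hj] at h2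
      linarith
    · have h1 : ∑ i ∈ Finset.univ.erase j, G i j = 0 := by
        refine Finset.sum_eq_zero fun i hi => ?_
        simp only [hG, Matrix.of_apply, if_neg hj, if_neg (Finset.ne_of_mem_erase hi)]
      have h2 : G j j = 1 := by simp only [hG, Matrix.of_apply, if_neg hj, if_true]
      rw [h1, h2]
      norm_num
  have hlow := half_sum_abs_le_mulVec hdom
  have hdet : IsUnit G.det := by
    rw [isUnit_iff_ne_zero]
    intro h0
    obtain ⟨v, hv, hv0⟩ := Matrix.exists_mulVec_eq_zero_iff.2 h0
    have h1 := hlow v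
    rw [hv0] at h1
    simp only [Pi.zero_apply, abs_zero, Finset.sum_const_zero] at h1
    refine hv (funext fun i => ?_)
    have h2 : |v i| ≤ ∑ i, |v i| := Finset.single_le_sum (fun i _ => abs_nonneg (v i))
      (Finset.mem_univ i)
    exact abs_eq_zero.1 (le_antisymm (by linarith) (abs_nonneg _))
  -- `N u` is the classifier applied to the mixture of the `q j`; `G⁻¹` corrects for confusion.
  set N : Matrix (Fin L) (Fin L) ℝ := Matrix.of fun i j => ∑' x, Y i x * q j x with hN
  refine ⟨G⁻¹ * N, fun c u hc => ?_⟩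
  have e1 : G.mulVec (fun i => (G⁻¹ * N).mulVec u i - c i)
      = fun i => ∑' x, Y i x * (∑ j, u j * q j x - ∑ j, c j * p j x) := by
    have : (fun i => (G⁻¹ * N).mulVec u i - c i) = (G⁻¹ * N).mulVec u - c := rfl
    rw [this, Matrix.mulVec_sub, Matrix.mulVec_mulVec, Matrix.mul_nonsing_inv_cancel_left _ _ hdet]
    funext i
    simp only [Pi.sub_apply, Matrix.mulVec, dotProduct, hN, hG, Matrix.of_apply]
    have l1' : HasSum (fun x => Y i x * ∑ j, u j * q j x) (∑ j, (∑' x, Y i x * q j x) * u j) := by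
      refine (hasSum_sum (s := Finset.univ) fun j _ => (hsq i j).hasSum.mul_right (u j)).congr_fun
        fun x => ?_
      rw [Finset.mul_sum]
      exact Finset.sum_congr rfl fun j _ => by ring
    have l2' : HasSum (fun x => Y i x * ∑ j, c j * p j x) (∑ j, (∑' x, Y i x * p j x) * c j) := by
      refine (hasSum_sum (s := Finset.univ) fun j _ => (hsp i j).hasSum.mul_right (c j)).congr_fun
        fun x => ?_
      rw [Finset.mul_sum]
      exact Finset.sum_congr rfl fun j _ => by ring
    have e2 : ∑ j, (if j ∈ t then ∑' x, Y i x * p j x else if i = j then 1 else 0) * c j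
        = ∑ j, (∑' x, Y i x * p j x) * c j := by
      refine Finset.sum_congr rfl fun j _ => ?_
      by_cases hj : j ∈ t
      · rw [if_pos hj]
      · rw [hc j hj, mul_zero, mul_zero]
    rw [e2, ← (l1'.sub l2').tsum_eq]
    refine tsum_congr fun x => ?_
    rw [mul_sub]
  have h1 := hlow fun i => (G⁻¹ * N).mulVec u i - c i
  rw [e1] at h1
  set f : X → ℝ := fun x => ∑ j, u j * q j x - ∑ j, c j * p j x with hf
  have hfs : Summable f :=
    (summable_sum fun j _ => (hq j).2.summable.mul_left (u j)).sub
      (summable_sum fun j _ => (hp j).2.summable.mul_left (c j))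
  -- The classifier contracts `ℓ¹`, because its values add up to at most one.
  have h2 : ∑ i, |∑' x, Y i x * f x| ≤ ∑' x, |f x| := by
    have hs' : ∀ i, Summable fun x => Y i x * |f x| := fun i => hsm i _ hfs.abs fun x => abs_nonneg _
    calc ∑ i, |∑' x, Y i x * f x| ≤ ∑ i, ∑' x, Y i x * |f x| := by
          refine Finset.sum_le_sum fun i _ => ?_
          have hab : ∀ x, |Y i x * f x| = Y i x * |f x| := fun x => by
            rw [abs_mul, abs_of_nonneg (hY0 i x)]
          have hs2 : Summable fun x => ‖Y i x * f x‖ := by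
            simpa only [Real.norm_eq_abs, hab] using hs' i
          have := norm_tsum_le_tsum_norm hs2
          simpa only [Real.norm_eq_abs, hab] using this
      _ = ∑' x, ∑ i, Y i x * |f x| := (Summable.tsum_finsetSum fun i _ => hs' i).symm
      _ ≤ ∑' x, |f x| := by
          refine Summable.tsum_le_tsum (fun x => ?_) (summable_sum fun i _ => hs' i) hfs.abs
          rw [← Finset.sum_mul]
          exact mul_le_of_le_one_left (abs_nonneg _) (hYsum1 x)
  calc ENNReal.ofReal (∑ i, |(G⁻¹ * N).mulVec u i - c i|)
      ≤ ENNReal.ofReal (2 * ∑' x, |f x|) := ENNReal.ofReal_le_ofReal (by linarith)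
    _ = 2 * l1 _ _ := by
        rw [ENNReal.ofReal_mul (by norm_num), ENNReal.ofReal_tsum_of_nonneg
          (fun x => abs_nonneg _) hfs.abs]
        simp only [l1, hf, ENNReal.ofReal_ofNat]

end LeftInverse

/-! ### The elliptic potential, with contexts -/

section Potential

open Matrix

variable {n : ℕ}

theorem exists_factor {Λ : Matrix (Fin n) (Fin n) ℝ} (hΛ : Λ.PosDef) :
    ∃ B : Matrix (Fin n) (Fin n) ℝ, Λ = Bᵀ * B ∧ IsUnit B.det := by
  have h : ∃ B : Matrix (Fin n) (Fin n) ℝ, Λ = Bᵀ * B := by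
    open scoped MatrixOrder in
    obtain ⟨B, hB⟩ := CStarAlgebra.nonneg_iff_eq_star_mul_self.mp hΛ.posSemidef.nonneg
    exact ⟨B, by rw [hB, star_eq_conjTranspose, conjTranspose_eq_transpose_of_trivial]⟩
  obtain ⟨B, hB⟩ := h
  refine ⟨B, hB, ?_⟩
  have := hΛ.det_pos
  rw [hB, det_mul, det_transpose] at this
  rw [isUnit_iff_ne_zero]
  rintro h0
  rw [h0] at this
  simp at this

/-- In eigenvalues this is `1 + ∑ λᵢ ≤ ∏ (1 + λᵢ)`; the determinant is read off the characteristic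
polynomial at `-1`. -/
theorem one_add_trace_le_det {M : Matrix (Fin n) (Fin n) ℝ} (hM : M.PosSemidef) :
    1 + M.trace ≤ (1 + M).det := by
  have h1 : (1 + M).det = ∏ i, (1 + hM.1.eigenvalues i) := by
    have h2 := congrArg (Polynomial.eval (-1)) hM.1.charpoly_eq
    rw [eval_charpoly, Polynomial.eval_prod] at h2
    have e1 : (scalar (Fin n) (-1 : ℝ)) - M = -(1 + M) := by
      rw [map_neg, map_one]
      abel
    rw [e1, det_neg] at h2
    have e2 : ∏ i, Polynomial.eval (-1) (Polynomial.X - Polynomial.C ((hM.1.eigenvalues i : ℝ)))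
        = (-1) ^ Fintype.card (Fin n) * ∏ i, (1 + hM.1.eigenvalues i) := by
      rw [← Finset.card_univ, ← Finset.prod_const, ← Finset.prod_mul_distrib]
      refine Finset.prod_congr rfl fun i _ => ?_
      simp
      ring
    have h3 := h2.trans e2
    exact mul_left_cancel₀ (pow_ne_zero _ (by norm_num)) h3
  have h2 : M.trace = ∑ i, hM.1.eigenvalues i := by
    simpa using hM.1.trace_eq_sum_eigenvalues
  rw [h1, h2]
  have key : ∀ t : Finset (Fin n), 1 + ∑ i ∈ t, hM.1.eigenvalues i
      ≤ ∏ i ∈ t, (1 + hM.1.eigenvalues i) := by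
    intro t
    induction t using Finset.induction_on with
    | empty => simp
    | insert a t ha ih =>
      rw [Finset.sum_insert ha, Finset.prod_insert ha]
      have h3 := hM.eigenvalues_nonneg a
      have h4 : 0 ≤ ∑ i ∈ t, hM.1.eigenvalues i :=
        Finset.sum_nonneg fun i _ => hM.eigenvalues_nonneg i
      have h5 := mul_le_mul_of_nonneg_left ih (show 0 ≤ 1 + hM.1.eigenvalues a by linarith)
      nlinarith [mul_nonneg h3 h4]
  exact key _

/-- A congruence reduces to `Λ = 1`. The update may have any rank, since one round adds an average
of many rank-one terms. -/
theorem det_mul_one_add_trace_le {Λ Δ : Matrix (Fin n) (Fin n) ℝ} (hΛ : Λ.PosDef)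
    (hΔ : Δ.PosSemidef) : Λ.det * (1 + (Λ⁻¹ * Δ).trace) ≤ (Λ + Δ).det := by
  obtain ⟨B, hB, hu⟩ := exists_factor hΛ
  have hut : IsUnit Bᵀ.det := by rwa [det_transpose]
  set C := B⁻¹ with hC
  have h1 : (Cᵀ * Δ * C).PosSemidef := by
    have := hΔ.conjTranspose_mul_mul_same C
    rwa [conjTranspose_eq_transpose_of_trivial] at this
  have h2 : Λ + Δ = Bᵀ * (1 + Cᵀ * Δ * C) * B := by
    have e1 : C * B = 1 := nonsing_inv_mul _ hu
    have e2 : Bᵀ * Cᵀ = 1 := by rw [← transpose_mul, e1, transpose_one]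
    rw [mul_add, add_mul, mul_one, ← hB]
    congr 1
    calc Δ = (Bᵀ * Cᵀ) * Δ * (C * B) := by rw [e1, e2, one_mul, mul_one]
      _ = _ := by simp only [Matrix.mul_assoc]
  have h3 : (Λ⁻¹ * Δ).trace = (Cᵀ * Δ * C).trace := by
    rw [hB, Matrix.mul_inv_rev, ← transpose_nonsing_inv, ← hC, Matrix.mul_assoc, trace_mul_comm]
  rw [h2, h3, det_mul, det_mul, hB, det_mul]
  have := mul_le_mul_of_nonneg_left (one_add_trace_le_det h1) (mul_self_nonneg B.det)
  rw [det_transpose]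
  nlinarith

/-- The tangent of the logarithm at `m`, summed over the eigenvalues. -/
theorem log_det_le {Λ : Matrix (Fin n) (Fin n) ℝ} (hΛ : Λ.PosDef) {m : ℝ} (hm : 0 < m)
    (htr : Λ.trace ≤ n * m) : Real.log Λ.det ≤ n * Real.log m := by
  have h1 : Λ.det = ∏ i, hΛ.1.eigenvalues i := by simpa using hΛ.1.det_eq_prod_eigenvalues
  have h2 : Λ.trace = ∑ i, hΛ.1.eigenvalues i := by simpa using hΛ.1.trace_eq_sum_eigenvalues
  rw [h1, Real.log_prod fun i _ => (hΛ.eigenvalues_pos i).ne']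
  have h3 : ∀ i, Real.log (hΛ.1.eigenvalues i)
      ≤ Real.log m - 1 + m⁻¹ * hΛ.1.eigenvalues i := by
    intro i
    have hp := hΛ.eigenvalues_pos i
    have := Real.log_le_sub_one_of_pos (div_pos hp hm)
    rw [Real.log_div hp.ne' hm.ne', div_eq_inv_mul] at this
    linarith
  refine (Finset.sum_le_sum fun i _ => h3 i).trans ?_
  rw [Finset.sum_add_distrib, ← Finset.mul_sum, ← h2, Finset.sum_const, Finset.card_univ,
    Fintype.card_fin, nsmul_eq_mul]
  have : m⁻¹ * Λ.trace ≤ n := by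
    rw [inv_mul_le_iff₀ hm, mul_comm]
    exact htr
  linarith

theorem min_one_le_two_mul_log {x : ℝ} (hx : 0 ≤ x) : min 1 x ≤ 2 * Real.log (1 + x) := by
  have key : ∀ y : ℝ, 0 ≤ y → y ≤ 1 → y ≤ 2 * Real.log (1 + y) := by
    intro y h0 h1
    have h2 := Real.one_sub_inv_le_log_of_pos (show 0 < 1 + y by linarith)
    have h3 : y / 2 ≤ 1 - (1 + y)⁻¹ := by
      have h4 : (1 + y)⁻¹ ≤ 1 - y / 2 := by
        rw [inv_le_iff_one_le_mul₀ (by linarith)]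
        nlinarith
      linarith
    linarith
  rcases le_total x 1 with h | h
  · rw [min_eq_right h]; exact key x hx h
  · rw [min_eq_left h]
    refine (key 1 zero_le_one le_rfl).trans ?_
    gcongr

/-- The elliptic potential lemma. -/
theorem elliptic_potential {lam b : ℝ} (hn : 0 < n) (hlam : 0 < lam) (K : ℕ)
    (Δ : ℕ → Matrix (Fin n) (Fin n) ℝ) (hΔ : ∀ k, (Δ k).PosSemidef) (htr : ∀ k, (Δ k).trace ≤ b) :
    ∑ k ∈ Finset.range K, min 1 (((lam • (1 : Matrix (Fin n) (Fin n) ℝ)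
        + ∑ t ∈ Finset.range k, Δ t)⁻¹ * Δ k).trace)
      ≤ 2 * (n * Real.log (1 + K * b / (n * lam))) := by
  set Λ : ℕ → Matrix (Fin n) (Fin n) ℝ := fun k => lam • (1 : Matrix (Fin n) (Fin n) ℝ)
        + ∑ t ∈ Finset.range k, Δ t with hΛdef
  have hΛ : ∀ k, (Λ k).PosDef := fun k =>
    (PosDef.one.smul hlam).add_posSemidef (posSemidef_sum _ fun t _ => hΔ t)
  have hb : 0 ≤ b := (hΔ 0).trace_nonneg.trans (htr 0)
  have htn : ∀ k, 0 ≤ ((Λ k)⁻¹ * Δ k).trace := by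
    intro k
    obtain ⟨B, hB, hu⟩ := exists_factor (hΛ k)
    have : ((Λ k)⁻¹ * Δ k).trace = (B⁻¹ᵀ * Δ k * B⁻¹).trace := by
      rw [hB, Matrix.mul_inv_rev, ← transpose_nonsing_inv, Matrix.mul_assoc, trace_mul_comm]
    rw [this]
    have := (hΔ k).conjTranspose_mul_mul_same B⁻¹
    rw [conjTranspose_eq_transpose_of_trivial] at this
    exact this.trace_nonneg
  have hstep : ∀ k, min 1 (((Λ k)⁻¹ * Δ k).trace)
      ≤ 2 * (Real.log (Λ (k + 1)).det - Real.log (Λ k).det) := by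
    intro k
    refine (min_one_le_two_mul_log (htn k)).trans ?_
    have h1 := det_mul_one_add_trace_le (hΛ k) (hΔ k)
    have h2 : Λ (k + 1) = Λ k + Δ k := by
      simp only [hΛdef, Finset.sum_range_succ, add_assoc]
    rw [← h2] at h1
    have h3 : Real.log (Λ k).det + Real.log (1 + ((Λ k)⁻¹ * Δ k).trace)
        ≤ Real.log (Λ (k + 1)).det := by
      have hpos : 0 < 1 + ((Λ k)⁻¹ * Δ k).trace := by linarith [htn k]
      rw [← Real.log_mul (hΛ k).det_pos.ne' hpos.ne']
      exact Real.log_le_log (mul_pos (hΛ k).det_pos hpos) h1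
    linarith
  refine (Finset.sum_le_sum fun k _ => hstep k).trans ?_
  rw [← Finset.mul_sum, Finset.sum_range_sub fun k => Real.log (Λ k).det]
  have hn' : (0 : ℝ) < n := by exact_mod_cast hn
  have h0 : Real.log (Λ 0).det = n * Real.log lam := by
    simp [hΛdef]
  have hK : Real.log (Λ K).det ≤ n * Real.log (lam * (1 + K * b / (n * lam))) := by
    refine log_det_le (hΛ K) (by positivity) ?_
    simp only [hΛdef, trace_add, trace_smul, trace_one, trace_sum, Fintype.card_fin, smul_eq_mul]
    have : ∑ t ∈ Finset.range K, (Δ t).trace ≤ K * b := by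
      refine (Finset.sum_le_sum fun t _ => htr t).trans ?_
      simp
    have e : (n : ℝ) * (lam * (1 + K * b / (n * lam))) = lam * n + K * b := by
      field_simp
    rw [e]
    linarith
  rw [Real.log_mul hlam.ne' (by positivity)] at hK
  rw [h0]
  linarith

theorem dotProduct_sq_le {Λ : Matrix (Fin n) (Fin n) ℝ} (hΛ : Λ.PosDef) (g u : Fin n → ℝ) :
    (g ⬝ᵥ u) ^ 2 ≤ (g ⬝ᵥ Λ *ᵥ g) * (u ⬝ᵥ Λ⁻¹ *ᵥ u) := by
  obtain ⟨B, hB, hu⟩ := exists_factor hΛ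
  have e1 : g ⬝ᵥ Λ *ᵥ g = (B *ᵥ g) ⬝ᵥ (B *ᵥ g) := by
    rw [hB, ← mulVec_mulVec, dotProduct_mulVec, vecMul_transpose]
  have e2 : u ⬝ᵥ Λ⁻¹ *ᵥ u = (B⁻¹ᵀ *ᵥ u) ⬝ᵥ (B⁻¹ᵀ *ᵥ u) := by
    rw [hB, Matrix.mul_inv_rev, ← transpose_nonsing_inv, ← mulVec_mulVec, dotProduct_mulVec,
      ← vecMul_transpose, transpose_transpose]
  have e3 : g ⬝ᵥ u = (B *ᵥ g) ⬝ᵥ (B⁻¹ᵀ *ᵥ u) := by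
    rw [dotProduct_mulVec, vecMul_transpose, mulVec_mulVec, nonsing_inv_mul _ hu, one_mulVec]
  rw [e1, e2, e3]
  simp only [dotProduct, ← sq]
  exact Finset.sum_mul_sq_le_sq_mul_sq _ _ _

/-- If the errors `f k` of the rounds `t < k` have a small sum of squares, then the sum of the
errors `f k` of the rounds `k` is small, where the errors are seminorms of bounded features in
dimension `n`, one for each context, and the laws of the contexts are dominated by `w`. -/
theorem sq_sum_error_le {X Y : Type*} [DecidableEq X] (hn : 0 < n) {lam b c G D : ℝ}
    (hlam : 0 < lam) (hb : 0 ≤ b) (hG : 0 ≤ G) (K : ℕ) (s : Finset Y) (ctx : Y → X) (P : ℕ → Y → ℝ)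
    (hP : ∀ k y, 0 ≤ P k y) (hP1 : ∀ k, ∑ y ∈ s, P k y ≤ 1) (w : X → ℝ)
    (hw : ∀ k x, ∑ y ∈ s with ctx y = x, P k y ≤ w x) (hD : ∑ x ∈ s.image ctx, w x ≤ D)
    (u : Y → Fin n → ℝ) (hu : ∀ y, u y ⬝ᵥ u y ≤ b) (g : ℕ → Y → Fin n → ℝ)
    (hg : ∀ k y, g k y ⬝ᵥ g k y ≤ G) (f : ℕ → Y → ℝ) (hf0 : ∀ k y, 0 ≤ f k y)
    (hf : ∀ k y, f k y ≤ g k y ⬝ᵥ u y)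
    (hfg : ∀ k y y', ctx y = ctx y' → |g k y ⬝ᵥ u y'| ≤ f k y')
    (hfc : ∀ k y, f k y ≤ c) :
    (∑ k ∈ Finset.range K, ∑ y ∈ s, P k y * f k y) ^ 2 ≤
      (D * (2 * (n * Real.log (1 + K * b / (n * lam))))) *
        ∑ k ∈ Finset.range K,
          (c ^ 2 + lam * G + ∑ t ∈ Finset.range k, ∑ y ∈ s, P t y * f k y ^ 2) := by
  have hw0 : ∀ x, 0 ≤ w x := fun x => (Finset.sum_nonneg fun y _ => hP 0 y).trans (hw 0 x)
  -- Each context has its own covariance, normalized by `w x`, so that a round adds mass at most one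
  -- to it whatever the policy.
  set Δ : X → ℕ → Matrix (Fin n) (Fin n) ℝ := fun x k =>
    ∑ y ∈ s with ctx y = x, (P k y / w x) • vecMulVec (u y) (u y) with hΔdef
  have hΔ : ∀ x k, (Δ x k).PosSemidef := fun x k => posSemidef_sum _ fun y _ =>
    (by simpa using posSemidef_vecMulVec_self_star (u y) : (vecMulVec (u y) (u y)).PosSemidef).smul
      (div_nonneg (hP k y) (hw0 x))
  have hmass : ∀ x k, ∑ y ∈ s with ctx y = x, P k y / w x ≤ 1 := by
    intro x k
    rw [← Finset.sum_div]
    exact div_le_one_of_le₀ (hw k x) (hw0 x)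
  set Λ : X → ℕ → Matrix (Fin n) (Fin n) ℝ := fun x k =>
    lam • (1 : Matrix (Fin n) (Fin n) ℝ) + ∑ t ∈ Finset.range k, Δ x t with hΛdef
  have hΛ : ∀ x k, (Λ x k).PosDef := fun x k =>
    (PosDef.one.smul hlam).add_posSemidef (posSemidef_sum _ fun t _ => hΔ x t)
  set q : ℕ → Y → ℝ := fun k y => u y ⬝ᵥ (Λ (ctx y) k)⁻¹ *ᵥ u y with hq
  have hq0 : ∀ k y, 0 ≤ q k y := by
    intro k y
    simpa using (hΛ (ctx y) k).inv.posSemidef.dotProduct_mulVec_nonneg (u y)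
  set B : ℕ → X → ℝ := fun k x =>
    ∑ t ∈ Finset.range k, ∑ y ∈ s with ctx y = x, P t y * f k y ^ 2 with hBdef
  have hB0 : ∀ k x, 0 ≤ B k x := fun k x =>
    Finset.sum_nonneg fun t _ => Finset.sum_nonneg fun y _ => mul_nonneg (hP t y) (sq_nonneg _)
  -- `min 1 (q k y) * e k y` majorizes `f k y ^ 2`: by Cauchy–Schwarz in the norm of `Λ` if `q ≤ 1`,
  -- and by the trivial bound `c ^ 2` otherwise.
  set e : ℕ → Y → ℝ := fun k y => c ^ 2 + lam * G + B k (ctx y) / w (ctx y) with he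
  have he0 : ∀ k y, 0 ≤ e k y := fun k y => by
    have := div_nonneg (hB0 k (ctx y)) (hw0 (ctx y))
    positivity
  have hform : ∀ k y, g k y ⬝ᵥ Λ (ctx y) k *ᵥ g k y ≤ lam * G + B k (ctx y) / w (ctx y) := by
    intro k y
    have h1 : g k y ⬝ᵥ Λ (ctx y) k *ᵥ g k y = lam * (g k y ⬝ᵥ g k y)
        + ∑ t ∈ Finset.range k, ∑ y' ∈ s with ctx y' = ctx y,
          P t y' / w (ctx y) * (g k y ⬝ᵥ u y') ^ 2 := by
      simp only [hΛdef, hΔdef, add_mulVec, smul_mulVec, one_mulVec, dotProduct_add,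
        dotProduct_smul, smul_eq_mul, sum_mulVec, dotProduct_sum]
      congr 1
      refine Finset.sum_congr rfl fun t _ => Finset.sum_congr rfl fun y' _ => ?_
      rw [vecMulVec_mulVec]
      simp only [dotProduct_smul, MulOpposite.smul_eq_mul_unop, MulOpposite.unop_op]
      rw [dotProduct_comm (u y') (g k y)]
      ring
    rw [h1, hBdef, Finset.sum_div]
    refine add_le_add (mul_le_mul_of_nonneg_left (hg k y) hlam.le)
      (Finset.sum_le_sum fun t _ => ?_)
    rw [Finset.sum_div]
    refine Finset.sum_le_sum fun y' hy' => ?_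
    rw [div_mul_eq_mul_div]
    refine div_le_div_of_nonneg_right (mul_le_mul_of_nonneg_left ?_ (hP t y')) (hw0 _)
    rw [← sq_abs]
    exact pow_le_pow_left₀ (abs_nonneg _) (hfg k y y' (Finset.mem_filter.1 hy').2.symm) 2
  have hfe : ∀ k y, f k y ^ 2 ≤ min 1 (q k y) * e k y := by
    intro k y
    rcases le_total 1 (q k y) with h | h
    · rw [min_eq_left h, one_mul]
      have h1 := pow_le_pow_left₀ (hf0 k y) (hfc k y) 2
      have h2 := div_nonneg (hB0 k (ctx y)) (hw0 (ctx y))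
      have h3 := mul_nonneg hlam.le hG
      simp only [he]
      linarith
    · rw [min_eq_right h]
      calc f k y ^ 2 ≤ (g k y ⬝ᵥ u y) ^ 2 := pow_le_pow_left₀ (hf0 k y) (hf k y) 2
        _ ≤ (g k y ⬝ᵥ Λ (ctx y) k *ᵥ g k y) * q k y := dotProduct_sq_le (hΛ _ _) _ _
        _ ≤ e k y * q k y := by
            refine mul_le_mul_of_nonneg_right ((hform k y).trans ?_) (hq0 k y)
            simp only [he]
            linarith [sq_nonneg c]
        _ = _ := mul_comm _ _
  -- Cauchy–Schwarz separates the potential from the accumulated past errors.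
  have hcs : (∑ k ∈ Finset.range K, ∑ y ∈ s, P k y * f k y) ^ 2 ≤
      (∑ k ∈ Finset.range K, ∑ y ∈ s, P k y * min 1 (q k y)) *
        ∑ k ∈ Finset.range K, ∑ y ∈ s, P k y * e k y := by
    simp only [← Finset.sum_product']
    refine le_trans (pow_le_pow_left₀ (Finset.sum_nonneg fun z _ => mul_nonneg (hP _ _) (hf0 _ _))
      (Finset.sum_le_sum fun z _ => ?_) 2) (le_trans (Finset.sum_mul_sq_le_sq_mul_sq _
        (fun z : ℕ × Y => √(P z.1 z.2 * min 1 (q z.1 z.2)))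
        (fun z : ℕ × Y => √(P z.1 z.2 * e z.1 z.2))) (le_of_eq ?_))
    · have hm : 0 ≤ min 1 (q z.1 z.2) := le_min zero_le_one (hq0 _ _)
      rw [← Real.sqrt_mul (mul_nonneg (hP _ _) hm)]
      refine Real.le_sqrt_of_sq_le ?_
      rw [mul_pow]
      calc P z.1 z.2 ^ 2 * f z.1 z.2 ^ 2
          ≤ P z.1 z.2 ^ 2 * (min 1 (q z.1 z.2) * e z.1 z.2) := by gcongr; exact hfe _ _
        _ = _ := by ring
    · congr 1
      · refine Finset.sum_congr rfl fun z _ => Real.sq_sqrt ?_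
        exact mul_nonneg (hP _ _) (le_min zero_le_one (hq0 _ _))
      · exact Finset.sum_congr rfl fun z _ => Real.sq_sqrt (mul_nonneg (hP _ _) (he0 _ _))
  have hfiber : ∀ F : Y → ℝ, ∑ y ∈ s, F y = ∑ x ∈ s.image ctx, ∑ y ∈ s with ctx y = x, F y :=
    fun F => (Finset.sum_fiberwise_of_maps_to (fun y hy => Finset.mem_image_of_mem ctx hy) F).symm
  -- Contexts of weight zero carry no probability, so that dividing by `w` is harmless.
  have hzero : ∀ k y, y ∈ s → w (ctx y) = 0 → P k y = 0 := by
    intro k y hy hwy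
    have h1 := hw k (ctx y)
    rw [hwy] at h1
    refine le_antisymm (le_trans ?_ h1) (hP k y)
    exact Finset.single_le_sum (f := P k) (fun y _ => hP k y)
      (Finset.mem_filter.2 ⟨hy, rfl⟩)
  -- The potential of a context enters with the factor `w x`; the total is `D` times one potential,
  -- however many contexts there are.
  have hfirst : ∑ k ∈ Finset.range K, ∑ y ∈ s, P k y * min 1 (q k y)
      ≤ D * (2 * (n * Real.log (1 + K * b / (n * lam)))) := by
    have hlog : 0 ≤ 2 * (n * Real.log (1 + K * b / (n * lam))) := by
      have : 0 ≤ Real.log (1 + K * b / (n * lam)) := Real.log_nonneg (by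
        have : 0 ≤ K * b / (n * lam) := by positivity
        linarith)
      positivity
    calc ∑ k ∈ Finset.range K, ∑ y ∈ s, P k y * min 1 (q k y)
        = ∑ x ∈ s.image ctx, ∑ k ∈ Finset.range K,
            ∑ y ∈ s with ctx y = x, P k y * min 1 (q k y) := by
          exact (Finset.sum_congr rfl fun k _ => hfiber _).trans Finset.sum_comm
      _ ≤ ∑ x ∈ s.image ctx, w x * ∑ k ∈ Finset.range K,
            min 1 (((Λ x k)⁻¹ * Δ x k).trace) := by
          refine Finset.sum_le_sum fun x _ => ?_
          rw [Finset.mul_sum]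
          refine Finset.sum_le_sum fun k _ => ?_
          have h1 : ∑ y ∈ s with ctx y = x, P k y * min 1 (q k y)
              = w x * ∑ y ∈ s with ctx y = x, P k y / w x * min 1 (q k y) := by
            rw [Finset.mul_sum]
            refine Finset.sum_congr rfl fun y hy => ?_
            obtain ⟨hys, rfl⟩ := Finset.mem_filter.1 hy
            by_cases h0 : w (ctx y) = 0
            · rw [hzero k y hys h0, h0]; simp
            · field_simp
          rw [h1]
          refine mul_le_mul_of_nonneg_left (le_min ?_ ?_) (hw0 x)
          · refine le_trans (Finset.sum_le_sum fun y _ => ?_) (hmass x k)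
            exact mul_le_of_le_one_right (div_nonneg (hP k y) (hw0 x)) (min_le_left _ _)
          · have h2 : ((Λ x k)⁻¹ * Δ x k).trace
                = ∑ y ∈ s with ctx y = x, P k y / w x * q k y := by
              simp only [hΔdef, Finset.mul_sum, trace_sum]
              refine Finset.sum_congr rfl fun y hy => ?_
              obtain ⟨hys, rfl⟩ := Finset.mem_filter.1 hy
              rw [Matrix.mul_smul, trace_smul, mul_vecMulVec, trace_vecMulVec, smul_eq_mul,
                dotProduct_comm]
            rw [h2]
            refine Finset.sum_le_sum fun y _ => ?_
            exact mul_le_mul_of_nonneg_left (min_le_right _ _) (div_nonneg (hP k y) (hw0 x))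
      _ ≤ ∑ x ∈ s.image ctx, w x * (2 * (n * Real.log (1 + K * b / (n * lam)))) := by
          refine Finset.sum_le_sum fun x _ => mul_le_mul_of_nonneg_left ?_ (hw0 x)
          refine elliptic_potential hn hlam K (Δ x) (hΔ x) fun k => ?_
          simp only [hΔdef, trace_sum, trace_smul, trace_vecMulVec, smul_eq_mul]
          calc ∑ y ∈ s with ctx y = x, P k y / w x * (u y ⬝ᵥ u y)
              ≤ ∑ y ∈ s with ctx y = x, P k y / w x * b := by
                refine Finset.sum_le_sum fun y _ => ?_
                exact mul_le_mul_of_nonneg_left (hu y) (div_nonneg (hP k y) (hw0 x))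
            _ ≤ b := by
                rw [← Finset.sum_mul]
                exact mul_le_of_le_one_left hb (hmass x k)
      _ ≤ _ := by
          rw [← Finset.sum_mul]
          exact mul_le_mul_of_nonneg_right hD hlog
  -- Within a context the weights `P k y / w x` add up to at most one, which removes `w` from the
  -- past errors.
  have hsecond : ∑ k ∈ Finset.range K, ∑ y ∈ s, P k y * e k y ≤
      ∑ k ∈ Finset.range K,
          (c ^ 2 + lam * G + ∑ t ∈ Finset.range k, ∑ y ∈ s, P t y * f k y ^ 2) := by
    refine Finset.sum_le_sum fun k _ => ?_
    simp only [he, mul_add, Finset.sum_add_distrib, ← Finset.sum_mul]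
    have h3 : ∑ y ∈ s, P k y * (B k (ctx y) / w (ctx y))
        ≤ ∑ t ∈ Finset.range k, ∑ y ∈ s, P t y * f k y ^ 2 := by
      have h4 : ∑ t ∈ Finset.range k, ∑ y ∈ s, P t y * f k y ^ 2 = ∑ x ∈ s.image ctx, B k x := by
        exact (Finset.sum_congr rfl fun t _ => hfiber _).trans Finset.sum_comm
      rw [h4, hfiber]
      refine Finset.sum_le_sum fun x _ => ?_
      have h5 : ∑ y ∈ s with ctx y = x, P k y * (B k (ctx y) / w (ctx y))
          = (∑ y ∈ s with ctx y = x, P k y / w x) * B k x := by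
        rw [Finset.sum_mul]
        refine Finset.sum_congr rfl fun y hy => ?_
        obtain ⟨hys, rfl⟩ := Finset.mem_filter.1 hy
        ring
      rw [h5]
      exact mul_le_of_le_one_left (hB0 k x) (hmass x k)
    have h6 := mul_le_of_le_one_left (sq_nonneg c) (hP1 k)
    have h7 := mul_le_of_le_one_left (mul_nonneg hlam.le hG) (hP1 k)
    linarith
  refine hcs.trans (mul_le_mul hfirst hsecond ?_ ?_)
  · exact Finset.sum_nonneg fun k _ => Finset.sum_nonneg fun y _ => mul_nonneg (hP k y) (he0 k y)
  · refine le_trans ?_ hfirst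
    exact Finset.sum_nonneg fun k _ => Finset.sum_nonneg fun y _ =>
      mul_nonneg (hP k y) (le_min zero_le_one (hq0 k y))

/-- AM–GM with a free weight: the linear bounds of different steps can be added, and `η` is chosen
only once at the end. -/
theorem le_add_of_sq_le_mul {r x y η : ℝ} (hη : 0 < η) (hx : 0 ≤ x) (hy : 0 ≤ y)
    (h : r ^ 2 ≤ x * y) : r ≤ η * x + η⁻¹ * y := by
  have h1 : x * y = (η * x) * (η⁻¹ * y) := by field_simp
  have h2 : 0 ≤ η * x := by positivity
  have h3 : 0 ≤ η⁻¹ * y := by positivity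
  refine abs_le_of_sq_le_sq' ?_ (by positivity) |>.2
  nlinarith

/-- The version of `sq_sum_error_le` for countable sums, in a form that is linear in the errors. -/
theorem tsum_error_le {X Y : Type*} (hn : 0 < n) {lam b c G D η : ℝ}
    (hlam : 0 < lam) (hb : 0 ≤ b) (hG : 0 ≤ G) (hD0 : 0 ≤ D) (hη : 0 < η)
    (K : ℕ) (ctx : Y → X) (P : ℕ → Y → ℝ≥0∞)
    (hP1 : ∀ k, ∑' y, P k y ≤ 1) (w : X → ℝ≥0∞)
    (hw : ∀ k x, ∑' y, (open Classical in if ctx y = x then P k y else 0) ≤ w x)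
    (hD : ∑' x, w x ≤ ENNReal.ofReal D)
    (u : Y → Fin n → ℝ) (hu : ∀ y, u y ⬝ᵥ u y ≤ b) (g : ℕ → Y → Fin n → ℝ)
    (hg : ∀ k y, g k y ⬝ᵥ g k y ≤ G) (f : ℕ → Y → ℝ) (hf0 : ∀ k y, 0 ≤ f k y)
    (hf : ∀ k y, f k y ≤ g k y ⬝ᵥ u y)
    (hfg : ∀ k y y', ctx y = ctx y' → |g k y ⬝ᵥ u y'| ≤ f k y')
    (hfc : ∀ k y, f k y ≤ c) :
    ∑ k ∈ Finset.range K, ∑' y, P k y * ENNReal.ofReal (f k y) ≤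
      ENNReal.ofReal (η * (D * (2 * (n * Real.log (1 + K * b / (n * lam))))))
        + ENNReal.ofReal η⁻¹ * ∑ k ∈ Finset.range K, (ENNReal.ofReal (c ^ 2 + lam * G)
          + ∑ t ∈ Finset.range k, ∑' y, P t y * ENNReal.ofReal (f k y ^ 2)) := by
  classical
  rw [← Summable.tsum_finsetSum fun _ _ => ENNReal.summable, ENNReal.tsum_eq_iSup_sum]
  refine iSup_le fun s => ?_
  have hPfin : ∀ k y, P k y ≠ ∞ := fun k y =>
    (((ENNReal.le_tsum y).trans (hP1 k)).trans_lt ENNReal.one_lt_top).ne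
  have hwfin : ∀ x, w x ≠ ∞ := fun x =>
    (((ENNReal.le_tsum x).trans hD).trans_lt ENNReal.ofReal_lt_top).ne
  have hcast : ∀ (k : ℕ) (r : Finset Y) (F : Y → ℝ), (∀ y, 0 ≤ F y) →
      ∑ y ∈ r, P k y * ENNReal.ofReal (F y)
        = ENNReal.ofReal (∑ y ∈ r, (P k y).toReal * F y) := by
    intro k r F hF
    rw [ENNReal.ofReal_sum_of_nonneg fun y _ => mul_nonneg ENNReal.toReal_nonneg (hF y)]
    refine Finset.sum_congr rfl fun y _ => ?_
    rw [ENNReal.ofReal_mul ENNReal.toReal_nonneg, ENNReal.ofReal_toReal (hPfin k y)]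
  have hmass : ∀ (k : ℕ) (r : Finset Y), ENNReal.ofReal (∑ y ∈ r, (P k y).toReal)
      = ∑ y ∈ r, P k y := by
    intro k r
    have := hcast k r (fun _ => 1) fun _ => zero_le_one
    simpa using this.symm
  have key := sq_sum_error_le (c := c) (D := D) hn hlam hb hG K s ctx
    (fun k y => (P k y).toReal) (fun _ _ => ENNReal.toReal_nonneg) (fun k => ?_)
    (fun x => (w x).toReal) (fun k x => ?_) ?_ u hu g hg f hf0 hf hfg hfc
  · rw [Finset.sum_comm]
    simp only [hcast _ s (f _) (hf0 _)]
    rw [← ENNReal.ofReal_sum_of_nonneg fun k _ => Finset.sum_nonneg fun y _ =>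
      mul_nonneg ENNReal.toReal_nonneg (hf0 k y)]
    have hlog : 0 ≤ Real.log (1 + K * b / (n * lam)) := Real.log_nonneg (by
      have : 0 ≤ K * b / (n * lam) := by positivity
      linarith)
    have hsq : ∀ k, 0 ≤ ∑ t ∈ Finset.range k, ∑ y ∈ s, (P t y).toReal * f k y ^ 2 := fun k =>
      Finset.sum_nonneg fun t _ => Finset.sum_nonneg fun y _ =>
        mul_nonneg ENNReal.toReal_nonneg (sq_nonneg _)
    have hc0 : 0 ≤ c ^ 2 + lam * G := by positivity
    have hY0 : 0 ≤ ∑ k ∈ Finset.range K,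
        (c ^ 2 + lam * G + ∑ t ∈ Finset.range k, ∑ y ∈ s, (P t y).toReal * f k y ^ 2) :=
      Finset.sum_nonneg fun k _ => add_nonneg hc0 (hsq k)
    refine (ENNReal.ofReal_le_ofReal (le_add_of_sq_le_mul hη ?_ hY0 key)).trans ?_
    · positivity
    rw [ENNReal.ofReal_add (by positivity) (by positivity), ENNReal.ofReal_mul (inv_pos.2 hη).le]
    gcongr
    rw [ENNReal.ofReal_sum_of_nonneg fun k _ => add_nonneg hc0 (hsq k)]
    refine Finset.sum_le_sum fun k _ => ?_
    rw [ENNReal.ofReal_add hc0 (hsq k)]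
    gcongr
    rw [ENNReal.ofReal_sum_of_nonneg fun t _ => Finset.sum_nonneg fun y _ =>
      mul_nonneg ENNReal.toReal_nonneg (sq_nonneg _)]
    refine Finset.sum_le_sum fun t _ => ?_
    rw [← hcast t s (fun y => f k y ^ 2) fun y => sq_nonneg _]
    exact ENNReal.sum_le_tsum s
  · rw [← ENNReal.ofReal_le_ofReal_iff zero_le_one, hmass, ENNReal.ofReal_one]
    exact (ENNReal.sum_le_tsum s).trans (hP1 k)
  · rw [← ENNReal.ofReal_le_ofReal_iff ENNReal.toReal_nonneg, hmass,
      ENNReal.ofReal_toReal (hwfin x)]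
    refine le_trans ?_ (hw k x)
    rw [Finset.sum_filter]
    refine (Finset.sum_le_sum fun y _ => ?_).trans (ENNReal.sum_le_tsum s)
    split_ifs <;> rfl
  · rw [← ENNReal.ofReal_le_ofReal_iff hD0]
    refine le_trans ?_ hD
    rw [ENNReal.ofReal_sum_of_nonneg fun x _ => ENNReal.toReal_nonneg]
    simp only [ENNReal.ofReal_toReal (hwfin _)]
    exact ENNReal.sum_le_tsum _

end Potential

/-! ### Bounded spanning columns of a matrix of low rank -/

section Spanner

open Matrix

variable {S Z : Type*}

theorem le_of_submatrix_det_ne_zero {A : Matrix S Z ℝ} {d r : ℕ} (hA : A.eRank ≤ d)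
    (s : Fin r → S) (z : Fin r → Z) (h : (A.submatrix s z).det ≠ 0) : r ≤ d := by
  have h1 := (eRank_submatrix_le A s z).trans hA
  have h2 : (A.submatrix s z).rank = r := by
    rw [rank_of_isUnit _ ((isUnit_iff_isUnit_det _).2 (isUnit_iff_ne_zero.2 h)), Fintype.card_fin]
  have h3 : (A.submatrix s z).eRank.toNat = (A.submatrix s z).rank := by
    rw [eRank_toNat_eq_finrank, rank_eq_finrank_span_cols]
  have h4 := ENat.toNat_le_toNat h1 (ENat.natCast_ne_top d)
  rw [h3, h2] at h4
  simpa using h4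

/-- A matrix of rank at most `d` with entries in `[0, 1]` has `d` columns such that every column is
a linear combination of them with coefficients bounded by `2`. -/
theorem exists_spanner [Nonempty Z] {A : Matrix S Z ℝ} {d : ℕ} (hA : A.eRank ≤ d)
    (h0 : ∀ s z, 0 ≤ A s z) (h1 : ∀ s z, A s z ≤ 1) :
    ∃ (c : Fin d → Z) (a : Z → Fin d → ℝ), (∀ z i, |a z i| ≤ 2) ∧
      ∀ s z, A s z = ∑ i, a z i * A s (c i) := by
  classical
  let Q : ℕ → Prop := fun r => ∃ (s : Fin r → S) (z : Fin r → Z), (A.submatrix s z).det ≠ 0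
  have hQ0 : Q 0 := ⟨Fin.elim0, Fin.elim0, by simp⟩
  have hQd : ∀ r, Q r → r ≤ d := fun r ⟨s, z, h⟩ => le_of_submatrix_det_ne_zero hA s z h
  set r := Nat.findGreatest Q d with hr
  have hQr : Q r := Nat.findGreatest_spec (Nat.zero_le d) hQ0
  have hQr1 : ¬ Q (r + 1) := fun h => by
    have := Nat.le_findGreatest (hQd _ h) h
    omega
  obtain ⟨s, z₀, hz₀⟩ := hQr
  -- With the rows fixed, columns of nearly maximal volume are chosen. The supremum over infinitely
  -- many columns need not be attained, whence the bound `2` instead of `1`.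
  let f : (Fin r → Z) → ℝ := fun z => |(A.submatrix s z).det|
  have hbdd : BddAbove (Set.range f) := by
    refine ⟨(r.factorial : ℝ) * 1, ?_⟩
    rintro _ ⟨z, rfl⟩
    have := det_le (A := A.submatrix s z) (abv := AbsoluteValue.abs) (x := (1 : ℝ)) (by
      intro i j
      simp only [submatrix_apply, AbsoluteValue.abs_apply]
      rw [abs_of_nonneg (h0 _ _)]
      exact h1 _ _)
    simpa [nsmul_eq_mul] using this
  set B := ⨆ z, f z with hB
  have hle : ∀ z, f z ≤ B := fun z => le_ciSup hbdd z
  have hBpos : 0 < B := (abs_pos.2 hz₀).trans_le (hle z₀)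
  obtain ⟨z, hz⟩ := exists_lt_of_lt_ciSup (show B / 2 < ⨆ z, f z by rw [← hB]; linarith)
  set M := A.submatrix s z with hM
  have hdet : M.det ≠ 0 := by
    intro h
    simp only [f, ← hM, h, abs_zero] at hz
    linarith
  set a : Z → Fin r → ℝ := fun y => M⁻¹ *ᵥ fun i => A (s i) y with ha
  have ha2 : ∀ y i, |a y i| ≤ 2 := by
    intro y i
    -- Cramer's rule: a coefficient is a ratio of two volumes.
    have e1 : a y i = M.det⁻¹ * (M.updateCol i fun i => A (s i) y).det := by
      simp only [ha]
      rw [inv_def, smul_mulVec, ← cramer_eq_adjugate_mulVec, Pi.smul_apply, cramer_apply,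
        Ring.inverse_eq_inv', smul_eq_mul]
    have e2 : (M.updateCol i fun i => A (s i) y) = A.submatrix s (Function.update z i y) := by
      ext j k
      by_cases hk : k = i
      · subst hk; simp
      · simp [hM, hk]
    rw [e1, e2, abs_mul, abs_inv, inv_mul_le_iff₀ (abs_pos.2 hdet)]
    have h3 : f z = |M.det| := rfl
    have h4 := hle (Function.update z i y)
    simp only [f] at h4
    rw [← h3]
    linarith
  -- The minor bordered by one more row and column vanishes by maximality of `r`; so does its Schur
  -- complement, which is the identity sought.
  have hrep : ∀ x y, A x y = ∑ i, a y i * A x (z i) := by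
    intro x y
    let _ : Invertible M := invertibleOfIsUnitDet M (isUnit_iff_ne_zero.2 hdet)
    have e1 := det_fromBlocks₁₁ M (of fun i (_ : Unit) => A (s i) y)
      (of fun (_ : Unit) i => A x (z i)) (of fun (_ _ : Unit) => A x y)
    have e2 : fromBlocks M (of fun i (_ : Unit) => A (s i) y)
      (of fun (_ : Unit) i => A x (z i)) (of fun (_ _ : Unit) => A x y)
        = A.submatrix (Sum.elim s fun _ => x) (Sum.elim z fun _ => y) := by
      ext i j
      rcases i with i | i <;> rcases j with j | j <;> rfl
    have e3 : (A.submatrix (Sum.elim s fun _ : Unit => x) (Sum.elim z fun _ : Unit => y)).det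
        = 0 := by
      by_contra hne
      set eq := (Fintype.equivFinOfCardEq (by simp : Fintype.card (Fin r ⊕ Unit) = r + 1)).symm
      rw [← det_submatrix_equiv_self eq] at hne
      exact hQr1 ⟨fun i => Sum.elim s (fun _ : Unit => x) (eq i),
        fun i => Sum.elim z (fun _ : Unit => y) (eq i), hne⟩
    rw [e2, e3] at e1
    have e4 := (mul_eq_zero.1 e1.symm).resolve_left hdet
    rw [det_unique, Matrix.sub_apply, sub_eq_zero] at e4
    simp only [of_apply] at e4
    rw [e4, Matrix.mul_assoc]
    simp only [Matrix.mul_apply, of_apply, ha, invOf_eq_nonsing_inv, mulVec, dotProduct]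
    exact Finset.sum_congr rfl fun i _ => mul_comm _ _
  have hrd : r ≤ d := Nat.findGreatest_le d
  -- If `r < d`, the list is filled up with arbitrary columns of coefficient zero.
  refine ⟨fun i => if h : (i : ℕ) < r then z ⟨i, h⟩ else Classical.arbitrary Z,
    fun y i => if h : (i : ℕ) < r then a y ⟨i, h⟩ else 0, ?_, ?_⟩
  · intro y i
    simp only
    split_ifs
    · exact ha2 _ _
    · simp
  · intro x y
    rw [hrep x y]
    symm
    rw [← Finset.sum_subset (Finset.subset_univ (Finset.univ.map (Fin.castLEEmb hrd)))]
    · rw [Finset.sum_map]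
      refine Finset.sum_congr rfl fun i _ => ?_
      simp
    · intro i _ hi
      have : ¬ (i : ℕ) < r := by
        intro h
        refine hi (Finset.mem_map.2 ⟨⟨i, h⟩, Finset.mem_univ _, ?_⟩)
        ext
        simp
      simp [this]

end Spanner

/-! ### Likelihoods of histories and weights of the latent indices -/

section Beliefs

variable {S A : Type*} [Fintype A] {L : ℕ}

set_option linter.unusedSectionVars false

/-- The likelihood of the states of a history and of the state that follows it, when the first
state has the weights `μ`. -/
def wlik (T : S → A → PMF S) : List (S × A) → (S → ℝ≥0∞) → S → ℝ≥0∞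
  | [], μ, s => μ s
  | x :: r, μ, s => μ x.1 * wlik T r (fun s' => T x.1 x.2 s') s

theorem wlik_append (T : S → A → PMF S) (hist : List (S × A)) (μ : S → ℝ≥0∞) (s : S) (a : A)
    (s' : S) : wlik T (hist ++ [(s, a)]) μ s' = wlik T hist μ s * T s a s' := by
  induction hist generalizing μ with
  | nil => rfl
  | cons x r ih => rw [List.cons_append, wlik, wlik, ih, mul_assoc]

theorem wlik_le_one (T : S → A → PMF S) (hist : List (S × A)) (μ : S → ℝ≥0∞)
    (hμ : ∀ s, μ s ≤ 1) (s : S) : wlik T hist μ s ≤ 1 := by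
  induction hist generalizing μ with
  | nil => exact hμ s
  | cons x r ih => exact mul_le_one' (hμ _) (ih _ fun s => PMF.coe_le_one _ _)

namespace LMDP

/-- The joint likelihood of the latent index `l` and the states of a history. -/
def belE (M : LMDP S A L) (l : Fin L) (hist : List (S × A)) (s : S) : ℝ≥0∞ :=
  M.ρ l * wlik (M.T l) hist (fun s => M.ν l s) s

theorem follows_belE (M : LMDP S A L) (l : Fin L) : Follows (M.T l) (M.belE l) := by
  intro hist s a s'
  rw [belE, wlik_append, ← mul_assoc]
  rfl

theorem belE_ne_top (M : LMDP S A L) (l : Fin L) (hist : List (S × A)) (s : S) :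
    M.belE l hist s ≠ ∞ :=
  ENNReal.mul_ne_top (PMF.apply_ne_top _ _)
    ((wlik_le_one _ _ _ (fun _ => PMF.coe_le_one _ _) s).trans_lt ENNReal.one_lt_top).ne

/-- The joint likelihood of the latent index and the states of a history, as a real vector. -/
def bel (M : LMDP S A L) (hist : List (S × A)) (s : S) (l : Fin L) : ℝ := (M.belE l hist s).toReal

/-- The likelihood of the states of a history. -/
def tot (M : LMDP S A L) (hist : List (S × A)) (s : S) : ℝ := ∑ l, M.bel hist s l

/-- The transition probabilities as real numbers. -/
def tr (M : LMDP S A L) (l : Fin L) (s : S) (a : A) (s' : S) : ℝ := (M.T l s a s').toReal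

/-- The law of the observations from the state `x` under `π`, as a real function. -/
def fut (M : LMDP S A L) (π : Policy S A) (n : ℕ) (x : S) (l : Fin L) (ω : Fin n → A × S) : ℝ :=
  (futureLaw (M.T l) π n [] x ω).toReal

variable (M M' : LMDP S A L)

theorem isProb_tr (l : Fin L) (s : S) (a : A) : IsProb (M.tr l s a) := isProb_toReal _

theorem isProb_fut (π : Policy S A) (n : ℕ) (x : S) (l : Fin L) : IsProb (M.fut π n x l) :=
  isProb_toReal _

theorem bel_nonneg (hist : List (S × A)) (s : S) (l : Fin L) : 0 ≤ M.bel hist s l :=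
  ENNReal.toReal_nonneg

theorem tot_nonneg (hist : List (S × A)) (s : S) : 0 ≤ M.tot hist s :=
  Finset.sum_nonneg fun l _ => M.bel_nonneg hist s l

theorem bel_le_tot (hist : List (S × A)) (s : S) (l : Fin L) : M.bel hist s l ≤ M.tot hist s :=
  Finset.single_le_sum (fun l _ => M.bel_nonneg hist s l) (Finset.mem_univ l)

theorem bel_nil (s : S) (l : Fin L) : M.bel [] s l = (M.ρ l).toReal * (M.ν l s).toReal :=
  ENNReal.toReal_mul

theorem bel_append (hist : List (S × A)) (s : S) (a : A) (s' : S) (l : Fin L) :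
    M.bel (hist ++ [(s, a)]) s' l = M.bel hist s l * M.tr l s a s' := by
  rw [bel, M.follows_belE l, ENNReal.toReal_mul]
  rfl

theorem bel_eq_zero_of_notMem {l : Fin L} (hl : l ∉ M.ρ.support) (hist : List (S × A)) (s : S) :
    M.bel hist s l = 0 := by
  have : M.ρ l = 0 := by simpa using hl
  rw [bel, belE, this, zero_mul, ENNReal.toReal_zero]

theorem ofReal_bel (hist : List (S × A)) (s : S) (l : Fin L) :
    ENNReal.ofReal (M.bel hist s l) = M.belE l hist s :=
  ENNReal.ofReal_toReal (M.belE_ne_top l hist s)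

theorem hasSum_bel (hist : List (S × A)) (s : S) (a : A) (l : Fin L) :
    HasSum (fun s' => M.bel (hist ++ [(s, a)]) s' l) (M.bel hist s l) := by
  simp only [bel_append]
  simpa using (M.isProb_tr l s a).2.mul_left (M.bel hist s l)

theorem tot_append (hist : List (S × A)) (s : S) (a : A) (s' : S) :
    M.tot (hist ++ [(s, a)]) s' = ∑ l, M.bel hist s l * M.tr l s a s' :=
  Finset.sum_congr rfl fun l _ => M.bel_append hist s a s' l

theorem hasSum_tot (hist : List (S × A)) (s : S) (a : A) :
    HasSum (fun s' => M.tot (hist ++ [(s, a)]) s') (M.tot hist s) :=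
  hasSum_sum fun l _ => M.hasSum_bel hist s a l

theorem jointLaw_apply (π : Policy S A) (N : ℕ) (l : Fin L) (τ : Traj S A (N + 1)) :
    M.jointLaw (N + 1) π (l, τ)
      = pathWt π N [] τ * M.belE l (pathEnd N [] τ).1 (pathEnd N [] τ).2 := by
  classical
  rw [jointLaw, PMF.bind_apply, tsum_eq_single l]
  · rw [← tsum_mul_rollout (M.follows_belE l), PMF.bind_apply, ← ENNReal.tsum_mul_left]
    refine tsum_congr fun s => ?_
    rw [belE, wlik, ← mul_assoc, PMF.map_apply, tsum_eq_single τ]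
    · simp
    · intro τ' hτ'
      rw [if_neg]
      intro h
      exact hτ' (Prod.ext_iff.1 h).2.symm
  · intro l' hl'
    rw [PMF.bind_apply]
    refine mul_eq_zero_of_right _ (ENNReal.tsum_eq_zero.2 fun s => mul_eq_zero_of_right _ ?_)
    rw [PMF.map_apply]
    refine ENNReal.tsum_eq_zero.2 fun τ' => if_neg fun h => hl' ?_
    exact (Prod.ext_iff.1 h).1.symm

theorem trajLaw_apply (π : Policy S A) (N : ℕ) (τ : Traj S A (N + 1)) :
    M.trajLaw (N + 1) π τ
      = pathWt π N [] τ * ENNReal.ofReal (M.tot (pathEnd N [] τ).1 (pathEnd N [] τ).2) := by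
  classical
  have h : M.trajLaw (N + 1) π τ = ∑ l, M.jointLaw (N + 1) π (l, τ) := by
    rw [trajLaw, PMF.map_apply, ENNReal.tsum_prod', tsum_fintype]
    refine Finset.sum_congr rfl fun l _ => ?_
    rw [tsum_eq_single τ]
    · simp
    · intro τ' hτ'
      rw [if_neg (Ne.symm hτ')]
  rw [h, tot, ENNReal.ofReal_sum_of_nonneg fun l _ => M.bel_nonneg _ _ l, Finset.mul_sum]
  refine Finset.sum_congr rfl fun l _ => ?_
  rw [jointLaw_apply, ofReal_bel]

/-- The squared difference of the roots of the likelihoods of a history in two models. -/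
def rootDiff (hist : List (S × A)) (s : S) : ℝ≥0∞ :=
  ENNReal.ofReal ((√(M.tot hist s) - √(M'.tot hist s)) ^ 2)

/-- The absolute difference of the likelihoods of a history in two models. -/
def absDiff (hist : List (S × A)) (s : S) : ℝ≥0∞ :=
  ENNReal.ofReal |M.tot hist s - M'.tot hist s|

theorem pathWt_le_one (π : Policy S A) (n : ℕ) (hist : List (S × A)) (τ : Fin (n + 1) → S × A) :
    pathWt π n hist τ ≤ 1 := by
  induction n generalizing hist with
  | zero => exact PMF.coe_le_one _ _
  | succ n ih => exact mul_le_one' (PMF.coe_le_one _ _) (ih _ _)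

/-- Homogeneity of degree one, by which common action weights come out of Hellinger distances. -/
theorem mul_ofReal_sq_sqrt_sub {o : ℝ≥0∞} (ho : o ≠ ∞) {x y : ℝ} (hx : 0 ≤ x) (hy : 0 ≤ y) :
    o * ENNReal.ofReal ((√x - √y) ^ 2) = ENNReal.ofReal
      ((√((o * ENNReal.ofReal x).toReal) - √((o * ENNReal.ofReal y).toReal)) ^ 2) := by
  rw [ENNReal.toReal_mul, ENNReal.toReal_mul, ENNReal.toReal_ofReal hx, ENNReal.toReal_ofReal hy,
    Real.sqrt_mul ENNReal.toReal_nonneg, Real.sqrt_mul ENNReal.toReal_nonneg, ← mul_sub, mul_pow,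
    Real.sq_sqrt ENNReal.toReal_nonneg, ENNReal.ofReal_mul ENNReal.toReal_nonneg,
    ENNReal.ofReal_toReal ho]

theorem mul_ofReal_abs_sub {o : ℝ≥0∞} (ho : o ≠ ∞) {x y : ℝ} (hx : 0 ≤ x) (hy : 0 ≤ y) :
    o * ENNReal.ofReal |x - y| = ENNReal.ofReal
      |(o * ENNReal.ofReal x).toReal - (o * ENNReal.ofReal y).toReal| := by
  rw [ENNReal.toReal_mul, ENNReal.toReal_mul, ENNReal.toReal_ofReal hx, ENNReal.toReal_ofReal hy,
    ← mul_sub, abs_mul, abs_of_nonneg ENNReal.toReal_nonneg,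
    ENNReal.ofReal_mul ENNReal.toReal_nonneg, ENNReal.ofReal_toReal ho]

theorem l1_trajLaw (π : Policy S A) (N : ℕ) :
    l1 (fun τ => (M.trajLaw (N + 1) π τ).toReal) (fun τ => (M'.trajLaw (N + 1) π τ).toReal)
      = hsum π N (M.absDiff M') := by
  rw [hsum, ← tsum_pathWt, l1]
  refine tsum_congr fun τ => ?_
  rw [absDiff, mul_ofReal_abs_sub (ne_top_of_le_ne_top ENNReal.one_ne_top (pathWt_le_one _ _ _ _))
    (M.tot_nonneg _ _) (M'.tot_nonneg _ _), trajLaw_apply, trajLaw_apply]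

theorem mixLaw_apply (q : PMF (Policy S A)) (N : ℕ) (τ : Traj S A (N + 1)) :
    M.mixLaw (N + 1) q τ = (∑' π, q π * pathWt π N [] τ)
      * ENNReal.ofReal (M.tot (pathEnd N [] τ).1 (pathEnd N [] τ).2) := by
  rw [mixLaw, PMF.bind_apply, ← ENNReal.tsum_mul_right]
  refine tsum_congr fun π => ?_
  rw [trajLaw_apply, mul_assoc]

/-- Even for a mixture of policies the action weights are a common factor of both likelihoods. The
distance is therefore linear in `q`, where convexity alone would give only an inequality in the
useless direction. -/
theorem hell_mixLaw (q : PMF (Policy S A)) (N : ℕ) :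
    hell (fun τ => (M.mixLaw (N + 1) q τ).toReal) (fun τ => (M'.mixLaw (N + 1) q τ).toReal)
      = ∑' π, q π * hsum π N (M.rootDiff M') := by
  have h1 : ∀ π : Policy S A, hsum π N (M.rootDiff M') = ∑' τ, pathWt π N [] τ
      * M.rootDiff M' (pathEnd N [] τ).1 (pathEnd N [] τ).2 := fun π => by
    rw [hsum, tsum_pathWt]
  simp only [h1, ← ENNReal.tsum_mul_left]
  rw [ENNReal.tsum_comm, hell]
  refine tsum_congr fun τ => ?_
  have ho : ∑' π, q π * pathWt π N [] τ ≠ ∞ := by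
    refine ne_top_of_le_ne_top ENNReal.one_ne_top ?_
    rw [← q.tsum_coe]
    gcongr with π
    exact mul_le_of_le_one_right' (pathWt_le_one _ _ _ _)
  simp only [← mul_assoc]
  rw [ENNReal.tsum_mul_right, rootDiff, mul_ofReal_sq_sqrt_sub ho (M.tot_nonneg _ _)
    (M'.tot_nonneg _ _), mixLaw_apply, mixLaw_apply]

theorem obsWt_le_one (π : Policy S A) (n : ℕ) (hist : List (S × A)) (s : S)
    (ω : Fin n → A × S) : obsWt π n hist s ω ≤ 1 := by
  induction n generalizing hist s with
  | zero => exact le_rfl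
  | succ n ih => exact mul_le_one' (PMF.coe_le_one _ _) (ih _ _ _)

theorem obsWt_mul_tot (π : Policy S A) (n : ℕ) (hist : List (S × A)) (s : S)
    (ω : Fin n → A × S) :
    (obsWt π n [] s ω * ENNReal.ofReal (M.tot (obsEnd n hist s ω).1 (obsEnd n hist s ω).2)).toReal
      = ∑ l, M.bel hist s l * M.fut π n s l ω := by
  rw [tot, ENNReal.ofReal_sum_of_nonneg fun l _ => M.bel_nonneg _ _ l, Finset.mul_sum,
    ENNReal.toReal_sum]
  · refine Finset.sum_congr rfl fun l _ => ?_
    rw [ofReal_bel, ← mul_futureLaw (M.follows_belE l) π n hist [] s ω, ENNReal.toReal_mul]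
    rfl
  · intro l _
    exact ENNReal.mul_ne_top (ne_top_of_le_ne_top ENNReal.one_ne_top (obsWt_le_one _ _ _ _ _))
      ENNReal.ofReal_ne_top

theorem iterate_step_fresh {π π' : Policy S A} {hist : List (S × A)}
    (h : ∀ r s, π (hist ++ r) s = π' r s) (n : ℕ) (c : List (S × A) → S → ℝ≥0∞) (s : S) :
    (step π)^[n] c hist s
      = ∑' ω, obsWt π' n [] s ω * c (obsEnd n hist s ω).1 (obsEnd n hist s ω).2 := by
  rw [← tsum_obsWt]
  refine tsum_congr fun ω => ?_
  have := obsWt_fresh h n [] s ω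
  rw [List.append_nil] at this
  rw [this]

/-- After a restart the law of the observations given the latent index depends on the current state
only, so the likelihoods become mixtures with weights `bel hist s`. -/
theorem iterate_step_rootDiff {π π' : Policy S A} {hist : List (S × A)}
    (h : ∀ r s, π (hist ++ r) s = π' r s) (n : ℕ) (s : S) :
    (step π)^[n] (M.rootDiff M') hist s
      = hell (fun ω => ∑ l, M.bel hist s l * M.fut π' n s l ω)
          (fun ω => ∑ l, M'.bel hist s l * M'.fut π' n s l ω) := by
  rw [iterate_step_fresh h, hell]
  refine tsum_congr fun ω => ?_
  rw [rootDiff, mul_ofReal_sq_sqrt_sub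
    (ne_top_of_le_ne_top ENNReal.one_ne_top (obsWt_le_one _ _ _ _ _))
    (M.tot_nonneg _ _) (M'.tot_nonneg _ _), obsWt_mul_tot, obsWt_mul_tot]

theorem step_martingale (π : Policy S A) {c : List (S × A) → S → ℝ≥0∞} {hist : List (S × A)}
    {s : S} {r : ℝ≥0∞} (h : ∀ a, ∑' s', c (hist ++ [(s, a)]) s' = r) : step π c hist s = r := by
  simp only [step, h]
  rw [← Finset.sum_mul, sum_policy, one_mul]

theorem tsum_ofReal_bel (hist : List (S × A)) (s : S) (a : A) (l : Fin L) :
    ∑' s', ENNReal.ofReal (M.bel (hist ++ [(s, a)]) s' l) = ENNReal.ofReal (M.bel hist s l) := by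
  rw [← ENNReal.ofReal_tsum_of_nonneg (fun s' => M.bel_nonneg _ _ _) (M.hasSum_bel _ _ _ _).summable,
    (M.hasSum_bel _ _ _ _).tsum_eq]

theorem tsum_ofReal_tot (hist : List (S × A)) (s : S) (a : A) :
    ∑' s', ENNReal.ofReal (M.tot (hist ++ [(s, a)]) s') = ENNReal.ofReal (M.tot hist s) := by
  rw [← ENNReal.ofReal_tsum_of_nonneg (fun s' => M.tot_nonneg _ _) (M.hasSum_tot _ _ _).summable,
    (M.hasSum_tot _ _ _).tsum_eq]

theorem hsum_tot (π : Policy S A) (n : ℕ) :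
    hsum π n (fun hist s => ENNReal.ofReal (M.tot hist s)) = 1 := by
  induction n with
  | zero =>
    rw [hsum_zero]
    simp only [tot, ENNReal.ofReal_sum_of_nonneg fun l _ => M.bel_nonneg _ _ l, ofReal_bel, belE,
      wlik]
    rw [Summable.tsum_finsetSum fun _ _ => ENNReal.summable]
    simp only [ENNReal.tsum_mul_left, PMF.tsum_coe, mul_one]
    have := M.ρ.tsum_coe
    rwa [tsum_fintype] at this
  | succ n ih =>
    rw [hsum_succ, ← ih]
    exact hsum_congr fun hist s _ => step_martingale π fun a => M.tsum_ofReal_tot hist s a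

/-- Forgetting the next state contracts the Hellinger distance. -/
theorem rootDiff_le_tsum (hist : List (S × A)) (s : S) (a : A) :
    M.rootDiff M' hist s ≤ ∑' s', M.rootDiff M' (hist ++ [(s, a)]) s' :=
  sq_sub_le_hell (fun _ => M.tot_nonneg _ _) (fun _ => M'.tot_nonneg _ _)
    (M.hasSum_tot hist s a) (M'.hasSum_tot hist s a)

end LMDP

end Beliefs

/-! ### Decoding the latent index from the first `v + 1` states -/

section Decoding

variable {S A : Type*} [Fintype A] {L : ℕ}

set_option linter.unusedSectionVars false

theorem le_of_log_le_bhattacharyya {X : Type*} {p q : PMF X} {x : ℝ} (hx : 0 < x)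
    (h : ((Real.log x : ℝ) : EReal) ≤ bhattacharyya p q) :
    ∑' y, √(p y).toReal * √(q y).toReal ≤ 1 / x := by
  have h1 : ∑' y, (p y * q y) ^ (1 / 2 : ℝ) ≤ ENNReal.ofReal (1 / x) := by
    rw [← ENNReal.log_le_log_iff, ENNReal.log_ofReal_of_pos (by positivity),
      Real.log_div one_ne_zero hx.ne', Real.log_one, zero_sub, EReal.coe_neg]
    rw [bhattacharyya] at h
    exact EReal.le_neg_of_le_neg h
  have hs := summable_sqrt_mul (isProb_toReal p).1 (isProb_toReal q).1
    (isProb_toReal p).2.summable (isProb_toReal q).2.summable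
  rw [← ENNReal.ofReal_le_ofReal_iff (by positivity),
    ENNReal.ofReal_tsum_of_nonneg (fun y => by positivity) hs]
  refine le_trans (le_of_eq (tsum_congr fun y => ?_)) h1
  rw [← Real.sqrt_mul ENNReal.toReal_nonneg, ← ENNReal.toReal_mul, Real.sqrt_eq_rpow,
    ENNReal.toReal_rpow, ENNReal.ofReal_toReal]
  exact ENNReal.rpow_ne_top_of_nonneg (by norm_num)
    (ENNReal.mul_ne_top (PMF.apply_ne_top _ _) (PMF.apply_ne_top _ _))

/-- A finite bound excludes the empty infimum, so some admissible `h ≤ W` exists and monotonicity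
carries it to `W`. -/
theorem le_of_growthInv_le {ϖ : ℕ → EReal} (hϖ : Monotone ϖ) {x : EReal} {W : ℕ}
    (h : growthInv ϖ x ≤ (W : ℕ∞)) : 1 ≤ W ∧ x ≤ ϖ W := by
  by_contra hcon
  have h1 : ((W + 1 : ℕ) : ℕ∞) ≤ growthInv ϖ x := by
    refine le_iInf fun ⟨i, hi1, hi2⟩ => ?_
    simp only [Nat.cast_le]
    by_contra hlt
    exact hcon ⟨by omega, hi2.trans (hϖ (by omega))⟩
  have h2 := h1.trans h
  simp only [Nat.cast_le] at h2
  omega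

/-- The state at position `v` of the history `hist` that is followed by the state `s`. -/
def stAt (v : ℕ) (hist : List (S × A)) (s : S) : S := (hist[v]?.map Prod.fst).getD s

theorem stAt_eq {v : ℕ} {hist : List (S × A)} (h : hist.length = v) (s : S) :
    stAt v hist s = s := by
  simp [stAt, h.le]

theorem stAt_append {v : ℕ} {hist : List (S × A)} (h : v ≤ hist.length) (s : S) (a : A) (s' : S) :
    stAt v (hist ++ [(s, a)]) s' = stAt v hist s := by
  rcases h.eq_or_lt with h | h
  · subst h
    simp [stAt]
  · simp [stAt, List.getElem?_append_left h, h]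

theorem take_append_of_le {v : ℕ} {hist : List (S × A)} (h : v ≤ hist.length) (x : S × A) :
    (hist ++ [x]).take v = hist.take v := List.take_append_of_le_length h

namespace LMDP

variable (M M' : LMDP S A L)

/-- The latent weights are martingales, and `φ` is fixed once the state at position `v` is known. -/
theorem hsum_prefix (π : Policy S A) (v n : ℕ) (φ : Fin L → List (S × A) → S → ℝ≥0∞) :
    hsum π (v + n) (fun hist s =>
        ∑ l, φ l (hist.take v) (stAt v hist s) * ENNReal.ofReal (M.bel hist s l))
      = hsum π v fun hist s => ∑ l, φ l hist s * ENNReal.ofReal (M.bel hist s l) := by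
  induction n with
  | zero =>
    refine hsum_congr fun hist s hl => ?_
    have hl' : hist.length = v := hl
    rw [stAt_eq hl', List.take_of_length_le hl'.le]
  | succ n ih =>
    rw [← add_assoc, hsum_succ, ← ih]
    refine hsum_congr fun hist s hl => step_martingale π fun a => ?_
    rw [Summable.tsum_finsetSum fun _ _ => ENNReal.summable]
    refine Finset.sum_congr rfl fun l _ => ?_
    have hv : v ≤ hist.length := by omega
    simp only [stAt_append hv, take_append_of_le hv, ENNReal.tsum_mul_left, tsum_ofReal_bel]

/-- The sum of the overlaps of the likelihoods of the latent indices. -/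
def pairSum (hist : List (S × A)) (s : S) : ℝ :=
  ∑ l, ∑ l', if l = l' then 0 else √(M.bel hist s l) * √(M.bel hist s l')

/-- The square of `∑ √ρ`, by Cauchy–Schwarz. The separation level `log (L / εs)` compensates this
factor `L`. -/
theorem sum_sqrt_mul_sqrt_le : ∑ l, ∑ l', √(M.ρ l).toReal * √(M.ρ l').toReal ≤ (L : ℝ) := by
  rw [← Finset.sum_mul_sum, ← sq]
  have h1 : ∑ l, (M.ρ l).toReal = 1 := by
    have := (isProb_toReal M.ρ).2.tsum_eq
    rwa [tsum_fintype] at this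
  have h2 := sq_sum_le_card_mul_sum_sq (s := Finset.univ) (f := fun l => √(M.ρ l).toReal)
  simpa [Real.sq_sqrt ENNReal.toReal_nonneg, h1] using h2

/-- The action weights complete the overlap of two latent likelihoods to the affinity of their joint
laws. It is at most `√ρ √ρ'` times the affinity of the observations given `s₁`, which separation
bounds by `εs / L`. -/
theorem hsum_pairSum_le {H : ℕ} {ϖ : ℕ → EReal} {π : Policy S A} (hsep : M.SeparatedUnder H ϖ π)
    {v : ℕ} (hv : v + 1 ≤ H) {εs : ℝ} (hεs : 0 < εs) (hL : 0 < L)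
    (hϖ : ((Real.log (L / εs) : ℝ) : EReal) ≤ ϖ (v + 1)) :
    hsum π v (fun hist s => ENNReal.ofReal (M.pairSum hist s)) ≤ ENNReal.ofReal εs := by
  have hL' : (0 : ℝ) < L := by exact_mod_cast hL
  have hBC : ∀ l l', l ≠ l' → ∀ s,
      ∑' ω, ENNReal.ofReal (√(M.bel [] s l * M.fut π v s l ω) * √(M.bel [] s l' * M.fut π v s l' ω))
        ≤ ENNReal.ofReal (√(M.bel [] s l) * √(M.bel [] s l') * (εs / L)) := by
    intro l l' hll s
    by_cases hl : l ∈ M.ρ.support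
    swap
    · simp [M.bel_eq_zero_of_notMem hl]
    by_cases hl' : l' ∈ M.ρ.support
    swap
    · simp [M.bel_eq_zero_of_notMem hl']
    have h1 := hϖ.trans (hsep l hl l' hl' hll (v + 1) (by omega) hv s)
    have h2 := le_of_log_le_bhattacharyya (by positivity) h1
    have h3 := summable_sqrt_mul (M.isProb_fut π v s l).1 (M.isProb_fut π v s l').1
      (M.isProb_fut π v s l).2.summable (M.isProb_fut π v s l').2.summable
    simp only [Real.sqrt_mul (M.bel_nonneg _ _ _)]
    calc _ = ∑' ω, ENNReal.ofReal (√(M.bel [] s l) * √(M.bel [] s l')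
          * (√(M.fut π v s l ω) * √(M.fut π v s l' ω))) :=
          tsum_congr fun ω => by congr 1; ring
      _ = ENNReal.ofReal (√(M.bel [] s l) * √(M.bel [] s l')
          * ∑' ω, √(M.fut π v s l ω) * √(M.fut π v s l' ω)) := by
          rw [← tsum_mul_left, ENNReal.ofReal_tsum_of_nonneg (fun ω => by positivity)
            (h3.mul_left _)]
      _ ≤ _ := by
          refine ENNReal.ofReal_le_ofReal (mul_le_mul_of_nonneg_left ?_ (by positivity))
          rw [one_div_div] at h2
          exact h2
  have hν : ∀ l l', ∑' s, ENNReal.ofReal (√(M.bel [] s l) * √(M.bel [] s l'))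
      ≤ ENNReal.ofReal (√(M.ρ l).toReal * √(M.ρ l').toReal) := by
    intro l l'
    have e : ∀ s, √(M.bel [] s l) * √(M.bel [] s l') = √(M.ρ l).toReal * √(M.ρ l').toReal
        * (√(M.ν l s).toReal * √(M.ν l' s).toReal) := by
      intro s
      rw [bel_nil, bel_nil, Real.sqrt_mul ENNReal.toReal_nonneg,
        Real.sqrt_mul ENNReal.toReal_nonneg]
      ring
    have hp := isProb_toReal (M.ν l)
    have hq := isProb_toReal (M.ν l')
    have h3 := summable_sqrt_mul hp.1 hq.1 hp.2.summable hq.2.summable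
    simp only [e]
    rw [← ENNReal.ofReal_tsum_of_nonneg (fun s => by positivity) (h3.mul_left _), tsum_mul_left]
    refine ENNReal.ofReal_le_ofReal (mul_le_of_le_one_right (by positivity) ?_)
    have h4 : ∑' s, √(M.ν l s).toReal * √(M.ν l' s).toReal
        ≤ ∑' s, ((M.ν l s).toReal / 2 + (M.ν l' s).toReal / 2) := by
      refine Summable.tsum_le_tsum (fun s => ?_) h3
        ((hp.2.summable.div_const 2).add (hq.2.summable.div_const 2))
      nlinarith [sq_nonneg (√(M.ν l s).toReal - √(M.ν l' s).toReal),
        Real.sq_sqrt (hp.1 s), Real.sq_sqrt (hq.1 s)]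
    rw [((hp.2.div_const 2).add (hq.2.div_const 2)).tsum_eq] at h4
    linarith
  have h0 : ∀ hist s, ENNReal.ofReal (M.pairSum hist s) = ∑ l, ∑ l', if l = l' then 0 else
      ENNReal.ofReal (√(M.bel hist s l) * √(M.bel hist s l')) := by
    intro hist s
    have nn : ∀ l l', 0 ≤ if l = l' then 0 else √(M.bel hist s l) * √(M.bel hist s l') := by
      intro l l'
      split_ifs <;> positivity
    rw [pairSum, ENNReal.ofReal_sum_of_nonneg fun l _ => Finset.sum_nonneg fun l' _ => nn l l']
    refine Finset.sum_congr rfl fun l _ => ?_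
    rw [ENNReal.ofReal_sum_of_nonneg fun l' _ => nn l l']
    refine Finset.sum_congr rfl fun l' _ => ?_
    split_ifs <;> simp
  simp only [h0]
  rw [hsum_finset_sum]
  simp only [hsum_finset_sum]
  calc _ ≤ ∑ l, ∑ l', ENNReal.ofReal (√(M.ρ l).toReal * √(M.ρ l').toReal * (εs / L)) := by
        refine Finset.sum_le_sum fun l _ => Finset.sum_le_sum fun l' _ => ?_
        by_cases hll : l = l'
        · simp only [if_pos hll]
          rw [hsum_congr (c' := fun _ _ => (0 : ℝ≥0∞) * 0) fun _ _ _ => by simp,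
            hsum_const_mul, zero_mul]
          exact zero_le
        simp only [if_neg hll]
        rw [hsum]
        calc _ = ∑' s, ∑' ω, ENNReal.ofReal (√(M.bel [] s l * M.fut π v s l ω)
              * √(M.bel [] s l' * M.fut π v s l' ω)) := by
              refine tsum_congr fun s => ?_
              rw [iterate_step_fresh (π' := π) (fun r s => by rw [List.nil_append])]
              refine tsum_congr fun ω => ?_
              have ho : obsWt π v [] s ω ≠ ∞ :=
                ne_top_of_le_ne_top ENNReal.one_ne_top (obsWt_le_one _ _ _ _ _)
              have hm : ∀ l, M.bel [] s l * M.fut π v s l ω = (obsWt π v [] s ω).toReal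
                  * M.bel (obsEnd v [] s ω).1 (obsEnd v [] s ω).2 l := by
                intro l
                rw [bel, fut, ← ENNReal.toReal_mul, mul_futureLaw (M.follows_belE l) π v [] [] s ω,
                  ENNReal.toReal_mul]
                rfl
              rw [hm, hm, Real.sqrt_mul ENNReal.toReal_nonneg, Real.sqrt_mul ENNReal.toReal_nonneg,
                mul_mul_mul_comm, Real.mul_self_sqrt ENNReal.toReal_nonneg,
                ENNReal.ofReal_mul ENNReal.toReal_nonneg, ENNReal.ofReal_toReal ho]
          _ ≤ ∑' s, ENNReal.ofReal (√(M.bel [] s l) * √(M.bel [] s l') * (εs / L)) := by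
              gcongr with s
              exact hBC l l' hll s
          _ = (∑' s, ENNReal.ofReal (√(M.bel [] s l) * √(M.bel [] s l')))
                * ENNReal.ofReal (εs / L) := by
              rw [← ENNReal.tsum_mul_right]
              exact tsum_congr fun s => ENNReal.ofReal_mul (by positivity)
          _ ≤ _ := by
              rw [ENNReal.ofReal_mul (by positivity)]
              gcongr
              exact hν l l'
    _ = ENNReal.ofReal ((∑ l, ∑ l', √(M.ρ l).toReal * √(M.ρ l').toReal) * (εs / L)) := by
        rw [Finset.sum_mul, ENNReal.ofReal_sum_of_nonneg fun l _ => by positivity]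
        refine Finset.sum_congr rfl fun l _ => ?_
        rw [Finset.sum_mul, ENNReal.ofReal_sum_of_nonneg fun l _ => by positivity]
    _ ≤ ENNReal.ofReal εs := by
        refine ENNReal.ofReal_le_ofReal ?_
        calc _ ≤ (L : ℝ) * (εs / L) :=
              mul_le_mul_of_nonneg_right M.sum_sqrt_mul_sqrt_le (by positivity)
          _ = εs := by field_simp

theorem exists_dec (hist : List (S × A)) (s : S) :
    ∃ m ∈ M.ρ.support, ∀ l, M.bel hist s l ≤ M.bel hist s m := by
  obtain ⟨m, hm, h⟩ := Set.exists_max_image _ (M.bel hist s) (Set.toFinite M.ρ.support)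
    M.ρ.support_nonempty
  refine ⟨m, hm, fun l => ?_⟩
  by_cases hl : l ∈ M.ρ.support
  · exact h l hl
  · rw [M.bel_eq_zero_of_notMem hl]
    exact M.bel_nonneg _ _ _

/-- A latent index of maximal likelihood, given the first `v + 1` states. -/
def dec (v : ℕ) (hist : List (S × A)) (s : S) : Fin L :=
  (M.exists_dec (hist.take v) (stAt v hist s)).choose

theorem dec_mem (v : ℕ) (hist : List (S × A)) (s : S) : M.dec v hist s ∈ M.ρ.support :=
  (M.exists_dec (hist.take v) (stAt v hist s)).choose_spec.1

theorem dec_append {v : ℕ} {hist : List (S × A)} (h : v ≤ hist.length) (s : S) (a : A) (s' : S) :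
    M.dec v (hist ++ [(s, a)]) s' = M.dec v hist s := by
  simp only [dec, stAt_append h, take_append_of_le h]

/-- The part of the likelihood that does not come from the decoded latent index. -/
def resid (v : ℕ) (hist : List (S × A)) (s : S) : ℝ :=
  M.tot hist s - M.bel hist s (M.dec v hist s)

theorem resid_nonneg (v : ℕ) (hist : List (S × A)) (s : S) : 0 ≤ M.resid v hist s :=
  sub_nonneg.2 (M.bel_le_tot _ _ _)

/-- If `l'` dominates `l`, the weight of `l` is at most the geometric mean of both weights. -/
theorem sum_offDiag_le_pairSum (hist : List (S × A)) (s : S) (t : Finset (Fin L))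
    (h : ∀ l ∈ t, ∃ l', l' ≠ l ∧ M.bel hist s l ≤ M.bel hist s l') :
    ∑ l ∈ t, M.bel hist s l ≤ M.pairSum hist s := by
  have nn : ∀ l l', 0 ≤ if l = l' then 0 else √(M.bel hist s l) * √(M.bel hist s l') := by
    intro l l'
    split_ifs <;> positivity
  refine le_trans (Finset.sum_le_sum fun l hl => ?_)
    (Finset.sum_le_sum_of_subset_of_nonneg (Finset.subset_univ t)
      fun l _ _ => Finset.sum_nonneg fun l' _ => nn l l')
  obtain ⟨l', hne, hle⟩ := h l hl
  refine le_trans ?_ (Finset.single_le_sum (fun l' _ => nn l l') (Finset.mem_univ l'))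
  rw [if_neg (Ne.symm hne)]
  calc M.bel hist s l = √(M.bel hist s l) * √(M.bel hist s l) :=
        (Real.mul_self_sqrt (M.bel_nonneg _ _ _)).symm
    _ ≤ _ := by gcongr

theorem ofReal_resid (v : ℕ) (hist : List (S × A)) (s : S) :
    ENNReal.ofReal (M.resid v hist s)
      = ∑ l, (if l = M.dec v hist s then 0 else 1) * ENNReal.ofReal (M.bel hist s l) := by
  classical
  have : M.resid v hist s = ∑ l, if l = M.dec v hist s then 0 else M.bel hist s l := by
    have h1 : ∀ l, (if l = M.dec v hist s then 0 else M.bel hist s l)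
        = M.bel hist s l - if l = M.dec v hist s then M.bel hist s l else 0 := by
      intro l
      split_ifs <;> ring
    simp only [h1, Finset.sum_sub_distrib, Finset.sum_ite_eq', Finset.mem_univ, if_true]
    rfl
  rw [this, ENNReal.ofReal_sum_of_nonneg]
  · refine Finset.sum_congr rfl fun l _ => ?_
    split_ifs <;> simp
  · intro l _
    split_ifs
    · exact le_rfl
    · exact M.bel_nonneg _ _ _

/-- The decoded index is frozen after position `v`, so the martingale property moves the residual
mass back to that position. -/
theorem hsum_resid_le {π : Policy S A} {v : ℕ} (n : ℕ) :
    hsum π (v + n) (fun hist s => ENNReal.ofReal (M.resid v hist s))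
      ≤ hsum π v (fun hist s => ENNReal.ofReal (M.pairSum hist s)) := by
  classical
  have h1 := M.hsum_prefix π v n fun l hist s =>
    if l = (M.exists_dec hist s).choose then 0 else 1
  simp only [ofReal_resid]
  refine (h1.trans_le ?_)
  refine hsum_mono fun hist s hl => ?_
  have h2 : ∀ l, (if l = (M.exists_dec hist s).choose then (0 : ℝ≥0∞) else 1)
      * ENNReal.ofReal (M.bel hist s l)
      = if l ∈ Finset.univ.filter (fun l => l ≠ (M.exists_dec hist s).choose) then
        ENNReal.ofReal (M.bel hist s l) else 0 := by
    intro l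
    by_cases h : l = (M.exists_dec hist s).choose <;> simp [h]
  simp only [h2, Finset.sum_ite_mem, Finset.univ_inter]
  rw [← ENNReal.ofReal_sum_of_nonneg fun l _ => M.bel_nonneg _ _ l]
  refine ENNReal.ofReal_le_ofReal (M.sum_offDiag_le_pairSum hist s _ fun l hl => ?_)
  exact ⟨_, (Finset.mem_filter.1 hl).2.symm, (M.exists_dec hist s).choose_spec.2 l⟩

theorem pathEnd_eq (N : ℕ) (hist : List (S × A)) (τ : Fin (N + 1) → S × A) :
    pathEnd N hist τ = (hist ++ List.ofFn (fun i : Fin N => τ i.castSucc), (τ (Fin.last N)).1) := by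
  induction N generalizing hist with
  | zero => simp [pathEnd]
  | succ N ih =>
    rw [pathEnd, ih, List.ofFn_succ, List.append_assoc]
    rfl

theorem latentLogLik_succ {N v : ℕ} (hv : v ≤ N) (τ : Traj S A (N + 1)) (l : Fin L) :
    M.latentLogLik (v + 1) τ l = ENNReal.log (M.belE l
      (List.ofFn fun i : Fin v => τ ⟨i, by omega⟩) (τ ⟨v, by omega⟩).1) := by
  induction v with
  | zero =>
    have : (Finset.univ.filter fun h : Fin (N + 1) => (h : ℕ) < 0 + 1) = {0} := by
      ext h
      simp only [Finset.mem_filter, Finset.mem_univ, true_and, Finset.mem_singleton, Fin.ext_iff,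
        Fin.val_zero]
      omega
    rw [latentLogLik, this, Finset.sum_singleton, belE, ENNReal.log_mul_add]
    rfl
  | succ v ih =>
    have h1 : (Finset.univ.filter fun h : Fin (N + 1) => (h : ℕ) < v + 1 + 1)
        = insert ⟨v + 1, by omega⟩ (Finset.univ.filter fun h : Fin (N + 1) => (h : ℕ) < v + 1) := by
      ext h
      simp only [Finset.mem_filter, Finset.mem_univ, true_and, Finset.mem_insert, Fin.ext_iff]
      omega
    have h2 : M.latentLogLik (v + 1 + 1) τ l
        = M.latentLogLik (v + 1) τ l + ENNReal.log (M.stateLik l τ ⟨v + 1, by omega⟩) := by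
      rw [latentLogLik, latentLogLik, h1, Finset.sum_insert (by simp), add_assoc,
        add_comm (ENNReal.log (M.stateLik _ _ _))]
    rw [h2, ih (by omega), ← ENNReal.log_mul_add]
    congr 1
    rw [List.ofFn_succ', List.concat_eq_append]
    exact (M.follows_belE l _ _ _ _).symm

/-- An error means that another index dominates the true one. This is decided at position `v`, where
the mass of dominated indices is at most the overlap. -/
theorem decodingError_le {N v : ℕ} (hv : v ≤ N) (π : Policy S A) {εs : ℝ} (hεs : 0 ≤ εs)
    (h : hsum π v (fun hist s => ENNReal.ofReal (M.pairSum hist s)) ≤ ENNReal.ofReal εs) :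
    M.decodingError (N + 1) (v + 1) π ≤ εs := by
  classical
  refine ENNReal.toReal_le_of_le_ofReal hεs (le_trans ?_ h)
  -- Ties count as errors, so the bound does not depend on how `mleIndex` breaks them.
  let φ : Fin L → List (S × A) → S → ℝ≥0∞ := fun l hist s =>
    if ∃ l', l' ≠ l ∧ M.bel hist s l ≤ M.bel hist s l' then 1 else 0
  have h1 := M.hsum_prefix π v (N - v) φ
  rw [Nat.add_sub_cancel' hv] at h1
  calc (M.jointLaw (N + 1) π).toOuterMeasure {x | M.mleIndex (v + 1) x.2 ≠ x.1}
      ≤ hsum π N (fun hist s =>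
        ∑ l, φ l (hist.take v) (stAt v hist s) * ENNReal.ofReal (M.bel hist s l)) := by
        rw [PMF.toOuterMeasure_apply, ENNReal.tsum_prod', ENNReal.tsum_comm, hsum, ← tsum_pathWt]
        refine ENNReal.tsum_le_tsum fun τ => ?_
        rw [tsum_fintype, Finset.mul_sum]
        refine Finset.sum_le_sum fun l _ => ?_
        rw [Set.indicator_apply]
        split_ifs with hmem
        swap
        · exact zero_le
        rw [jointLaw_apply, ofReal_bel]
        refine mul_le_mul_right (le_mul_of_one_le_left zero_le ?_) _
        have hend := pathEnd_eq N [] τ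
        have e1 : (pathEnd N [] τ).1.take v = List.ofFn fun i : Fin v => τ ⟨i, by omega⟩ := by
          rw [hend]
          refine List.ext_getElem (by simp; omega) fun i h1 h2 => ?_
          simp
        have e2 : stAt v (pathEnd N [] τ).1 (pathEnd N [] τ).2 = (τ ⟨v, by omega⟩).1 := by
          rw [hend, stAt]
          rcases hv.eq_or_lt with h' | h'
          · subst h'
            simp
            rfl
          · simp [h']
        have hspec := (M.exists_mleIndex (v + 1) τ).choose_spec
        refine (if_pos ⟨M.mleIndex (v + 1) τ, hmem, ?_⟩).ge
        rw [e1, e2]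
        by_cases hl : l ∈ M.ρ.support
        · have h3 := hspec.2 l hl
          rw [M.latentLogLik_succ hv, M.latentLogLik_succ hv, ENNReal.log_le_log_iff] at h3
          exact ENNReal.toReal_mono (M.belE_ne_top _ _ _) h3
        · rw [M.bel_eq_zero_of_notMem hl]
          exact M.bel_nonneg _ _ _
    _ = hsum π v fun hist s => ∑ l, φ l hist s * ENNReal.ofReal (M.bel hist s l) := h1
    _ ≤ _ := by
        refine hsum_mono fun hist s _ => ?_
        have h2 : ∀ l, φ l hist s * ENNReal.ofReal (M.bel hist s l)
            = if l ∈ Finset.univ.filter (fun l => ∃ l', l' ≠ l ∧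
              M.bel hist s l ≤ M.bel hist s l') then ENNReal.ofReal (M.bel hist s l) else 0 := by
          intro l
          by_cases h : ∃ l', l' ≠ l ∧ M.bel hist s l ≤ M.bel hist s l' <;> simp [φ, h]
        simp only [h2, Finset.sum_ite_mem, Finset.univ_inter]
        rw [← ENNReal.ofReal_sum_of_nonneg fun l _ => M.bel_nonneg _ _ l]
        refine ENNReal.ofReal_le_ofReal (M.sum_offDiag_le_pairSum hist s _ fun l hl => ?_)
        exact (Finset.mem_filter.1 hl).2

end LMDP

end Decoding

/-! ### What the exploratory policies reveal about the future of a history -/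

section Explore

variable {S A : Type*} [Fintype A] {L : ℕ}

set_option linter.unusedSectionVars false

theorem tsum_bind_mul {X Y : Type*} (p : PMF X) (f : X → PMF Y) (F : Y → ℝ≥0∞) :
    ∑' y, p.bind f y * F y = ∑' x, p x * ∑' y, f x y * F y := by
  simp only [PMF.bind_apply, ← ENNReal.tsum_mul_right, ← ENNReal.tsum_mul_left]
  rw [ENNReal.tsum_comm]
  exact tsum_congr fun x => tsum_congr fun y => by ring

theorem tsum_pure_mul {Y : Type*} (y : Y) (F : Y → ℝ≥0∞) :
    ∑' z, PMF.pure y z * F z = F y := by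
  classical
  rw [tsum_eq_single y fun z hz => by rw [PMF.pure_apply, if_neg hz, zero_mul]]
  simp

theorem tsum_map_mul {X Y : Type*} (p : PMF X) (f : X → Y) (F : Y → ℝ≥0∞) :
    ∑' y, p.map f y * F y = ∑' x, p x * F (f x) := by
  rw [← PMF.bind_pure_comp, tsum_bind_mul]
  simp only [Function.comp_apply, tsum_pure_mul]

theorem switch_of_lt {k : ℕ} {π π' : Policy S A} {hist : List (S × A)}
    (h : hist.length + 1 < k) (s : S) : Policy.switch k π π' hist s = π hist s :=
  if_pos h

theorem switch_fresh {k : ℕ} {π π' : Policy S A} {hist : List (S × A)}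
    (h : hist.length = k) (r : List (S × A)) (s : S) :
    Policy.switch (k + 1) π π' (hist ++ r) s = π' r s := by
  rw [Policy.switch, if_neg (by simp; omega), Nat.add_sub_cancel, ← h, List.drop_left]

variable [Nonempty A]

theorem exploreAt_of_lt {k : ℕ} {πexp π : Policy S A} {hist : List (S × A)}
    (h : hist.length + 1 < k) (s : S) : exploreAt πexp k π hist s = π hist s := by
  rw [exploreAt, switch_of_lt (by omega), switch_of_lt h]

theorem exploreAt_unif {k : ℕ} {πexp π : Policy S A} {hist : List (S × A)}
    (h : hist.length + 1 = k) (s : S) :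
    exploreAt πexp k π hist s = PMF.uniformOfFintype A := by
  rw [exploreAt, switch_of_lt (by omega), Policy.switch, if_neg (by omega), unifPolicy]

theorem exploreAt_fresh {k : ℕ} {πexp π : Policy S A} {hist : List (S × A)}
    (h : hist.length = k) (r : List (S × A)) (s : S) :
    exploreAt πexp k π (hist ++ r) s = πexp r s :=
  switch_fresh h r s

theorem tsum_explore_mul (H : ℕ) [NeZero H] (W : ℕ) (πexp π : Policy S A)
    (F : Policy S A → ℝ≥0∞) :
    ∑' ψ, explore H W πexp π ψ * F ψ = 2⁻¹ * F (Policy.switch W π πexp)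
      + 2⁻¹ * ((H : ℝ≥0∞)⁻¹ * ∑ h ∈ Finset.range H, F (exploreAt πexp h π)) := by
  have hcoe : (do let a ← PMF.uniformOfFintype (Fin H); pure (a : ℕ))
      = (PMF.uniformOfFintype (Fin H)).map (fun h : Fin H => (h : ℕ)) := rfl
  rw [explore, tsum_bind_mul, tsum_fintype, Fintype.sum_bool]
  simp only [if_true, Bool.false_eq_true, if_false, tsum_pure_mul, tsum_map_mul,
    hcoe, PMF.uniformOfFintype_apply, Fintype.card_bool, Fintype.card_fin, tsum_fintype,
    ← Finset.mul_sum, Nat.cast_ofNat]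
  rw [Fin.sum_univ_eq_sum_range fun h => F (exploreAt πexp h π)]

namespace LMDP

variable (M Ms : LMDP S A L)

/-- The squared Hellinger distance of the laws of the future of a history, weighted with the
likelihood of the history. -/
def futHell (πexp : Policy S A) (n : ℕ) (hist : List (S × A)) (s : S) : ℝ≥0∞ :=
  hell (fun ω => ∑ l, M.bel hist s l * M.fut πexp n s l ω)
    (fun ω => ∑ l, Ms.bel hist s l * Ms.fut πexp n s l ω)

/-- The `ℓ¹` distance of the laws of the future of a history, weighted with the likelihood of the
history. -/
def futL1 (πexp : Policy S A) (n : ℕ) (hist : List (S × A)) (s : S) : ℝ≥0∞ :=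
  l1 (fun ω => ∑ l, M.bel hist s l * M.fut πexp n s l ω)
    (fun ω => ∑ l, Ms.bel hist s l * Ms.fut πexp n s l ω)

theorem mix_fut_nonneg (πexp : Policy S A) (n : ℕ) (hist : List (S × A)) (s : S)
    (ω : Fin n → A × S) : 0 ≤ ∑ l, M.bel hist s l * M.fut πexp n s l ω :=
  Finset.sum_nonneg fun _ _ => mul_nonneg (M.bel_nonneg _ _ _) ((M.isProb_fut _ _ _ _).1 ω)

theorem hasSum_mix_fut (πexp : Policy S A) (n : ℕ) (hist : List (S × A)) (s : S) :
    HasSum (fun ω => ∑ l, M.bel hist s l * M.fut πexp n s l ω) (M.tot hist s) := by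
  have := hasSum_sum (s := Finset.univ) fun (l : Fin L) _ =>
    (M.isProb_fut πexp n s l).2.mul_left (M.bel hist s l)
  simpa [tot] using this

theorem rootDiff_le_futHell (πexp : Policy S A) (n : ℕ) (hist : List (S × A)) (s : S) :
    M.rootDiff Ms hist s ≤ M.futHell Ms πexp n hist s :=
  sq_sub_le_hell (M.mix_fut_nonneg πexp n hist s) (Ms.mix_fut_nonneg πexp n hist s)
    (M.hasSum_mix_fut πexp n hist s) (Ms.hasSum_mix_fut πexp n hist s)

theorem futHell_le_futL1 (πexp : Policy S A) (n : ℕ) (hist : List (S × A)) (s : S) :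
    M.futHell Ms πexp n hist s ≤ M.futL1 Ms πexp n hist s :=
  hell_le_l1 (M.mix_fut_nonneg πexp n hist s) (Ms.mix_fut_nonneg πexp n hist s)

theorem absDiff_le_futL1 (πexp : Policy S A) (n : ℕ) (hist : List (S × A)) (s : S) :
    M.absDiff Ms hist s ≤ M.futL1 Ms πexp n hist s := by
  have h := (M.hasSum_mix_fut πexp n hist s).sub (Ms.hasSum_mix_fut πexp n hist s)
  rw [absDiff, futL1, l1, ← h.tsum_eq,
    ← ENNReal.ofReal_tsum_of_nonneg (fun _ => abs_nonneg _) h.summable.abs]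
  refine ENNReal.ofReal_le_ofReal ?_
  have := norm_tsum_le_tsum_norm (f := fun ω => ∑ l, M.bel hist s l * M.fut πexp n s l ω
    - ∑ l, Ms.bel hist s l * Ms.fut πexp n s l ω) h.summable.norm
  simpa only [Real.norm_eq_abs] using this

/-- The squared Hellinger distance of the laws of a trajectory in two models. -/
def trajHell (N : ℕ) (π : Policy S A) : ℝ≥0∞ := hsum π N (M.rootDiff Ms)

/-- `Policy.switch (v + 1)` takes exactly `v` actions from `π` and then restarts `πexp`. -/
theorem hsum_futHell_switch (πexp π : Policy S A) (v n : ℕ) :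
    hsum π v (M.futHell Ms πexp n) = M.trajHell Ms (v + n) (Policy.switch (v + 1) π πexp) := by
  rw [trajHell, hsum_iterate, hsum_congr_policy (π' := Policy.switch (v + 1) π πexp) _
    fun hist s hl => (switch_of_lt (by omega) s).symm]
  exact hsum_congr fun hist s hl =>
    (M.iterate_step_rootDiff Ms (switch_fresh hl) n s).symm

theorem hsum_futHell_zero (πexp π : Policy S A) (n : ℕ) :
    hsum π 0 (M.futHell Ms πexp n) = M.trajHell Ms n (exploreAt πexp 0 π) := by
  rw [trajHell, hsum, hsum]
  exact tsum_congr fun s => (M.iterate_step_rootDiff Ms (exploreAt_fresh (by rfl)) n s).symm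

/-- The action after `j` pairs has probability `1 / A` under `exploreAt πexp (j + 1) π`; undoing
this weight gives the sum over all actions. -/
theorem hsum_sum_futHell (πexp π : Policy S A) (j n : ℕ) :
    hsum π j (fun hist s => ∑ a, ∑' s', M.futHell Ms πexp n (hist ++ [(s, a)]) s')
      = Fintype.card A * M.trajHell Ms (j + 1 + n) (exploreAt πexp (j + 1) π) := by
  rw [trajHell, hsum_iterate, hsum_succ, ← hsum_const_mul,
    hsum_congr_policy (π' := exploreAt πexp (j + 1) π) _
      fun hist s hl => (exploreAt_of_lt (by omega) s).symm]
  refine hsum_congr fun hist s hl => ?_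
  have h0 : (Fintype.card A : ℝ≥0∞) ≠ 0 := by simp
  rw [step, exploreAt_unif (by omega)]
  simp only [PMF.uniformOfFintype_apply, ← Finset.mul_sum]
  rw [← mul_assoc, ENNReal.mul_inv_cancel h0 (ENNReal.natCast_ne_top _), one_mul]
  refine Finset.sum_congr rfl fun a _ => tsum_congr fun s' => ?_
  exact (M.iterate_step_rootDiff Ms (exploreAt_fresh (by simp [hl])) n s').symm

theorem one_le_card : (1 : ℝ≥0∞) ≤ Fintype.card A := by
  exact_mod_cast Fintype.card_pos (α := A)

/-- The probability of the last action of `π` is bounded by one, and the uniform action replaces it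
at the cost of `A`. For `j = 0` there is no such action and `πexp` runs from the start. -/
theorem hsum_futHell_le (πexp π : Policy S A) (j n : ℕ) :
    hsum π j (M.futHell Ms πexp n)
      ≤ Fintype.card A * M.trajHell Ms (j + n) (exploreAt πexp j π) := by
  cases j with
  | zero =>
    rw [hsum_futHell_zero, zero_add]
    exact le_mul_of_one_le_left zero_le one_le_card
  | succ j =>
    rw [← hsum_sum_futHell, hsum_succ]
    refine hsum_mono fun hist s _ => ?_
    unfold step
    gcongr with a
    exact mul_le_of_le_one_left zero_le (PMF.coe_le_one _ _)

/-- The posterior law of the latent index given a history. -/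
def posterior (hist : List (S × A)) (s : S) (l : Fin L) : ℝ :=
  -- On impossible histories the prior keeps this a probability vector supported on the support of
  -- `ρ`.
  if M.tot hist s = 0 then (M.ρ l).toReal else M.bel hist s l / M.tot hist s

theorem sum_ρ : ∑ l, (M.ρ l).toReal = 1 := by
  have := (isProb_toReal M.ρ).2.tsum_eq
  rwa [tsum_fintype] at this

theorem posterior_nonneg (hist : List (S × A)) (s : S) (l : Fin L) :
    0 ≤ M.posterior hist s l := by
  unfold posterior
  split_ifs
  · exact ENNReal.toReal_nonneg
  · exact div_nonneg (M.bel_nonneg _ _ _) (M.tot_nonneg _ _)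

theorem sum_posterior (hist : List (S × A)) (s : S) : ∑ l, M.posterior hist s l = 1 := by
  unfold posterior
  split_ifs with h
  · exact M.sum_ρ
  · rw [← Finset.sum_div]
    exact div_self h

theorem posterior_eq_zero {l : Fin L} (hl : l ∉ M.ρ.support) (hist : List (S × A)) (s : S) :
    M.posterior hist s l = 0 := by
  unfold posterior
  split_ifs with h
  · have : M.ρ l = 0 := by simpa using hl
    simp [this]
  · rw [M.bel_eq_zero_of_notMem hl, zero_div]

theorem tot_mul_posterior (hist : List (S × A)) (s : S) (l : Fin L) :
    M.tot hist s * M.posterior hist s l = M.bel hist s l := by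
  unfold posterior
  split_ifs with h
  · have := M.bel_le_tot hist s l
    rw [h] at this ⊢
    rw [zero_mul, le_antisymm this (M.bel_nonneg _ _ _)]
  · field_simp

theorem sum_abs_posterior (hist : List (S × A)) (s : S) : ∑ l, |M.posterior hist s l| = 1 := by
  simp only [abs_of_nonneg (M.posterior_nonneg _ _ _), sum_posterior]

theorem posterior_dotProduct_le (hist : List (S × A)) (s : S) :
    M.posterior hist s ⬝ᵥ M.posterior hist s ≤ 1 := by
  rw [← M.sum_posterior hist s, dotProduct]
  refine Finset.sum_le_sum fun l _ => mul_le_of_le_one_left (M.posterior_nonneg _ _ _) ?_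
  rw [← M.sum_posterior hist s]
  exact Finset.single_le_sum (fun l _ => M.posterior_nonneg _ _ l) (Finset.mem_univ l)

end LMDP

end Explore

/-! ### Norming functionals -/

section Dual

variable {n : ℕ} {I Z : Type*}

/-- The seminorm `sup_i ∑_z |⟨κ i z, u⟩|`, in `[0, ∞]`. -/
def supAbs (κ : I → Z → Fin n → ℝ) (u : Fin n → ℝ) : ℝ≥0∞ :=
  ⨆ i, ∑' z, ENNReal.ofReal |κ i z ⬝ᵥ u|

theorem supAbs_add_le (κ : I → Z → Fin n → ℝ) (u v : Fin n → ℝ) :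
    supAbs κ (u + v) ≤ supAbs κ u + supAbs κ v := by
  refine iSup_le fun i => ?_
  calc ∑' z, ENNReal.ofReal |κ i z ⬝ᵥ (u + v)|
      ≤ ∑' z, (ENNReal.ofReal |κ i z ⬝ᵥ u| + ENNReal.ofReal |κ i z ⬝ᵥ v|) := by
        gcongr with z
        rw [← ENNReal.ofReal_add (abs_nonneg _) (abs_nonneg _), dotProduct_add]
        exact ENNReal.ofReal_le_ofReal (abs_add_le _ _)
    _ ≤ _ := by
        rw [ENNReal.tsum_add]
        exact add_le_add (le_iSup (fun i => ∑' z, ENNReal.ofReal |κ i z ⬝ᵥ u|) i)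
          (le_iSup (fun i => ∑' z, ENNReal.ofReal |κ i z ⬝ᵥ v|) i)

theorem supAbs_smul (κ : I → Z → Fin n → ℝ) (c : ℝ) (u : Fin n → ℝ) :
    supAbs κ (c • u) = ENNReal.ofReal |c| * supAbs κ u := by
  rw [supAbs, supAbs, ENNReal.mul_iSup]
  refine iSup_congr fun i => ?_
  rw [← ENNReal.tsum_mul_left]
  refine tsum_congr fun z => ?_
  rw [dotProduct_smul, smul_eq_mul, abs_mul, ENNReal.ofReal_mul (abs_nonneg _)]

/-- Hahn–Banach: a functional below the seminorm that attains it at `u`, with coordinates bounded by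
the seminorm of the unit vectors. It makes the error linear in the feature, as the potential
argument requires. -/
theorem exists_dual {κ : I → Z → Fin n → ℝ} {c : ℝ} (hc0 : 0 ≤ c)
    (hc : ∀ u, supAbs κ u ≤ ENNReal.ofReal (c * ∑ i, |u i|)) (u : Fin n → ℝ) :
    ∃ g : Fin n → ℝ, g ⬝ᵥ u = (supAbs κ u).toReal ∧
      (∀ u', |g ⬝ᵥ u'| ≤ (supAbs κ u').toReal) ∧ g ⬝ᵥ g ≤ n * c ^ 2 := by
  classical
  have hfin : ∀ u, supAbs κ u ≠ ∞ := fun u => ((hc u).trans_lt ENNReal.ofReal_lt_top).ne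
  set F : (Fin n → ℝ) → ℝ := fun u => (supAbs κ u).toReal with hF
  have hF0 : ∀ u, 0 ≤ F u := fun u => ENNReal.toReal_nonneg
  have hadd : ∀ u v, F (u + v) ≤ F u + F v := fun u v => by
    rw [hF, ← ENNReal.toReal_add (hfin u) (hfin v)]
    exact ENNReal.toReal_mono (ENNReal.add_ne_top.2 ⟨hfin u, hfin v⟩) (supAbs_add_le κ u v)
  have hsmul : ∀ (r : ℝ) u, F (r • u) = |r| * F u := fun r u => by
    rw [hF]
    simp only [supAbs_smul, ENNReal.toReal_mul, ENNReal.toReal_ofReal (abs_nonneg _)]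
  have hFc : ∀ i, F (Pi.single i 1) ≤ c := fun i => by
    refine ENNReal.toReal_le_of_le_ofReal hc0 ((hc _).trans (le_of_eq ?_))
    simp [Pi.single_apply, apply_ite abs]
  obtain ⟨G, hGu, hG⟩ : ∃ G : (Fin n → ℝ) →ₗ[ℝ] ℝ, G u = F u ∧ ∀ u', G u' ≤ F u' := by
    by_cases hu : u = 0
    · refine ⟨0, ?_, fun u' => by simpa using hF0 u'⟩
      have := hsmul 0 u
      rw [hu] at this ⊢
      simp only [zero_smul, abs_zero, zero_mul] at this
      simp [this]
    · obtain ⟨G, hG1, hG2⟩ := exists_extension_of_le_sublinear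
        (LinearPMap.mkSpanSingleton (K := ℝ) u (F u) hu) F
        (fun r hr u => by rw [hsmul, abs_of_pos hr]) hadd (by
          rintro ⟨x, hx⟩
          obtain ⟨r, rfl⟩ := Submodule.mem_span_singleton.1 hx
          rw [LinearPMap.mkSpanSingleton'_apply]
          simp only [hsmul, smul_eq_mul, RingHom.id_apply]
          exact mul_le_mul_of_nonneg_right (le_abs_self r) (hF0 u))
      refine ⟨G, ?_, hG2⟩
      have := hG1 ⟨u, Submodule.mem_span_singleton_self u⟩
      rw [this]
      exact LinearPMap.mkSpanSingleton_apply ℝ ℝ hu (F u)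
  have hneg : ∀ u', |G u'| ≤ F u' := fun u' => by
    refine abs_le'.2 ⟨hG u', ?_⟩
    have h1 := hG (-u')
    have h2 := hsmul (-1) u'
    rw [map_neg] at h1
    simp only [neg_smul, one_smul, abs_neg, abs_one, one_mul] at h2
    rwa [h2] at h1
  have hdot : ∀ u', (fun i => G (Pi.single i 1)) ⬝ᵥ u' = G u' := fun u' => by
    rw [LinearMap.pi_apply_eq_sum_univ G u', dotProduct]
    refine Finset.sum_congr rfl fun i _ => ?_
    rw [smul_eq_mul, mul_comm]
    congr 2
    funext j
    simp [Pi.single_apply, eq_comm]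
  refine ⟨fun i => G (Pi.single i 1), by rw [hdot, hGu], fun u' => by rw [hdot]; exact hneg u', ?_⟩
  rw [dotProduct]
  refine (Finset.sum_le_card_nsmul _ _ (c ^ 2) fun i _ => ?_).trans (by simp)
  rw [← sq, ← sq_abs]
  exact pow_le_pow_left₀ (abs_nonneg _) ((hneg _).trans (hFc i)) 2

end Dual

/-! ### Linear maps between the latent weights of two models -/

section LatentMaps

variable {S A : Type*} [Fintype A] {L : ℕ}

set_option linter.unusedSectionVars false

theorem ennreal_add_sq_le (x y : ℝ≥0∞) : (x + y) ^ 2 ≤ 2 * x ^ 2 + 2 * y ^ 2 := by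
  rcases eq_or_ne x ∞ with rfl | hx
  · simp
  rcases eq_or_ne y ∞ with rfl | hy
  · simp
  lift x to ℝ≥0 using hx
  lift y to ℝ≥0 using hy
  have : (x + y) ^ 2 ≤ 2 * x ^ 2 + 2 * y ^ 2 := by
    rw [← NNReal.coe_le_coe]
    push_cast
    nlinarith [sq_nonneg ((x : ℝ) - y)]
  exact_mod_cast this

theorem l1_zero_right_le {X : Type*} {p : Fin L → X → ℝ} (hp : ∀ i, IsProb (p i))
    (z : Fin L → ℝ) {c : X → ℝ} (hc : ∀ x, c x = 0) :
    l1 (fun x => ∑ i, z i * p i x) c ≤ ENNReal.ofReal (∑ i, |z i|) := by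
  unfold l1
  simpa only [hc, sub_zero] using l1_sum_le hp z

theorem isProb_prod {X Y : Type*} {p : X → ℝ} {q : X → Y → ℝ} (hp : IsProb p)
    (hq : ∀ x, IsProb (q x)) : IsProb fun z : X × Y => p z.1 * q z.1 z.2 := by
  have h0 : ∀ z : X × Y, 0 ≤ p z.1 * q z.1 z.2 := fun z => mul_nonneg (hp.1 _) ((hq _).1 _)
  refine ⟨h0, ?_⟩
  have h1 : ∑' z : X × Y, ENNReal.ofReal (p z.1 * q z.1 z.2) = 1 := by
    rw [ENNReal.tsum_prod']
    simp only [ENNReal.ofReal_mul (hp.1 _), ENNReal.tsum_mul_left, (hq _).tsum_ofReal, mul_one,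
      hp.tsum_ofReal]
  have h2 := ENNReal.hasSum_toReal (f := fun z : X × Y => ENNReal.ofReal (p z.1 * q z.1 z.2))
    (by rw [h1]; simp)
  rw [← ENNReal.tsum_toReal_eq fun z => ENNReal.ofReal_ne_top, h1] at h2
  simpa only [ENNReal.toReal_ofReal (h0 _), ENNReal.toReal_one] using h2

namespace LMDP

/-- The laws of the futures of length `n` under `πexp` of distinct latent indices overlap little. -/
def FutSeparated (M : LMDP S A L) (πexp : Policy S A) (n : ℕ) : Prop :=
  ∀ x, ∀ i ∈ M.ρ.support, ∀ j ∈ M.ρ.support, i ≠ j →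
    ∑' ω, √(M.fut πexp n x i ω) * √(M.fut πexp n x j ω) ≤ 1 / (2 * L)

theorem SeparatedUnder.futSeparated {M : LMDP S A L} {H : ℕ} {ϖ : ℕ → EReal} {πexp : Policy S A}
    (h : M.SeparatedUnder H ϖ πexp) {n : ℕ} (hn : n + 1 ≤ H) (hL : 0 < L)
    (hϖ : ((Real.log (2 * L) : ℝ) : EReal) ≤ ϖ (n + 1)) : M.FutSeparated πexp n :=
  fun x i hi j hj hij => le_of_log_le_bhattacharyya (by positivity)
    (hϖ.trans (h i hi j hj hij (n + 1) (by omega) hn x))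

variable (M Ms : LMDP S A L) (πexp : Policy S A)

open Classical in
/-- A linear map that recovers the weights of the latent indices of `M` from those of `Ms` that
give a similar law of the future. -/
def latMap (n : ℕ) (x : S) : Matrix (Fin L) (Fin L) ℝ :=
  if h : ∃ J : Matrix (Fin L) (Fin L) ℝ, ∀ c u : Fin L → ℝ, (∀ i ∉ M.ρ.support, c i = 0) →
      ENNReal.ofReal (∑ i, |J.mulVec u i - c i|)
        ≤ 2 * l1 (fun ω => ∑ j, u j * Ms.fut πexp n x j ω) (fun ω => ∑ i, c i * M.fut πexp n x i ω)
  then h.choose else 0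

theorem latMap_spec {n : ℕ} (hsep : M.FutSeparated πexp n) (x : S) {c : Fin L → ℝ}
    (hc : ∀ i ∉ M.ρ.support, c i = 0) (u : Fin L → ℝ) :
    ENNReal.ofReal (∑ i, |(M.latMap Ms πexp n x).mulVec u i - c i|)
        ≤ 2 * l1 (fun ω => ∑ j, u j * Ms.fut πexp n x j ω)
          (fun ω => ∑ i, c i * M.fut πexp n x i ω) := by
  classical
  have h : ∃ J : Matrix (Fin L) (Fin L) ℝ, ∀ c u : Fin L → ℝ, (∀ i ∉ M.ρ.support, c i = 0) →
      ENNReal.ofReal (∑ i, |J.mulVec u i - c i|) ≤ 2 * l1 (fun ω => ∑ j, u j * Ms.fut πexp n x j ω)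
        (fun ω => ∑ i, c i * M.fut πexp n x i ω) := by
    obtain ⟨J, hJ⟩ := exists_latent_map (M.isProb_fut πexp n x) (Ms.isProb_fut πexp n x)
      (Finset.univ.filter (· ∈ M.ρ.support)) (fun i hi j hj => hsep x i (Finset.mem_filter.1 hi).2 j
        (Finset.mem_filter.1 hj).2)
    exact ⟨J, fun c u hc => hJ c u fun i hi => hc i (by simpa using hi)⟩
  rw [latMap, dif_pos h]
  exact h.choose_spec c u hc

/-- The coefficients of the error of the latent maps in one transition. -/
def stepErr (n : ℕ) (x : S) (a : A) (z : S × Fin L) (m : Fin L) : ℝ :=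
  M.tr z.2 x a z.1 * M.latMap Ms πexp (n + 1) x z.2 m
    - M.latMap Ms πexp n z.1 z.2 m * Ms.tr m x a z.1

theorem stepErr_dotProduct (n : ℕ) (x : S) (a : A) (s' : S) (i : Fin L) (u : Fin L → ℝ) :
    M.stepErr Ms πexp n x a (s', i) ⬝ᵥ u
      = M.tr i x a s' * (M.latMap Ms πexp (n + 1) x).mulVec u i
        - (M.latMap Ms πexp n s').mulVec (fun m => Ms.tr m x a s' * u m) i := by
  simp only [dotProduct, Matrix.mulVec, stepErr, Finset.mul_sum, ← Finset.sum_sub_distrib]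
  exact Finset.sum_congr rfl fun m _ => by ring

/-- The coefficients of the error of the latent maps in the law of the future. -/
def endErr (n : ℕ) (x : S) (_ : Unit) (ω : Fin n → A × S) (m : Fin L) : ℝ :=
  ∑ i, M.latMap Ms πexp n x i m * M.fut πexp n x i ω - Ms.fut πexp n x m ω

theorem endErr_dotProduct (n : ℕ) (x : S) (t : Unit) (ω : Fin n → A × S) (u : Fin L → ℝ) :
    M.endErr Ms πexp n x t ω ⬝ᵥ u
      = ∑ i, (M.latMap Ms πexp n x).mulVec u i * M.fut πexp n x i ω
        - ∑ m, u m * Ms.fut πexp n x m ω := by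
  simp only [dotProduct, Matrix.mulVec, endErr, sub_mul, Finset.sum_sub_distrib, Finset.sum_mul]
  rw [Finset.sum_comm]
  congr 1
  · exact Finset.sum_congr rfl fun i _ => Finset.sum_congr rfl fun m _ => by ring
  · exact Finset.sum_congr rfl fun m _ => by ring

variable {πexp}

/-- `stepErr` is the defect in commuting reconstruction with a transition; both orders are compared
with `M.tr * c`. The choice `c = 0` gives an a priori bound, and the posterior of `M` gives a bound
by observable distances. -/
theorem tsum_stepErr_le {n : ℕ} (h1 : M.FutSeparated πexp (n + 1)) (h0 : M.FutSeparated πexp n)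
    (x : S) (a : A) {c : Fin L → ℝ} (hc : ∀ i ∉ M.ρ.support, c i = 0) (u : Fin L → ℝ) :
    ∑' z, ENNReal.ofReal |M.stepErr Ms πexp n x a z ⬝ᵥ u|
      ≤ 2 * l1 (fun ω => ∑ j, u j * Ms.fut πexp (n + 1) x j ω)
          (fun ω => ∑ i, c i * M.fut πexp (n + 1) x i ω)
        + 2 * ∑' s', l1 (fun ω => ∑ j, (Ms.tr j x a s' * u j) * Ms.fut πexp n s' j ω)
          (fun ω => ∑ i, (M.tr i x a s' * c i) * M.fut πexp n s' i ω) := by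
  rw [ENNReal.tsum_prod', ← ENNReal.tsum_mul_left]
  simp only [tsum_fintype, stepErr_dotProduct]
  set J := M.latMap Ms πexp (n + 1) x
  calc _ ≤ ∑' s', (∑ i, ENNReal.ofReal (M.tr i x a s') * ENNReal.ofReal |J.mulVec u i - c i|
        + ENNReal.ofReal (∑ i, |(M.latMap Ms πexp n s').mulVec (fun m => Ms.tr m x a s' * u m) i
          - M.tr i x a s' * c i|)) := by
        gcongr with s'
        rw [ENNReal.ofReal_sum_of_nonneg fun i _ => abs_nonneg _, ← Finset.sum_add_distrib]
        refine Finset.sum_le_sum fun i _ => ?_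
        have ht := (M.isProb_tr i x a).1 s'
        rw [← ENNReal.ofReal_mul ht, ← ENNReal.ofReal_add (by positivity) (abs_nonneg _)]
        refine ENNReal.ofReal_le_ofReal ?_
        have e : M.tr i x a s' * |J.mulVec u i - c i| = |M.tr i x a s' * (J.mulVec u i - c i)| := by
          rw [abs_mul, abs_of_nonneg ht]
        rw [e, abs_sub_comm _ (M.tr i x a s' * c i)]
        refine le_trans (le_of_eq ?_) (abs_add_le _ _)
        congr 1
        ring
    _ ≤ _ := by
        rw [ENNReal.tsum_add]
        gcongr with s'
        · rw [Summable.tsum_finsetSum fun _ _ => ENNReal.summable]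
          simp only [ENNReal.tsum_mul_right, (M.isProb_tr _ x a).tsum_ofReal, one_mul]
          rw [← ENNReal.ofReal_sum_of_nonneg fun i _ => abs_nonneg _]
          exact M.latMap_spec Ms πexp h1 x hc u
        · exact M.latMap_spec Ms πexp h0 s' (fun i hi => by rw [hc i hi, mul_zero]) _

/-- Triangle inequality through the mixture with weights `c`: `2` from the latent map and `1` from
the distance itself. -/
theorem tsum_endErr_le {n : ℕ} (h0 : M.FutSeparated πexp n)
    (x : S) {c : Fin L → ℝ} (hc : ∀ i ∉ M.ρ.support, c i = 0) (u : Fin L → ℝ) (t : Unit) :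
    ∑' ω, ENNReal.ofReal |M.endErr Ms πexp n x t ω ⬝ᵥ u|
      ≤ 3 * l1 (fun ω => ∑ j, u j * Ms.fut πexp n x j ω)
          (fun ω => ∑ i, c i * M.fut πexp n x i ω) := by
  simp only [endErr_dotProduct]
  set J := M.latMap Ms πexp n x
  refine (l1_triangle _ (fun ω => ∑ i, c i * M.fut πexp n x i ω) _).trans ?_
  have h2 : l1 (fun ω => ∑ i, J.mulVec u i * M.fut πexp n x i ω)
      (fun ω => ∑ i, c i * M.fut πexp n x i ω) ≤ 2 * l1 (fun ω => ∑ j, u j * Ms.fut πexp n x j ω)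
          (fun ω => ∑ i, c i * M.fut πexp n x i ω) := by
    refine le_trans (le_of_eq ?_) ((l1_sum_le (M.isProb_fut πexp n x)
      fun i => J.mulVec u i - c i).trans (M.latMap_spec Ms πexp h0 x hc u))
    unfold l1
    simp only [sub_mul, Finset.sum_sub_distrib]
  rw [l1_comm (fun ω => ∑ i, c i * M.fut πexp n x i ω)]
  refine (add_le_add_left h2 _).trans (le_of_eq ?_)
  ring

theorem supAbs_stepErr_le {n : ℕ} (h1 : M.FutSeparated πexp (n + 1))
    (h0 : M.FutSeparated πexp n) (x : S) (u : Fin L → ℝ) :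
    supAbs (M.stepErr Ms πexp n x) u ≤ ENNReal.ofReal (4 * ∑ i, |u i|) := by
  refine iSup_le fun a => (M.tsum_stepErr_le Ms h1 h0 x a (c := 0) (fun _ _ => rfl) u).trans ?_
  have e1 := l1_zero_right_le (Ms.isProb_fut πexp (n + 1) x) u
    (c := fun ω => ∑ i, (0 : Fin L → ℝ) i * M.fut πexp (n + 1) x i ω) (by simp)
  have e2 : ∑' s', l1 (fun ω => ∑ j, (Ms.tr j x a s' * u j) * Ms.fut πexp n s' j ω)
      (fun ω => ∑ i, (M.tr i x a s' * (0 : Fin L → ℝ) i) * M.fut πexp n s' i ω)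
      ≤ ENNReal.ofReal (∑ i, |u i|) := by
    calc _ ≤ ∑' s', ∑ i, ENNReal.ofReal (Ms.tr i x a s') * ENNReal.ofReal |u i| := by
          gcongr with s'
          refine (l1_zero_right_le (Ms.isProb_fut πexp n s') (fun j => Ms.tr j x a s' * u j)
            (by simp)).trans (le_of_eq ?_)
          rw [ENNReal.ofReal_sum_of_nonneg fun i _ => abs_nonneg _]
          refine Finset.sum_congr rfl fun i _ => ?_
          rw [abs_mul, abs_of_nonneg ((Ms.isProb_tr i x a).1 s'),
            ENNReal.ofReal_mul ((Ms.isProb_tr i x a).1 s')]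
      _ = _ := by
          rw [Summable.tsum_finsetSum fun _ _ => ENNReal.summable]
          simp only [ENNReal.tsum_mul_right, (Ms.isProb_tr _ x a).tsum_ofReal, one_mul]
          rw [← ENNReal.ofReal_sum_of_nonneg fun i _ => abs_nonneg _]
  rw [ENNReal.ofReal_mul (by norm_num)]
  calc _ ≤ 2 * ENNReal.ofReal (∑ i, |u i|) + 2 * ENNReal.ofReal (∑ i, |u i|) := by gcongr
    _ = _ := by rw [← add_mul]; norm_num

/-- The constant `3` is rounded up to `4`, so that both kinds of error enter the same summation
lemma. -/
theorem supAbs_endErr_le {n : ℕ} (h0 : M.FutSeparated πexp n) (x : S) (u : Fin L → ℝ) :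
    supAbs (M.endErr Ms πexp n x) u ≤ ENNReal.ofReal (4 * ∑ i, |u i|) := by
  refine iSup_le fun t => (M.tsum_endErr_le Ms h0 x (c := 0) (fun _ _ => rfl) u t).trans ?_
  have e1 := l1_zero_right_le (Ms.isProb_fut πexp n x) u
    (c := fun ω => ∑ i, (0 : Fin L → ℝ) i * M.fut πexp n x i ω) (by simp)
  rw [ENNReal.ofReal_mul (by norm_num)]
  refine mul_le_mul' ?_ e1
  norm_num

end LMDP

end LatentMaps

/-! ### Propagation of the latent errors before decoding -/

section LatentErrors

variable {S A : Type*} [Fintype A] [Nonempty A] {L : ℕ}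

set_option linter.unusedSectionVars false

namespace LMDP

variable (M Ms : LMDP S A L) {πexp : Policy S A}

theorem tot_mul_sum_posterior {X : Type*} (hist : List (S × A)) (s : S) (p : Fin L → X → ℝ)
    (x : X) : M.tot hist s * ∑ l, M.posterior hist s l * p l x = ∑ l, M.bel hist s l * p l x := by
  rw [Finset.mul_sum]
  refine Finset.sum_congr rfl fun l _ => ?_
  rw [← mul_assoc, tot_mul_posterior]

theorem tot_mul_l1_posterior_sq_le {X : Type*} {p q : Fin L → X → ℝ} (hp : ∀ i, IsProb (p i))
    (hq : ∀ i, IsProb (q i)) (hist : List (S × A)) (s : S) :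
    ENNReal.ofReal (Ms.tot hist s) * l1 (fun x => ∑ l, Ms.posterior hist s l * q l x)
        (fun x => ∑ l, M.posterior hist s l * p l x) ^ 2
      ≤ 4 * hell (fun x => ∑ l, M.bel hist s l * p l x)
        (fun x => ∑ l, Ms.bel hist s l * q l x) := by
  have := mul_l1_sq_le_hell (isProb_mix hp (M.posterior_nonneg hist s) (M.sum_posterior hist s))
    (isProb_mix hq (Ms.posterior_nonneg hist s) (Ms.sum_posterior hist s))
    (M.tot_nonneg hist s) (Ms.tot_nonneg hist s)
  simp only [tot_mul_sum_posterior] at this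
  rwa [l1_comm]

/-- The comparison vector is the posterior of `M`; then both distances are between normalized
mixtures, and the likelihood of `Ms` times their squares is bounded by the unnormalized Hellinger
distances. -/
theorem tot_mul_tsum_stepErr_sq_le {n : ℕ} (h1 : M.FutSeparated πexp (n + 1))
    (h0 : M.FutSeparated πexp n) (hist : List (S × A)) (s : S) (a : A) :
    ENNReal.ofReal (Ms.tot hist s)
        * (∑' z, ENNReal.ofReal |M.stepErr Ms πexp n s a z ⬝ᵥ Ms.posterior hist s|) ^ 2
      ≤ 32 * (M.futHell Ms πexp (n + 1) hist s
        + ∑' s', M.futHell Ms πexp n (hist ++ [(s, a)]) s') := by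
  have hle := M.tsum_stepErr_le Ms h1 h0 s a (c := M.posterior hist s)
    (fun i hi => M.posterior_eq_zero hi hist s) (Ms.posterior hist s)
  set x := l1 (fun ω => ∑ j, Ms.posterior hist s j * Ms.fut πexp (n + 1) s j ω)
    (fun ω => ∑ i, M.posterior hist s i * M.fut πexp (n + 1) s i ω)
  set y := ∑' s', l1 (fun ω => ∑ j, (Ms.tr j s a s' * Ms.posterior hist s j)
      * Ms.fut πexp n s' j ω)
    (fun ω => ∑ i, (M.tr i s a s' * M.posterior hist s i) * M.fut πexp n s' i ω) with hy
  have hx : ENNReal.ofReal (Ms.tot hist s) * x ^ 2 ≤ 4 * M.futHell Ms πexp (n + 1) hist s :=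
    M.tot_mul_l1_posterior_sq_le Ms (M.isProb_fut πexp (n + 1) s)
      (Ms.isProb_fut πexp (n + 1) s) hist s
  have hy' : ENNReal.ofReal (Ms.tot hist s) * y ^ 2
      ≤ 4 * ∑' s', M.futHell Ms πexp n (hist ++ [(s, a)]) s' := by
    -- The sum over the next state is one distance between joint laws of the next state and its
    -- future, so it can be squared as a whole.
    have h := M.tot_mul_l1_posterior_sq_le Ms
      (fun i => isProb_prod (M.isProb_tr i s a) fun s' => M.isProb_fut πexp n s' i)
      (fun i => isProb_prod (Ms.isProb_tr i s a) fun s' => Ms.isProb_fut πexp n s' i) hist s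
    rw [hell, l1, ENNReal.tsum_prod', ENNReal.tsum_prod'] at h
    refine le_trans (le_of_eq ?_) (h.trans (le_of_eq ?_))
    · simp only [hy, l1]
      congr 3
      funext s'
      congr 1
      funext ω
      congr 4
      · funext l
        ring
      · funext l
        ring
    · congr 2
      funext s'
      rw [futHell, hell]
      congr 1
      funext ω
      simp only [bel_append, mul_assoc]
  calc _ ≤ ENNReal.ofReal (Ms.tot hist s) * (2 * x + 2 * y) ^ 2 := by gcongr
    _ ≤ ENNReal.ofReal (Ms.tot hist s) * (2 * (2 * x) ^ 2 + 2 * (2 * y) ^ 2) := by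
        gcongr
        exact ennreal_add_sq_le _ _
    _ = 8 * (ENNReal.ofReal (Ms.tot hist s) * x ^ 2)
        + 8 * (ENNReal.ofReal (Ms.tot hist s) * y ^ 2) := by ring
    _ ≤ 8 * (4 * M.futHell Ms πexp (n + 1) hist s)
        + 8 * (4 * ∑' s', M.futHell Ms πexp n (hist ++ [(s, a)]) s') := by gcongr
    _ = _ := by ring

theorem tot_mul_supAbs_endErr_sq_le {n : ℕ} (h0 : M.FutSeparated πexp n)
    (hist : List (S × A)) (s : S) :
    ENNReal.ofReal (Ms.tot hist s) * supAbs (M.endErr Ms πexp n s) (Ms.posterior hist s) ^ 2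
      ≤ 36 * M.futHell Ms πexp n hist s := by
  have hle := M.tsum_endErr_le Ms h0 s (c := M.posterior hist s)
    (fun i hi => M.posterior_eq_zero hi hist s) (Ms.posterior hist s) ()
  have hsup : supAbs (M.endErr Ms πexp n s) (Ms.posterior hist s)
      = ∑' ω, ENNReal.ofReal |M.endErr Ms πexp n s () ω ⬝ᵥ Ms.posterior hist s| := by
    rw [supAbs, iSup_unique]
  have hx := M.tot_mul_l1_posterior_sq_le Ms (M.isProb_fut πexp n s) (Ms.isProb_fut πexp n s) hist s
  rw [hsup]
  refine (mul_le_mul_right (pow_le_pow_left₀ zero_le hle 2) _).trans ?_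
  rw [mul_pow, mul_left_comm]
  refine (mul_le_mul_right hx _).trans (le_of_eq ?_)
  rw [← mul_assoc, futHell]
  norm_num

/-- The supremum over the finitely many actions is attained, and it is bounded by the sum that a
uniform action reveals. -/
theorem hsum_stepErr_sq_le {n : ℕ} (h1 : M.FutSeparated πexp (n + 1))
    (h0 : M.FutSeparated πexp n) (π : Policy S A) (j : ℕ) :
    hsum π j (fun hist s => ENNReal.ofReal (Ms.tot hist s)
        * supAbs (M.stepErr Ms πexp n s) (Ms.posterior hist s) ^ 2)
      ≤ 32 * (Fintype.card A * (M.trajHell Ms (j + 1 + n) (exploreAt πexp j π)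
        + M.trajHell Ms (j + 1 + n) (exploreAt πexp (j + 1) π))) := by
  have e1 := M.hsum_futHell_le Ms πexp π j (n + 1)
  rw [show j + (n + 1) = j + 1 + n by ring] at e1
  rw [mul_add, ← hsum_sum_futHell]
  refine le_trans ?_ (mul_le_mul_right (add_le_add_left e1 _) _)
  rw [← hsum_add, ← hsum_const_mul]
  refine hsum_mono fun hist s _ => ?_
  obtain ⟨a, ha⟩ := exists_eq_ciSup_of_finite (f := fun a =>
    ∑' z, ENNReal.ofReal |M.stepErr Ms πexp n s a z ⬝ᵥ Ms.posterior hist s|)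
  rw [supAbs, ← ha]
  refine (M.tot_mul_tsum_stepErr_sq_le Ms h1 h0 hist s a).trans ?_
  gcongr
  exact Finset.single_le_sum (f := fun a => ∑' s', M.futHell Ms πexp n (hist ++ [(s, a)]) s')
    (fun _ _ => zero_le) (Finset.mem_univ a)

theorem hsum_endErr_sq_le {n : ℕ} (h0 : M.FutSeparated πexp n) (π : Policy S A) (v : ℕ) :
    hsum π v (fun hist s => ENNReal.ofReal (Ms.tot hist s)
        * supAbs (M.endErr Ms πexp n s) (Ms.posterior hist s) ^ 2)
      ≤ 36 * M.trajHell Ms (v + n) (Policy.switch (v + 1) π πexp) := by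
  rw [← hsum_futHell_switch, ← hsum_const_mul]
  exact hsum_mono fun hist s _ => M.tot_mul_supAbs_endErr_sq_le Ms h0 hist s

/-- The `ℓ¹` distance of the weights of the latent indices in `M` from their reconstruction. -/
def latDist (πexp : Policy S A) (n : ℕ) (hist : List (S × A)) (s : S) : ℝ≥0∞ :=
  ENNReal.ofReal (∑ i, |(M.latMap Ms πexp n s).mulVec (Ms.bel hist s) i - M.bel hist s i|)

theorem latDist_le {n : ℕ} (h : M.FutSeparated πexp n) (hist : List (S × A)) (s : S) :
    M.latDist Ms πexp n hist s ≤ 2 * M.futL1 Ms πexp n hist s := by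
  rw [futL1, l1_comm]
  exact M.latMap_spec Ms πexp h s (fun i hi => M.bel_eq_zero_of_notMem hi hist s) _

theorem supAbs_bel {I Z : Type*} (κ : I → Z → Fin L → ℝ) (hist : List (S × A)) (s : S) :
    supAbs κ (Ms.bel hist s) = ENNReal.ofReal (Ms.tot hist s)
      * supAbs κ (Ms.posterior hist s) := by
  have : Ms.bel hist s = Ms.tot hist s • Ms.posterior hist s := by
    funext l
    rw [Pi.smul_apply, smul_eq_mul, tot_mul_posterior]
  rw [this, supAbs_smul, abs_of_nonneg (Ms.tot_nonneg _ _)]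

/-- Inserting the reconstruction at `s` moved by the kernels of `M` leaves the old error, preserved
by these stochastic kernels, and `stepErr`. -/
theorem tsum_latDist_le (n : ℕ) (hist : List (S × A)) (s : S) (a : A) :
    ∑' s', M.latDist Ms πexp n (hist ++ [(s, a)]) s' ≤ M.latDist Ms πexp (n + 1) hist s
      + supAbs (M.stepErr Ms πexp n s) (Ms.bel hist s) := by
  set J := M.latMap Ms πexp (n + 1) s
  calc _ ≤ ∑' s', (∑ i, ENNReal.ofReal (M.tr i s a s')
          * ENNReal.ofReal |J.mulVec (Ms.bel hist s) i - M.bel hist s i|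
        + ∑ i, ENNReal.ofReal |M.stepErr Ms πexp n s a (s', i) ⬝ᵥ Ms.bel hist s|) := by
        gcongr with s'
        rw [latDist, ENNReal.ofReal_sum_of_nonneg fun i _ => abs_nonneg _,
          ← Finset.sum_add_distrib]
        refine Finset.sum_le_sum fun i _ => ?_
        have ht := (M.isProb_tr i s a).1 s'
        rw [← ENNReal.ofReal_mul ht, ← ENNReal.ofReal_add (by positivity) (abs_nonneg _)]
        refine ENNReal.ofReal_le_ofReal ?_
        have e : M.tr i s a s' * |J.mulVec (Ms.bel hist s) i - M.bel hist s i|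
            = |M.tr i s a s' * (J.mulVec (Ms.bel hist s) i - M.bel hist s i)| := by
          rw [abs_mul, abs_of_nonneg ht]
        rw [e, stepErr_dotProduct, ← abs_neg (M.tr i s a s' * _ - _)]
        refine le_trans (le_of_eq ?_) (abs_add_le _ _)
        have e2 : Ms.bel (hist ++ [(s, a)]) s' = fun m => Ms.tr m s a s' * Ms.bel hist s m := by
          funext m
          rw [bel_append, mul_comm]
        rw [bel_append, e2]
        congr 1
        ring
    _ = ENNReal.ofReal (∑ i, |J.mulVec (Ms.bel hist s) i - M.bel hist s i|)
        + ∑' z, ENNReal.ofReal |M.stepErr Ms πexp n s a z ⬝ᵥ Ms.bel hist s| := by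
        rw [ENNReal.tsum_add, Summable.tsum_finsetSum fun _ _ => ENNReal.summable,
          ENNReal.tsum_prod']
        simp only [ENNReal.tsum_mul_right, (M.isProb_tr _ s a).tsum_ofReal, one_mul, tsum_fintype]
        rw [ENNReal.ofReal_sum_of_nonneg fun i _ => abs_nonneg _]
    _ ≤ _ := by
        gcongr
        · exact le_rfl
        · exact le_iSup (fun a => ∑' z, ENNReal.ofReal |M.stepErr Ms πexp n s a z
            ⬝ᵥ Ms.bel hist s|) a

theorem step_le_of_le (π : Policy S A) {c : List (S × A) → S → ℝ≥0∞} {hist : List (S × A)}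
    {s : S} {r : ℝ≥0∞} (h : ∀ a, ∑' s', c (hist ++ [(s, a)]) s' ≤ r) : step π c hist s ≤ r := by
  calc step π c hist s ≤ ∑ a, π hist s a * r := by
        unfold step
        gcongr with a
        exact h a
    _ = r := by rw [← Finset.sum_mul, sum_policy, one_mul]

theorem hsum_latDist_succ_le (π : Policy S A) (j n : ℕ) :
    hsum π (j + 1) (M.latDist Ms πexp n) ≤ hsum π j (M.latDist Ms πexp (n + 1))
      + hsum π j (fun hist s => ENNReal.ofReal (Ms.tot hist s)
        * supAbs (M.stepErr Ms πexp n s) (Ms.posterior hist s)) := by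
  rw [hsum_succ, ← hsum_add]
  refine hsum_mono fun hist s _ => step_le_of_le π fun a => ?_
  rw [← supAbs_bel]
  exact M.tsum_latDist_le Ms n hist s a

/-- Triangle inequality through the future of `M` with the reconstructed weights. -/
theorem futL1_le (n : ℕ) (hist : List (S × A)) (s : S) :
    M.futL1 Ms πexp n hist s ≤ M.latDist Ms πexp n hist s
      + ENNReal.ofReal (Ms.tot hist s)
        * supAbs (M.endErr Ms πexp n s) (Ms.posterior hist s) := by
  rw [← supAbs_bel]
  set J := M.latMap Ms πexp n s with hJ
  refine (l1_triangle _ (fun ω => ∑ i, J.mulVec (Ms.bel hist s) i * M.fut πexp n s i ω) _).trans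
    (add_le_add ?_ ?_)
  · rw [l1_comm]
    refine le_trans (le_of_eq ?_) (l1_sum_le (M.isProb_fut πexp n s)
      fun i => J.mulVec (Ms.bel hist s) i - M.bel hist s i)
    unfold l1
    simp only [sub_mul, Finset.sum_sub_distrib]
  · refine le_trans (le_of_eq ?_) (le_iSup (fun t => ∑' ω, ENNReal.ofReal
      |M.endErr Ms πexp n s t ω ⬝ᵥ Ms.bel hist s|) ())
    simp only [endErr_dotProduct]
    rfl

/-- The errors of the latent maps dominate the distance of the laws of the future of the states
before the decoding time. -/
theorem hsum_futL1_le {v n : ℕ} (hsep : M.FutSeparated πexp (v + n)) (π : Policy S A) :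
    hsum π v (M.futL1 Ms πexp n) ≤ 2 * hsum π 0 (M.futL1 Ms πexp (v + n))
      + ∑ j ∈ Finset.range v, hsum π j (fun hist s => ENNReal.ofReal (Ms.tot hist s)
        * supAbs (M.stepErr Ms πexp (v + n - (j + 1)) s) (Ms.posterior hist s))
      + hsum π v (fun hist s => ENNReal.ofReal (Ms.tot hist s)
        * supAbs (M.endErr Ms πexp n s) (Ms.posterior hist s)) := by
  have key : ∀ i ≤ v, hsum π i (M.latDist Ms πexp (v + n - i))
      ≤ 2 * hsum π 0 (M.futL1 Ms πexp (v + n))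
      + ∑ j ∈ Finset.range i, hsum π j (fun hist s => ENNReal.ofReal (Ms.tot hist s)
        * supAbs (M.stepErr Ms πexp (v + n - (j + 1)) s) (Ms.posterior hist s)) := by
    intro i
    induction i with
    | zero =>
      intro _
      rw [Finset.range_zero, Finset.sum_empty, add_zero, ← hsum_const_mul]
      exact hsum_mono fun hist s _ => M.latDist_le Ms hsep hist s
    | succ i ih =>
      intro hi
      refine (M.hsum_latDist_succ_le Ms π i _).trans ?_
      rw [show v + n - (i + 1) + 1 = v + n - i by omega, Finset.sum_range_succ, ← add_assoc]
      gcongr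
      exact ih (by omega)
  have h := key v le_rfl
  rw [Nat.add_sub_cancel_left] at h
  refine le_trans ?_ (add_le_add_left h _)
  rw [← hsum_add]
  exact hsum_mono fun hist s _ => M.futL1_le Ms n hist s

end LMDP

end LatentErrors

/-! ### Pairing the latent indices of the two models after decoding -/

section Pairing

variable {S A : Type*} [Fintype A] [Nonempty A] {L : ℕ}

set_option linter.unusedSectionVars false

namespace LMDP

variable (M Ms : LMDP S A L) (πexp : Policy S A)

theorem dec_prefix (v : ℕ) (hist : List (S × A)) (s : S) :
    M.dec v (hist.take v) (stAt v hist s) = M.dec v hist s := by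
  have h1 : stAt v (hist.take v) (stAt v hist s) = stAt v hist s := by
    simp [stAt]
  simp only [dec, h1, List.take_take, min_self]

theorem hsum_prefix_tot (π : Policy S A) (v n : ℕ) (φ : List (S × A) → S → ℝ≥0∞) :
    hsum π (v + n) (fun hist s =>
        φ (hist.take v) (stAt v hist s) * ENNReal.ofReal (M.tot hist s))
      = hsum π v fun hist s => φ hist s * ENNReal.ofReal (M.tot hist s) := by
  have h := M.hsum_prefix π v n fun _ => φ
  simpa only [tot, ENNReal.ofReal_sum_of_nonneg fun l _ => M.bel_nonneg _ _ l,
    Finset.mul_sum] using h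

theorem exists_pairIdx (n : ℕ) (m : Fin L) (x : S) :
    ∃ l ∈ M.ρ.support, ∀ l' ∈ M.ρ.support,
      l1 (M.fut πexp n x l) (Ms.fut πexp n x m) ≤ l1 (M.fut πexp n x l') (Ms.fut πexp n x m) :=
  Set.exists_min_image _ _ (Set.toFinite M.ρ.support) M.ρ.support_nonempty

/-- The latent index of `M` whose law of the future from `x` is closest to that of the latent index
`m` of `Ms`. -/
def pairIdx (n : ℕ) (m : Fin L) (x : S) : Fin L := (M.exists_pairIdx Ms πexp n m x).choose

/-- The distance of the transition laws of paired latent indices. -/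
def trErr (n : ℕ) (m : Fin L) (x s : S) : ℝ≥0∞ :=
  ⨆ a, l1 (M.tr (M.pairIdx Ms πexp n m x) s a) (Ms.tr m s a)

theorem trErr_le_two (n : ℕ) (m : Fin L) (x s : S) : M.trErr Ms πexp n m x s ≤ 2 :=
  iSup_le fun a => l1_le_two (M.isProb_tr _ s a) (Ms.isProb_tr m s a)

variable {πexp}

/-- Separated futures have affinity at most `1 / 2`, hence `ℓ¹` distance at least `1`. As the paired
index is the closest one, any other index is at distance at least `1 / 2` from `m`. -/
theorem one_le_of_ne_pairIdx {n : ℕ} (hsep : M.FutSeparated πexp n) {l m : Fin L} {x : S}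
    (hl : l ∈ M.ρ.support) (hne : l ≠ M.pairIdx Ms πexp n m x) :
    1 ≤ 4 * l1 (M.fut πexp n x l) (Ms.fut πexp n x m) ^ 2 := by
  obtain ⟨hp, hmin⟩ := (M.exists_pairIdx Ms πexp n m x).choose_spec
  set p := M.pairIdx Ms πexp n m x with hpdef
  have hBC := hsep x l hl p hp hne
  have hL : (1 : ℝ) ≤ L := by
    have := l.pos
    exact_mod_cast this
  have hBC2 : ∑' ω, √(M.fut πexp n x l ω) * √(M.fut πexp n x p ω) ≤ 1 / 2 :=
    hBC.trans (one_div_le_one_div_of_le (by norm_num) (by linarith))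
  have h1 : 1 ≤ l1 (M.fut πexp n x l) (M.fut πexp n x p) := by
    refine le_trans ?_ (hell_le_l1 (M.isProb_fut πexp n x l).1 (M.isProb_fut πexp n x p).1)
    have := hell_scaled (M.isProb_fut πexp n x l) (M.isProb_fut πexp n x p) zero_le_one zero_le_one
    simp only [one_mul, Real.sqrt_one, mul_one] at this
    rw [this, ← ENNReal.ofReal_one]
    exact ENNReal.ofReal_le_ofReal (by linarith)
  have h2 : 1 ≤ 2 * l1 (M.fut πexp n x l) (Ms.fut πexp n x m) := by
    refine h1.trans ((l1_triangle _ (Ms.fut πexp n x m) _).trans ?_)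
    rw [two_mul, l1_comm (Ms.fut πexp n x m)]
    gcongr
    exact hmin l hl
  calc (1 : ℝ≥0∞) ≤ (2 * l1 (M.fut πexp n x l) (Ms.fut πexp n x m)) ^ 2 := one_le_pow₀ h2
    _ = _ := by rw [mul_pow]; norm_num

theorem tot_mul_l1_dec_sq_le {X : Type*} {p q : Fin L → X → ℝ} (hp : ∀ i, IsProb (p i))
    (hq : ∀ i, IsProb (q i)) (v : ℕ) (hist : List (S × A)) (s : S) {h : ℝ≥0∞}
    (h1 : M.rootDiff Ms hist s ≤ h)
    (h2 : hell (fun x => ∑ i, M.bel hist s i * p i x) (fun x => ∑ i, Ms.bel hist s i * q i x) ≤ h) :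
    ENNReal.ofReal (Ms.tot hist s) * l1 (p (M.dec v hist s)) (q (Ms.dec v hist s)) ^ 2
      ≤ 24 * ENNReal.ofReal (M.resid v hist s) + 12 * ENNReal.ofReal (Ms.resid v hist s)
        + 36 * h := by
  refine (mul_l1_component_sq_le hp hq (M.bel_nonneg hist s) (Ms.bel_nonneg hist s)
    (M.dec v hist s) (Ms.dec v hist s)).trans ?_
  have hr := M.resid_nonneg v hist s
  have hr' := Ms.resid_nonneg v hist s
  change ENNReal.ofReal (24 * M.resid v hist s + 12 * Ms.resid v hist s
    + 24 * (√(M.tot hist s) - √(Ms.tot hist s)) ^ 2) + _ ≤ _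
  rw [ENNReal.ofReal_add (by positivity) (by positivity),
    ENNReal.ofReal_add (by positivity) (by positivity), ENNReal.ofReal_mul (by norm_num),
    ENNReal.ofReal_mul (by norm_num), ENNReal.ofReal_mul (by norm_num), ENNReal.ofReal_ofNat,
    ENNReal.ofReal_ofNat]
  calc _ ≤ 24 * ENNReal.ofReal (M.resid v hist s) + 12 * ENNReal.ofReal (Ms.resid v hist s)
        + 24 * h + 12 * h := by
        gcongr
        exact h1
    _ = _ := by ring

theorem tot_mul_l1_tr_sq_le (v : ℕ) (hist : List (S × A)) (s : S) (a : A) :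
    ENNReal.ofReal (Ms.tot hist s)
        * l1 (M.tr (M.dec v hist s) s a) (Ms.tr (Ms.dec v hist s) s a) ^ 2
      ≤ 24 * ENNReal.ofReal (M.resid v hist s) + 12 * ENNReal.ofReal (Ms.resid v hist s)
        + 36 * ∑' s', M.rootDiff Ms (hist ++ [(s, a)]) s' := by
  refine M.tot_mul_l1_dec_sq_le Ms (fun i => M.isProb_tr i s a) (fun i => Ms.isProb_tr i s a)
    v hist s (M.rootDiff_le_tsum Ms hist s a) (le_of_eq ?_)
  simp only [hell, rootDiff, tot_append]

/-- The squared distance of the laws of the future of the decoded latent indices. -/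
def decSq (πexp : Policy S A) (v n : ℕ) (hist : List (S × A)) (s : S) : ℝ≥0∞ :=
  l1 (M.fut πexp n s (M.dec v hist s)) (Ms.fut πexp n s (Ms.dec v hist s)) ^ 2

theorem decSq_mul_tot_le (v n : ℕ) (hist : List (S × A)) (s : S) :
    M.decSq Ms πexp v n hist s * ENNReal.ofReal (Ms.tot hist s)
      ≤ 24 * ENNReal.ofReal (M.resid v hist s) + 12 * ENNReal.ofReal (Ms.resid v hist s)
        + 36 * M.futHell Ms πexp n hist s := by
  rw [mul_comm]
  exact M.tot_mul_l1_dec_sq_le Ms (M.isProb_fut πexp n s) (Ms.isProb_fut πexp n s) v hist s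
    (M.rootDiff_le_futHell Ms πexp n hist s) le_rfl

theorem one_le_decSq {v n : ℕ} (hsep : M.FutSeparated πexp n) {hist : List (S × A)} {s : S}
    (hne : M.dec v hist s ≠ M.pairIdx Ms πexp n (Ms.dec v hist s) (stAt v hist s)) :
    1 ≤ 4 * M.decSq Ms πexp v n (hist.take v) (stAt v hist s) := by
  have := M.one_le_of_ne_pairIdx Ms hsep (M.dec_mem v hist s) hne
  rwa [decSq, dec_prefix, dec_prefix]

theorem sum_bel_mul_le (f : Fin L → ℝ≥0∞) {c : ℝ≥0∞} (hf : ∀ m, f m ≤ c) (v : ℕ)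
    (hist : List (S × A)) (s : S) :
    ∑ m, ENNReal.ofReal (M.bel hist s m) * f m ≤ c * ENNReal.ofReal (M.resid v hist s)
      + ENNReal.ofReal (M.tot hist s) * f (M.dec v hist s) := by
  classical
  rw [ofReal_resid, Finset.mul_sum, ← Finset.add_sum_erase _ _ (Finset.mem_univ (M.dec v hist s)),
    add_comm]
  refine add_le_add ?_ ?_
  · refine (Finset.sum_le_sum fun l hl => ?_).trans
      (Finset.sum_le_sum_of_subset (Finset.erase_subset (M.dec v hist s) Finset.univ))
    rw [if_neg (Finset.ne_of_mem_erase hl), one_mul, mul_comm]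
    gcongr
    exact hf l
  · gcongr
    exact M.bel_le_tot _ _ _

/-- Mass off the decoded index costs at most `4`. If the decoded indices are paired, the next state
reveals the error. If not, their futures differ by a constant at the decoding time, and the trivial
bound `4` is charged to `decSq` there. -/
theorem sum_bel_trErr_sq_le {v n : ℕ} (hsep : M.FutSeparated πexp n) (hist : List (S × A)) (s : S) :
    ∑ m, ENNReal.ofReal (Ms.bel hist s m) * M.trErr Ms πexp n m (stAt v hist s) s ^ 2
      ≤ 24 * ENNReal.ofReal (M.resid v hist s) + 16 * ENNReal.ofReal (Ms.resid v hist s)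
        + 36 * ∑ a, ∑' s', M.rootDiff Ms (hist ++ [(s, a)]) s'
        + 16 * (M.decSq Ms πexp v n (hist.take v) (stAt v hist s)
          * ENNReal.ofReal (Ms.tot hist s)) := by
  have h4 : ∀ m, M.trErr Ms πexp n m (stAt v hist s) s ^ 2 ≤ 4 := fun m =>
    (pow_le_pow_left₀ zero_le (M.trErr_le_two Ms πexp n m _ s) 2).trans (by norm_num)
  have h := Ms.sum_bel_mul_le (fun m => M.trErr Ms πexp n m (stAt v hist s) s ^ 2) h4 v hist s
  refine h.trans ?_
  by_cases hne : M.dec v hist s = M.pairIdx Ms πexp n (Ms.dec v hist s) (stAt v hist s)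
  · obtain ⟨a, ha⟩ := exists_eq_ciSup_of_finite (f := fun a =>
      l1 (M.tr (M.pairIdx Ms πexp n (Ms.dec v hist s) (stAt v hist s)) s a)
        (Ms.tr (Ms.dec v hist s) s a))
    have h1 := M.tot_mul_l1_tr_sq_le Ms v hist s a
    rw [hne] at h1
    rw [trErr, ← ha]
    calc _ ≤ 4 * ENNReal.ofReal (Ms.resid v hist s)
          + (24 * ENNReal.ofReal (M.resid v hist s) + 12 * ENNReal.ofReal (Ms.resid v hist s)
          + 36 * ∑ a, ∑' s', M.rootDiff Ms (hist ++ [(s, a)]) s') := by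
          refine add_le_add le_rfl (h1.trans ?_)
          gcongr
          exact Finset.single_le_sum (f := fun a => ∑' s', M.rootDiff Ms (hist ++ [(s, a)]) s')
            (fun _ _ => zero_le) (Finset.mem_univ a)
      _ = 24 * ENNReal.ofReal (M.resid v hist s) + 16 * ENNReal.ofReal (Ms.resid v hist s)
        + 36 * ∑ a, ∑' s', M.rootDiff Ms (hist ++ [(s, a)]) s' := by ring
      _ ≤ _ := le_self_add
  · have h1 := M.one_le_decSq Ms hsep hne
    calc _ ≤ 4 * ENNReal.ofReal (Ms.resid v hist s) + ENNReal.ofReal (Ms.tot hist s)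
          * (4 * (4 * M.decSq Ms πexp v n (hist.take v) (stAt v hist s))) := by
          gcongr
          exact (h4 _).trans (le_mul_of_one_le_right zero_le h1)
      _ = 4 * ENNReal.ofReal (Ms.resid v hist s) + 16 * (M.decSq Ms πexp v n (hist.take v)
          (stAt v hist s) * ENNReal.ofReal (Ms.tot hist s)) := by ring
      _ ≤ _ := by
          gcongr
          refine le_trans ?_ (le_self_add.trans (add_le_add_left le_add_self _))
          gcongr
          norm_num

theorem hsum_decSq_le {v n : ℕ} {π : Policy S A} {e : ℝ≥0∞}
    (h1 : hsum π v (fun hist s => ENNReal.ofReal (M.pairSum hist s)) ≤ e)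
    (h2 : hsum π v (fun hist s => ENNReal.ofReal (Ms.pairSum hist s)) ≤ e) :
    hsum π v (fun hist s => M.decSq Ms πexp v n hist s * ENNReal.ofReal (Ms.tot hist s))
      ≤ 36 * e + 36 * hsum π v (M.futHell Ms πexp n) := by
  refine (hsum_mono fun hist s _ => M.decSq_mul_tot_le Ms v n hist s).trans ?_
  rw [hsum_add, hsum_add, hsum_const_mul, hsum_const_mul, hsum_const_mul]
  have h3 := (M.hsum_resid_le (π := π) (v := v) 0).trans h1
  have h4 := (Ms.hsum_resid_le (π := π) (v := v) 0).trans h2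
  rw [add_zero] at h3 h4
  calc _ ≤ 24 * e + 12 * e + 36 * hsum π v (M.futHell Ms πexp n) := by gcongr
    _ = _ := by ring

/-- Mispairing is charged to the switch at the decoding time, the transition to a uniform action
followed by `πexp`. Here `576 = 16 * 36` and `616 = 24 + 16 + 576`. -/
theorem hsum_trErr_sq_le {v n i n' : ℕ} (hsep : M.FutSeparated πexp n) (hn : i + 1 + n' = n)
    {π : Policy S A} {e : ℝ≥0∞}
    (h1 : hsum π v (fun hist s => ENNReal.ofReal (M.pairSum hist s)) ≤ e)
    (h2 : hsum π v (fun hist s => ENNReal.ofReal (Ms.pairSum hist s)) ≤ e) :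
    hsum π (v + i) (fun hist s => ∑ m, ENNReal.ofReal (Ms.bel hist s m)
        * M.trErr Ms πexp n m (stAt v hist s) s ^ 2)
      ≤ 616 * e + 576 * M.trajHell Ms (v + n) (Policy.switch (v + 1) π πexp)
        + 36 * (Fintype.card A * M.trajHell Ms (v + n) (exploreAt πexp (v + i + 1) π)) := by
  refine (hsum_mono fun hist s _ => M.sum_bel_trErr_sq_le Ms (v := v) hsep hist s).trans ?_
  rw [hsum_add, hsum_add, hsum_add]
  simp only [hsum_const_mul]
  rw [Ms.hsum_prefix_tot π v i (M.decSq Ms πexp v n)]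
  have h3 := (M.hsum_resid_le (π := π) (v := v) i).trans h1
  have h4 := (Ms.hsum_resid_le (π := π) (v := v) i).trans h2
  have h5 := M.hsum_decSq_le Ms (πexp := πexp) (n := n) h1 h2
  have h6 : hsum π (v + i) (fun hist s => ∑ a, ∑' s', M.rootDiff Ms (hist ++ [(s, a)]) s')
      ≤ Fintype.card A * M.trajHell Ms (v + n) (exploreAt πexp (v + i + 1) π) := by
    rw [show v + n = v + i + 1 + n' by omega, ← hsum_sum_futHell]
    refine hsum_mono fun hist s _ => ?_
    gcongr with a _ s'
    exact M.rootDiff_le_futHell Ms πexp n' _ _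
  rw [hsum_futHell_switch] at h5
  calc _ ≤ 24 * e + 16 * e
        + 36 * (Fintype.card A * M.trajHell Ms (v + n) (exploreAt πexp (v + i + 1) π))
        + 16 * (36 * e + 36 * M.trajHell Ms (v + n) (Policy.switch (v + 1) π πexp)) := by gcongr
    _ = _ := by ring

open Classical in
/-- The distance of the likelihoods of the decoded latent indices, where these are paired. -/
def decDiff (πexp : Policy S A) (v n : ℕ) (hist : List (S × A)) (s : S) : ℝ≥0∞ :=
  if M.dec v hist s = M.pairIdx Ms πexp n (Ms.dec v hist s) (stAt v hist s) then
    ENNReal.ofReal |M.bel hist s (M.dec v hist s) - Ms.bel hist s (Ms.dec v hist s)| else 0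

/-- From position `v` on the decoded indices and their pairing are frozen; only their weights move,
each with its own kernel. -/
theorem tsum_decDiff_le {v n : ℕ} {hist : List (S × A)} (hv : v ≤ hist.length) (s : S) (a : A) :
    ∑' s', M.decDiff Ms πexp v n (hist ++ [(s, a)]) s' ≤ M.decDiff Ms πexp v n hist s
      + ∑ m, ENNReal.ofReal (Ms.bel hist s m) * M.trErr Ms πexp n m (stAt v hist s) s := by
  simp only [decDiff, dec_append _ hv, stAt_append hv]
  split_ifs with h
  swap
  · simp
  set l := M.dec v hist s
  set m := Ms.dec v hist s
  have ht := (M.isProb_tr l s a).1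
  have hb := Ms.bel_nonneg hist s m
  calc _ ≤ ∑' s', (ENNReal.ofReal |M.bel hist s l - Ms.bel hist s m| * ENNReal.ofReal (M.tr l s a s')
        + ENNReal.ofReal (Ms.bel hist s m) * ENNReal.ofReal |M.tr l s a s' - Ms.tr m s a s'|) := by
        gcongr with s'
        rw [← ENNReal.ofReal_mul (abs_nonneg _), ← ENNReal.ofReal_mul hb,
          ← ENNReal.ofReal_add (mul_nonneg (abs_nonneg _) (ht s')) (by positivity)]
        refine ENNReal.ofReal_le_ofReal ?_
        have e1 : |M.bel hist s l - Ms.bel hist s m| * M.tr l s a s'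
            = |(M.bel hist s l - Ms.bel hist s m) * M.tr l s a s'| := by
          rw [abs_mul, abs_of_nonneg (ht s')]
        have e2 : Ms.bel hist s m * |M.tr l s a s' - Ms.tr m s a s'|
            = |Ms.bel hist s m * (M.tr l s a s' - Ms.tr m s a s')| := by
          rw [abs_mul, abs_of_nonneg hb]
        rw [e1, e2, bel_append, bel_append]
        refine le_trans (le_of_eq ?_) (abs_add_le _ _)
        congr 1
        ring
    _ = ENNReal.ofReal |M.bel hist s l - Ms.bel hist s m|
        + ENNReal.ofReal (Ms.bel hist s m) * l1 (M.tr l s a) (Ms.tr m s a) := by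
        rw [ENNReal.tsum_add, ENNReal.tsum_mul_left, ENNReal.tsum_mul_left,
          (M.isProb_tr l s a).tsum_ofReal, mul_one]
        rfl
    _ ≤ _ := by
        gcongr
        refine le_trans ?_ (Finset.single_le_sum (f := fun m => ENNReal.ofReal (Ms.bel hist s m)
          * M.trErr Ms πexp n m (stAt v hist s) s) (fun _ _ => zero_le) (Finset.mem_univ m))
        gcongr
        rw [h]
        exact le_iSup (fun a => l1 (M.tr (M.pairIdx Ms πexp n m (stAt v hist s)) s a)
          (Ms.tr m s a)) a

theorem hsum_decDiff_le (v n i : ℕ) (π : Policy S A) :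
    hsum π (v + i) (M.decDiff Ms πexp v n) ≤ hsum π v (M.decDiff Ms πexp v n)
      + ∑ j ∈ Finset.range i, hsum π (v + j) (fun hist s => ∑ m, ENNReal.ofReal (Ms.bel hist s m)
        * M.trErr Ms πexp n m (stAt v hist s) s) := by
  induction i with
  | zero => simp
  | succ i ih =>
    rw [Finset.sum_range_succ, ← add_assoc, ← add_assoc, hsum_succ]
    refine le_trans ?_ (add_le_add_left ih _)
    rw [← hsum_add]
    exact hsum_mono fun hist s hl => step_le_of_le π fun a =>
      M.tsum_decDiff_le Ms (by omega) s a

theorem abs_bel_dec_sub_le (v : ℕ) (hist : List (S × A)) (s : S) :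
    ENNReal.ofReal |M.bel hist s (M.dec v hist s) - Ms.bel hist s (Ms.dec v hist s)|
      ≤ M.absDiff Ms hist s + ENNReal.ofReal (M.resid v hist s)
        + ENNReal.ofReal (Ms.resid v hist s) := by
  have h1 := M.resid_nonneg v hist s
  have h2 := Ms.resid_nonneg v hist s
  rw [absDiff, ← ENNReal.ofReal_add (abs_nonneg _) h1, ← ENNReal.ofReal_add (by positivity) h2]
  refine ENNReal.ofReal_le_ofReal ?_
  have h3 := le_abs_self (M.tot hist s - Ms.tot hist s)
  have h4 := neg_abs_le (M.tot hist s - Ms.tot hist s)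
  rw [resid] at h1 h2 ⊢
  rw [resid]
  exact abs_le.2 ⟨by linarith, by linarith⟩

theorem absDiff_le (v n : ℕ) (hist : List (S × A)) (s : S) :
    M.absDiff Ms hist s ≤ ENNReal.ofReal (M.resid v hist s) + ENNReal.ofReal (Ms.resid v hist s)
      + M.decDiff Ms πexp v n hist s
      + ((open Classical in if M.dec v (hist.take v) (stAt v hist s) = M.pairIdx Ms πexp n
        (Ms.dec v (hist.take v) (stAt v hist s)) (stAt v hist s) then 0 else 1)
          * ENNReal.ofReal (M.tot hist s)
        + (open Classical in if M.dec v (hist.take v) (stAt v hist s) = M.pairIdx Ms πexp n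
        (Ms.dec v (hist.take v) (stAt v hist s)) (stAt v hist s) then 0 else 1)
          * ENNReal.ofReal (Ms.tot hist s)) := by
  classical
  simp only [dec_prefix, decDiff]
  have h1 := M.resid_nonneg v hist s
  have h2 := Ms.resid_nonneg v hist s
  split_ifs with h
  · rw [zero_mul, zero_mul, add_zero, add_zero, absDiff, ← ENNReal.ofReal_add h1 h2,
      ← ENNReal.ofReal_add (by positivity) (abs_nonneg _)]
    refine ENNReal.ofReal_le_ofReal ?_
    have h3 := le_abs_self (M.bel hist s (M.dec v hist s) - Ms.bel hist s (Ms.dec v hist s))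
    have h4 := neg_abs_le (M.bel hist s (M.dec v hist s) - Ms.bel hist s (Ms.dec v hist s))
    rw [resid] at h1 h2 ⊢
    rw [resid]
    exact abs_le.2 ⟨by linarith, by linarith⟩
  · rw [one_mul, one_mul]
    refine le_trans ?_ le_add_self
    have h3 := M.tot_nonneg hist s
    have h4 := Ms.tot_nonneg hist s
    rw [absDiff, ← ENNReal.ofReal_add h3 h4]
    exact ENNReal.ofReal_le_ofReal (abs_le.2 ⟨by linarith, by linarith⟩)

/-- The difference splits into residual masses, the difference of paired decoded weights, and the
mass of mispaired histories. Mispairing is decided at position `v`, so the martingale property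
returns it there, where `decSq` bounds it. The two mispaired masses give `288` of the factors `292`
and `290`. -/
theorem hsum_absDiff_le {v n : ℕ} (hsep : M.FutSeparated πexp n) {π : Policy S A} {e : ℝ≥0∞}
    (h1 : hsum π v (fun hist s => ENNReal.ofReal (M.pairSum hist s)) ≤ e)
    (h2 : hsum π v (fun hist s => ENNReal.ofReal (Ms.pairSum hist s)) ≤ e) :
    hsum π (v + n) (M.absDiff Ms) ≤ 292 * e + 290 * hsum π v (M.futL1 Ms πexp n)
      + ∑ j ∈ Finset.range n, hsum π (v + j) (fun hist s => ∑ m, ENNReal.ofReal (Ms.bel hist s m)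
        * M.trErr Ms πexp n m (stAt v hist s) s) := by
  classical
  set φ : List (S × A) → S → ℝ≥0∞ := fun hist s => if M.dec v hist s = M.pairIdx Ms πexp n
        (Ms.dec v hist s) s then 0 else 1 with hφ
  set Δ := hsum π v (M.futL1 Ms πexp n) with hΔ
  have r1 := (M.hsum_resid_le (π := π) (v := v) n).trans h1
  have r2 := (Ms.hsum_resid_le (π := π) (v := v) n).trans h2
  have q1 := (M.hsum_resid_le (π := π) (v := v) 0).trans h1
  have q2 := (Ms.hsum_resid_le (π := π) (v := v) 0).trans h2
  rw [add_zero] at q1 q2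
  have hd : hsum π v (M.decDiff Ms πexp v n) ≤ Δ + e + e := by
    calc _ ≤ hsum π v (fun hist s => M.futL1 Ms πexp n hist s + ENNReal.ofReal (M.resid v hist s)
          + ENNReal.ofReal (Ms.resid v hist s)) := by
          refine hsum_mono fun hist s _ => ?_
          refine le_trans ?_ (add_le_add_left (add_le_add_left
            (M.absDiff_le_futL1 Ms πexp n hist s) _) _)
          refine le_trans ?_ (M.abs_bel_dec_sub_le Ms v hist s)
          unfold decDiff
          split_ifs
          · exact le_rfl
          · exact zero_le
      _ ≤ _ := by
          rw [hsum_add, hsum_add]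
          gcongr
  have hφ4 : ∀ hist s, hist.length = v → φ hist s ≤ 4 * M.decSq Ms πexp v n hist s := by
    intro hist s hl
    simp only [hφ]
    split_ifs with h
    · exact zero_le
    · have := M.one_le_decSq Ms (v := v) (hist := hist) (s := s) hsep (by rwa [stAt_eq hl])
      rwa [stAt_eq hl, List.take_of_length_le hl.le] at this
  have hb2 : hsum π v (fun hist s => φ hist s * ENNReal.ofReal (Ms.tot hist s))
      ≤ 4 * (36 * e + 36 * Δ) := by
    calc _ ≤ hsum π v (fun hist s => 4 * (M.decSq Ms πexp v n hist s
          * ENNReal.ofReal (Ms.tot hist s))) := by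
          refine hsum_mono fun hist s hl => ?_
          rw [← mul_assoc]
          gcongr
          exact hφ4 hist s hl
      _ ≤ _ := by
          rw [hsum_const_mul]
          gcongr
          refine (M.hsum_decSq_le Ms h1 h2).trans ?_
          gcongr
          exact hsum_mono fun hist s _ => M.futHell_le_futL1 Ms πexp n hist s
  have hb1 : hsum π v (fun hist s => φ hist s * ENNReal.ofReal (M.tot hist s))
      ≤ Δ + 4 * (36 * e + 36 * Δ) := by
    refine le_trans ?_ (add_le_add_right hb2 Δ)
    rw [← hsum_add]
    refine hsum_mono fun hist s _ => ?_
    have hφ1 : φ hist s ≤ 1 := by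
      simp only [hφ]
      split_ifs
      · exact zero_le
      · exact le_rfl
    calc φ hist s * ENNReal.ofReal (M.tot hist s)
        ≤ φ hist s * (M.absDiff Ms hist s + ENNReal.ofReal (Ms.tot hist s)) := by
          gcongr
          rw [absDiff, ← ENNReal.ofReal_add (abs_nonneg _) (Ms.tot_nonneg _ _)]
          exact ENNReal.ofReal_le_ofReal (by linarith [le_abs_self (M.tot hist s - Ms.tot hist s)])
      _ ≤ _ := by
          rw [mul_add]
          gcongr
          exact (mul_le_of_le_one_left zero_le hφ1).trans (M.absDiff_le_futL1 Ms πexp n hist s)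
  calc _ ≤ _ := hsum_mono fun hist s _ => M.absDiff_le Ms v n hist s
    _ = hsum π (v + n) (fun hist s => ENNReal.ofReal (M.resid v hist s))
        + hsum π (v + n) (fun hist s => ENNReal.ofReal (Ms.resid v hist s))
        + hsum π (v + n) (M.decDiff Ms πexp v n)
        + (hsum π v (fun hist s => φ hist s * ENNReal.ofReal (M.tot hist s))
          + hsum π v (fun hist s => φ hist s * ENNReal.ofReal (Ms.tot hist s))) := by
        rw [hsum_add, hsum_add, hsum_add, hsum_add, ← M.hsum_prefix_tot π v n φ,
          ← Ms.hsum_prefix_tot π v n φ]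
    _ ≤ e + e + (Δ + e + e + ∑ j ∈ Finset.range n, hsum π (v + j) (fun hist s =>
          ∑ m, ENNReal.ofReal (Ms.bel hist s m) * M.trErr Ms πexp n m (stAt v hist s) s))
        + (Δ + 4 * (36 * e + 36 * Δ) + 4 * (36 * e + 36 * Δ)) := by
        gcongr
        exact (M.hsum_decDiff_le Ms v n n π).trans (add_le_add_left hd _)
    _ = _ := by ring

end LMDP

end Pairing

/-! ### Occupancy measures from low rank, and the errors before decoding -/

section Occupancy

variable {S A : Type*} [Fintype A] [Nonempty A] {L : ℕ}

set_option linter.unusedSectionVars false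

/-- With the regularization `B / n` the dimension enters only through `D * n`, and all applications
share one logarithm. -/
theorem tsum_error_le_uniform {n L d : ℕ} {X Y : Type*} (hn : 0 < n) (hd : 0 < d) {B D η : ℝ}
    (hB : 0 < B) (hD0 : 0 ≤ D) (hDn : D * n ≤ 2 * d ^ 2 * L) (hη : 0 < η)
    (K : ℕ) (ctx : Y → X) (P : ℕ → Y → ℝ≥0∞)
    (hP1 : ∀ k, ∑' y, P k y ≤ 1) (w : X → ℝ≥0∞)
    (hw : ∀ k x, ∑' y, (open Classical in if ctx y = x then P k y else 0) ≤ w x)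
    (hD : ∑' x, w x ≤ ENNReal.ofReal D)
    (u : Y → Fin n → ℝ) (hu : ∀ y, u y ⬝ᵥ u y ≤ 4 * d) (g : ℕ → Y → Fin n → ℝ)
    (hg : ∀ k y, g k y ⬝ᵥ g k y ≤ n * 4 ^ 2) (f : ℕ → Y → ℝ) (hf0 : ∀ k y, 0 ≤ f k y)
    (hf : ∀ k y, f k y ≤ g k y ⬝ᵥ u y)
    (hfg : ∀ k y y', ctx y = ctx y' → |g k y ⬝ᵥ u y'| ≤ f k y')
    (hfc : ∀ k y, f k y ≤ 4) :
    ∑ k ∈ Finset.range K, ∑' y, P k y * ENNReal.ofReal (f k y) ≤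
      ENNReal.ofReal (η * (4 * d ^ 2 * L * Real.log (1 + K * (4 * d) / B)))
        + ENNReal.ofReal η⁻¹ * ∑ k ∈ Finset.range K, (ENNReal.ofReal (16 + 16 * B)
          + ∑ t ∈ Finset.range k, ∑' y, P t y * ENNReal.ofReal (f k y ^ 2)) := by
  have hn' : (0 : ℝ) < n := by exact_mod_cast hn
  have h := tsum_error_le hn (lam := B / n) (b := 4 * d) (c := 4) (G := n * 4 ^ 2) (D := D) (η := η)
    (by positivity) (by positivity) (by positivity) hD0 hη K ctx P hP1 w hw hD u hu g hg f hf0 hf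
    hfg hfc
  have e1 : (n : ℝ) * (B / n) = B := by field_simp
  have e2 : (4 : ℝ) ^ 2 + B / n * (n * 4 ^ 2) = 16 + 16 * B := by field_simp; norm_num
  rw [e1, e2] at h
  refine h.trans (add_le_add_left (ENNReal.ofReal_le_ofReal ?_) _)
  have hlog : 0 ≤ Real.log (1 + K * (4 * d) / B) := Real.log_nonneg (by
    have : 0 ≤ K * (4 * d) / B := by positivity
    linarith)
  calc _ = η * (2 * (D * n) * Real.log (1 + K * (4 * d) / B)) := by ring
    _ ≤ η * (2 * (2 * d ^ 2 * L) * Real.log (1 + K * (4 * d) / B)) := by gcongr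
    _ = _ := by ring

theorem sq_tsum_le {X : Type*} {p : X → ℝ} (hp : IsProb p) (f : X → ℝ≥0∞) :
    (∑' x, ENNReal.ofReal (p x) * f x) ^ 2 ≤ ∑' x, ENNReal.ofReal (p x) * f x ^ 2 := by
  have h1 : ∀ x, ENNReal.ofReal √(p x) ^ 2 = ENNReal.ofReal (p x) := fun x => by
    rw [← ENNReal.ofReal_pow (Real.sqrt_nonneg _), Real.sq_sqrt (hp.1 x)]
  have h := ennreal_tsum_mul_sq_le (fun x => ENNReal.ofReal √(p x))
    (fun x => ENNReal.ofReal √(p x) * f x)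
  simp only [← mul_assoc, ← sq, h1, mul_pow, hp.tsum_ofReal, one_mul] at h
  exact h

namespace LMDP

variable (M : LMDP S A L)

theorem hsum_bel (π : Policy S A) (n : ℕ) (m : Fin L) :
    hsum π n (fun hist s => ENNReal.ofReal (M.bel hist s m)) = M.ρ m := by
  classical
  have h := M.hsum_prefix π 0 n fun l _ _ => if l = m then 1 else 0
  simp only [ite_mul, one_mul, zero_mul, Finset.sum_ite_eq', Finset.mem_univ, if_true,
    zero_add] at h
  rw [h, hsum_zero]
  simp only [ofReal_bel, belE, wlik, ENNReal.tsum_mul_left, PMF.tsum_coe, mul_one]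

theorem pos_latent (M : LMDP S A L) : 0 < L := by
  obtain ⟨l, -⟩ := M.ρ.support_nonempty
  exact l.pos

theorem exists_tr_spanner {d : ℕ} (hd : M.rank ≤ d) (m : Fin L) :
    ∃ (c : Fin d → S × A) (α : S × A → Fin d → ℝ), (∀ z i, |α z i| ≤ 2) ∧
      ∀ z s', M.tr m z.1 z.2 s' = ∑ i, α z i * M.tr m (c i).1 (c i).2 s' := by
  obtain ⟨s, -⟩ := (M.ν m).support_nonempty
  have : Nonempty (S × A) := ⟨s, Classical.arbitrary A⟩
  obtain ⟨c, α, h1, h2⟩ := exists_spanner (A := Matrix.of fun (s' : S) (x : S × A) =>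
      (M.T m x.1 x.2 s').toReal) ((le_iSup (fun m => (Matrix.of fun (s' : S) (x : S × A) =>
      (M.T m x.1 x.2 s').toReal).eRank) m).trans hd) (fun _ _ => ENNReal.toReal_nonneg)
      (fun s' z => ENNReal.toReal_le_of_le_ofReal zero_le_one
        (by rw [ENNReal.ofReal_one]; exact PMF.coe_le_one _ _))
  exact ⟨c, α, h1, fun z s' => h2 s' z⟩

theorem exists_occupancy {d : ℕ} (hd0 : 0 < d) (hd : M.rank ≤ d) (j : ℕ) :
    ∃ w : Fin L → S → ℝ≥0∞, (∑ m, ∑' x, w m x ≤ ENNReal.ofReal (2 * d)) ∧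
      ∀ (π : Policy S A) m x, hsum π j (fun hist s =>
        (open Classical in if s = x then 1 else 0) * ENNReal.ofReal (M.bel hist s m)) ≤ w m x := by
  classical
  have hρ : ∑ m, M.ρ m = 1 := by
    have := M.ρ.tsum_coe
    rwa [tsum_fintype] at this
  cases j with
  | zero =>
    -- At the first step the initial law itself dominates.
    refine ⟨fun m x => M.ρ m * M.ν m x, ?_, fun π m x => ?_⟩
    · simp only [ENNReal.tsum_mul_left, PMF.tsum_coe, mul_one, hρ]
      rw [← ENNReal.ofReal_one]
      have : (1 : ℝ) ≤ d := by exact_mod_cast hd0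
      exact ENNReal.ofReal_le_ofReal (by linarith)
    · rw [hsum_zero, tsum_eq_single x fun s hs => by rw [if_neg hs, zero_mul], if_pos rfl, one_mul,
        ofReal_bel]
      exact le_rfl
  | succ j =>
    choose c α hα hsp using M.exists_tr_spanner hd
    -- Every transition law is a combination of `d` of them with coefficients at most `2` in
    -- absolute value; twice their sum dominates every average, whatever the policy.
    refine ⟨fun m x => M.ρ m * ∑ i, 2 * ENNReal.ofReal (M.tr m (c m i).1 (c m i).2 x), ?_,
      fun π m x => ?_⟩
    · simp only [ENNReal.tsum_mul_left]
      have : ∀ m, ∑' x, ∑ i, 2 * ENNReal.ofReal (M.tr m (c m i).1 (c m i).2 x)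
          = ENNReal.ofReal (2 * d) := by
        intro m
        rw [Summable.tsum_finsetSum fun _ _ => ENNReal.summable]
        simp only [ENNReal.tsum_mul_left, (M.isProb_tr _ _ _).tsum_ofReal, mul_one,
          Finset.sum_const, Finset.card_univ, Fintype.card_fin, nsmul_eq_mul]
        rw [ENNReal.ofReal_mul (by norm_num), ENNReal.ofReal_natCast, ENNReal.ofReal_ofNat,
          mul_comm]
      simp only [this, ← Finset.sum_mul, hρ, one_mul]
      exact le_rfl
    · change _ ≤ M.ρ m * ∑ i, 2 * ENNReal.ofReal (M.tr m (c m i).1 (c m i).2 x)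
      rw [hsum_succ, ← M.hsum_bel π j m, mul_comm, ← hsum_const_mul]
      refine hsum_mono fun hist s _ => step_le_of_le π fun a => ?_
      rw [tsum_eq_single x fun s hs => by rw [if_neg hs, zero_mul], if_pos rfl, one_mul, bel_append,
        ENNReal.ofReal_mul (M.bel_nonneg _ _ _), mul_comm]
      gcongr
      have h2 : ∀ i, 2 * ENNReal.ofReal (M.tr m (c m i).1 (c m i).2 x)
          = ENNReal.ofReal (2 * M.tr m (c m i).1 (c m i).2 x) := fun i => by
        rw [ENNReal.ofReal_mul (by norm_num), ENNReal.ofReal_ofNat]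
      simp only [h2]
      have h0 : ∀ i, 0 ≤ M.tr m (c m i).1 (c m i).2 x := fun i => (M.isProb_tr _ _ _).1 x
      rw [← ENNReal.ofReal_sum_of_nonneg fun i _ => mul_nonneg zero_le_two (h0 i), hsp m (s, a) x]
      refine ENNReal.ofReal_le_ofReal (Finset.sum_le_sum fun i _ => ?_)
      exact mul_le_mul_of_nonneg_right ((le_abs_self _).trans (hα m (s, a) i)) (h0 i)

/-- The context is the current state, of occupancy mass `2 * d`; the feature is the posterior in
dimension `L`, tested by the norming functional of each round. -/
theorem sum_hsum_supAbs_le {d : ℕ} (hd0 : 0 < d) (hd : M.rank ≤ d) {B η : ℝ} (hB : 0 < B)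
    (hη : 0 < η) (K j : ℕ) (π : ℕ → Policy S A) {I Z : Type*}
    (κ : ℕ → S → I → Z → Fin L → ℝ)
    (hκ : ∀ k x u, supAbs (κ k x) u ≤ ENNReal.ofReal (4 * ∑ i, |u i|)) :
    ∑ k ∈ Finset.range K, hsum (π k) j (fun hist s => ENNReal.ofReal (M.tot hist s)
        * supAbs (κ k s) (M.posterior hist s)) ≤
      ENNReal.ofReal (η * (4 * d ^ 2 * L * Real.log (1 + K * (4 * d) / B)))
        + ENNReal.ofReal η⁻¹ * ∑ k ∈ Finset.range K, (ENNReal.ofReal (16 + 16 * B)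
          + ∑ t ∈ Finset.range k, hsum (π t) j (fun hist s => ENNReal.ofReal (M.tot hist s)
            * supAbs (κ k s) (M.posterior hist s) ^ 2)) := by
  classical
  obtain ⟨w, hw1, hw2⟩ := M.exists_occupancy hd0 hd j
  have hex := fun k x u => exists_dual (κ := κ k x) (by norm_num : (0 : ℝ) ≤ 4) (hκ k x) u
  choose g hg1 hg2 hg3 using hex
  have hfin : ∀ k x u, supAbs (κ k x) u ≠ ∞ := fun k x u =>
    ((hκ k x u).trans_lt ENNReal.ofReal_lt_top).ne
  have hL := M.pos_latent
  have hd1 : (1 : ℝ) ≤ d := by exact_mod_cast hd0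
  have hdL : 2 * (d : ℝ) * L ≤ 2 * d ^ 2 * L := by
    gcongr
    exact le_self_pow₀ hd1 (by norm_num)
  have h := tsum_error_le_uniform (n := L) (L := L) (d := d) (D := 2 * d) (η := η) (B := B) hL hd0 hB
    (by positivity) hdL hη K
    (fun y : List (S × A) × S => y.2)
    (fun k y => histWt (π k) j y * ENNReal.ofReal (M.tot y.1 y.2))
    (fun k => by
      rw [← hsum_eq_tsum (π k) j fun hist s => ENNReal.ofReal (M.tot hist s), hsum_tot])
    (fun x => ∑ m, w m x) (fun k x => by
      have e : ∀ y : List (S × A) × S, (if y.2 = x then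
          histWt (π k) j y * ENNReal.ofReal (M.tot y.1 y.2) else 0)
          = histWt (π k) j y * ((fun hist s => ∑ m, (if s = x then 1 else 0)
            * ENNReal.ofReal (M.bel hist s m)) y.1 y.2) := by
        intro y
        rw [tot, ENNReal.ofReal_sum_of_nonneg fun l _ => M.bel_nonneg _ _ l]
        by_cases hy : y.2 = x <;> simp [hy]
      refine (tsum_congr fun y => ?_).trans_le
        ((hsum_eq_tsum (π k) j fun hist s => ∑ m, (if s = x then 1 else 0)
            * ENNReal.ofReal (M.bel hist s m)).ge.trans ?_)
      · rw [← e y]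
      · rw [hsum_finset_sum]
        refine Finset.sum_le_sum fun m _ => le_trans (le_of_eq ?_) (hw2 (π k) m x)
        congr!)
    (by rw [Summable.tsum_finsetSum fun _ _ => ENNReal.summable]; exact hw1)
    (fun y => M.posterior y.1 y.2)
    (fun y => (M.posterior_dotProduct_le _ _).trans (by linarith))
    (fun k y => g k y.2 (M.posterior y.1 y.2)) (fun k y => hg3 k _ _)
    (fun k y => (supAbs (κ k y.2) (M.posterior y.1 y.2)).toReal)
    (fun k y => ENNReal.toReal_nonneg) (fun k y => (hg1 k _ _).ge)
    (fun k y y' hyy => by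
      have hyy' : y.2 = y'.2 := hyy
      rw [← hyy']
      exact hg2 k y.2 (M.posterior y.1 y.2) (M.posterior y'.1 y.2))
    (fun k y => ENNReal.toReal_le_of_le_ofReal (by norm_num)
      ((hκ k _ _).trans (by rw [sum_abs_posterior, mul_one])))
  simp only [← ENNReal.toReal_pow, ENNReal.ofReal_toReal (hfin _ _ _),
    ENNReal.ofReal_toReal (ENNReal.pow_ne_top (hfin _ _ _)), mul_assoc] at h
  simp only [hsum_eq_tsum]
  simpa only [mul_assoc] using h

end LMDP

end Occupancy

/-! ### Summed errors at the first step and after decoding -/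

section Regret

variable {S A : Type*} [Fintype A] [Nonempty A] {L : ℕ}

set_option linter.unusedSectionVars false

theorem const_dotProduct_const (x y : ℝ) :
    (fun _ : Fin 1 => x) ⬝ᵥ (fun _ => y) = x * y := by
  simp [dotProduct]

namespace LMDP

theorem sq_hsum_futL1_le (M Ms : LMDP S A L) (πexp π : Policy S A) (n : ℕ) :
    hsum π 0 (M.futL1 Ms πexp n) ^ 2 ≤ 4 * hsum π 0 (M.futHell Ms πexp n) := by
  have hp : ∀ M : LMDP S A L, ∀ l, IsProb fun z : S × (Fin n → A × S) =>
      (M.ν l z.1).toReal * M.fut πexp n z.1 l z.2 := fun M l =>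
    isProb_prod (isProb_toReal (M.ν l)) fun s => M.isProb_fut πexp n s l
  have hm : ∀ M : LMDP S A L, IsProb fun z : S × (Fin n → A × S) =>
      ∑ l, (M.ρ l).toReal * ((M.ν l z.1).toReal * M.fut πexp n z.1 l z.2) := fun M =>
    isProb_mix (hp M) (fun _ => ENNReal.toReal_nonneg) M.sum_ρ
  have h := mul_l1_sq_le_hell (hm M) (hm Ms) zero_le_one zero_le_one
  simp only [one_mul, ENNReal.ofReal_one] at h
  rw [l1, hell, ENNReal.tsum_prod', ENNReal.tsum_prod'] at h
  simpa only [hsum_zero, futL1, futHell, l1, hell, bel_nil, mul_assoc] using h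

theorem hsum_futL1_zero_le_two (M Ms : LMDP S A L) (πexp π : Policy S A) (n : ℕ) :
    hsum π 0 (M.futL1 Ms πexp n) ≤ 2 := by
  have h : ∀ hist s, M.futL1 Ms πexp n hist s
      ≤ ENNReal.ofReal (M.tot hist s) + ENNReal.ofReal (Ms.tot hist s) := by
    intro hist s
    have e : ∀ M : LMDP S A L, ENNReal.ofReal (M.tot hist s)
        = ∑' ω, ENNReal.ofReal (∑ l, M.bel hist s l * M.fut πexp n s l ω) := fun M => by
      rw [← ENNReal.ofReal_tsum_of_nonneg (M.mix_fut_nonneg πexp n hist s)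
        (M.hasSum_mix_fut πexp n hist s).summable, (M.hasSum_mix_fut πexp n hist s).tsum_eq]
    rw [e M, e Ms, ← ENNReal.tsum_add, futL1, l1]
    gcongr with ω
    have h1 := M.mix_fut_nonneg πexp n hist s ω
    have h2 := Ms.mix_fut_nonneg πexp n hist s ω
    rw [← ENNReal.ofReal_add h1 h2]
    exact ENNReal.ofReal_le_ofReal (abs_le.2 ⟨by linarith, by linarith⟩)
  refine (hsum_mono fun hist s _ => h hist s).trans ?_
  rw [hsum_add, hsum_tot, hsum_tot]
  norm_num

/-- No action has been taken, so the error of a model is the same in all rounds: one context and a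
constant feature suffice. -/
theorem sum_hsum_futL1_zero_le (Mk : ℕ → LMDP S A L) (Ms : LMDP S A L) (πexp : Policy S A)
    {d : ℕ} (hd0 : 0 < d) {B η : ℝ} (hB : 0 < B) (hη : 0 < η) (K n : ℕ) (π : ℕ → Policy S A) :
    ∑ k ∈ Finset.range K, hsum (π k) 0 ((Mk k).futL1 Ms πexp n) ≤
      ENNReal.ofReal (η * (4 * d ^ 2 * L * Real.log (1 + K * (4 * d) / B)))
        + ENNReal.ofReal η⁻¹ * ∑ k ∈ Finset.range K, (ENNReal.ofReal (16 + 16 * B)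
          + ∑ t ∈ Finset.range k, 4 * (Mk k).trajHell Ms n (exploreAt πexp 0 (π t))) := by
  classical
  set x : ℕ → ℝ≥0∞ := fun k => hsum (π k) 0 ((Mk k).futL1 Ms πexp n) with hx
  have hx2 : ∀ k, x k ≤ 2 := fun k => (Mk k).hsum_futL1_zero_le_two Ms πexp (π k) n
  have hfin : ∀ k, x k ≠ ∞ := fun k => ((hx2 k).trans_lt (by simp)).ne
  have hx2' : ∀ k, (x k).toReal ≤ 2 := fun k =>
    ENNReal.toReal_le_of_le_ofReal (by norm_num) (by simpa using hx2 k)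
  have hL : (1 : ℝ) ≤ L := by exact_mod_cast Ms.pos_latent
  have hd1 : (1 : ℝ) ≤ d := by exact_mod_cast hd0
  have h := tsum_error_le_uniform (n := 1) (L := L) (d := d) (D := 1) (η := η) (B := B)
    one_pos hd0 hB zero_le_one
    (by
      have h1 : (1 : ℝ) ≤ (d : ℝ) ^ 2 := one_le_pow₀ hd1
      have h2 := one_le_mul_of_one_le_of_one_le h1 hL
      push_cast
      linarith) hη K
    (fun _ : Unit => ()) (fun _ _ => 1) (fun _ => by simp) (fun _ => 1) (fun _ _ => by simp)
    (by simp) (fun _ _ => 1) (fun _ => by rw [const_dotProduct_const]; linarith) (fun k _ _ => (x k).toReal)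
    (fun k _ => by
      rw [const_dotProduct_const, Nat.cast_one]
      nlinarith [hx2' k, ENNReal.toReal_nonneg (a := x k)])
    (fun k _ => (x k).toReal) (fun _ _ => ENNReal.toReal_nonneg)
    (fun _ _ => by rw [const_dotProduct_const, mul_one])
    (fun k _ _ _ => by rw [const_dotProduct_const, mul_one, abs_of_nonneg ENNReal.toReal_nonneg]) (fun k _ => by linarith [hx2' k])
  simp only [← ENNReal.toReal_pow, ENNReal.ofReal_toReal (hfin _),
    ENNReal.ofReal_toReal (ENNReal.pow_ne_top (hfin _)), tsum_fintype, Finset.univ_unique,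
    Finset.sum_singleton, one_mul] at h
  refine h.trans ?_
  gcongr with k _ t _
  rw [← hsum_futHell_zero]
  exact (Mk k).sq_hsum_futL1_le Ms πexp (π t) n

/-- At position `v` the current state is the pairing state, so the error is a function of the
context of index and state: dimension one. -/
theorem sum_hsum_pair_le_zero (Ms : LMDP S A L) {d : ℕ} (hd0 : 0 < d) (hd : Ms.rank ≤ d) {B η : ℝ}
    (hB : 0 < B) (hη : 0 < η) (K v : ℕ) (π : ℕ → Policy S A)
    (e : ℕ → Fin L → S → S → ℝ≥0∞) (he : ∀ k m x s, e k m x s ≤ 2) :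
    ∑ k ∈ Finset.range K, hsum (π k) v (fun hist s => ∑ m, ENNReal.ofReal (Ms.bel hist s m)
        * e k m (stAt v hist s) s) ≤
      ENNReal.ofReal (η * (4 * d ^ 2 * L * Real.log (1 + K * (4 * d) / B)))
        + ENNReal.ofReal η⁻¹ * ∑ k ∈ Finset.range K, (ENNReal.ofReal (16 + 16 * B)
          + ∑ t ∈ Finset.range k, hsum (π t) v (fun hist s =>
            ∑ m, ENNReal.ofReal (Ms.bel hist s m) * e k m (stAt v hist s) s ^ 2)) := by
  classical
  obtain ⟨w, hw1, hw2⟩ := Ms.exists_occupancy hd0 hd v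
  have hfin : ∀ k m x s, e k m x s ≠ ∞ := fun k m x s => ((he k m x s).trans_lt (by simp)).ne
  have he' : ∀ k m x s, (e k m x s).toReal ≤ 2 := fun k m x s =>
    ENNReal.toReal_le_of_le_ofReal (by norm_num) (by simpa using he k m x s)
  have hL : (1 : ℝ) ≤ L := by exact_mod_cast Ms.pos_latent
  have hd1 : (1 : ℝ) ≤ d := by exact_mod_cast hd0
  have hsum' : ∀ k (F : Fin L → List (S × A) → S → ℝ≥0∞),
      ∑' y : Fin L × (List (S × A) × S), histWt (π k) v y.2 * F y.1 y.2.1 y.2.2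
        = hsum (π k) v (fun hist s => ∑ m, F m hist s) := by
    intro k F
    rw [hsum_finset_sum, ENNReal.tsum_prod', tsum_fintype]
    simp only [hsum_eq_tsum]
  have h := tsum_error_le_uniform (n := 1) (L := L) (d := d) (D := 2 * d) (η := η) (B := B)
    one_pos hd0 hB (by positivity)
    (by
      push_cast
      nlinarith [mul_le_mul hd1 hL zero_le_one (by linarith)]) hη K
    (fun y : Fin L × (List (S × A) × S) => (y.1, y.2.2))
    (fun k y => histWt (π k) v y.2 * ENNReal.ofReal (Ms.bel y.2.1 y.2.2 y.1))
    (fun k => by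
      rw [hsum' k fun m hist s => ENNReal.ofReal (Ms.bel hist s m), ← Ms.hsum_tot (π k) v]
      refine hsum_mono fun hist s _ => ?_
      rw [tot, ENNReal.ofReal_sum_of_nonneg fun l _ => Ms.bel_nonneg _ _ l])
    (fun z => w z.1 z.2) (fun k z => by
      have e1 : ∀ y : Fin L × (List (S × A) × S), (if (y.1, y.2.2) = z then
          histWt (π k) v y.2 * ENNReal.ofReal (Ms.bel y.2.1 y.2.2 y.1) else 0)
          = histWt (π k) v y.2 * ((fun m hist s => if m = z.1 then (if s = z.2 then 1 else 0)
            * ENNReal.ofReal (Ms.bel hist s m) else 0) y.1 y.2.1 y.2.2) := by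
        intro y
        by_cases h1 : y.1 = z.1 <;> by_cases h2 : y.2.2 = z.2 <;> simp [Prod.ext_iff, h1, h2]
      refine (tsum_congr fun y => ?_).trans_le ((hsum' k fun m hist s => if m = z.1 then
        (if s = z.2 then 1 else 0) * ENNReal.ofReal (Ms.bel hist s m) else 0).le.trans ?_)
      · convert e1 y
      · refine le_trans (le_of_eq ?_) (hw2 (π k) z.1 z.2)
        simp only [Finset.sum_ite_eq', Finset.mem_univ, if_true])
    (by rwa [ENNReal.tsum_prod', tsum_fintype]) (fun _ _ => 1) (fun _ => by rw [const_dotProduct_const]; linarith)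
    (fun k y _ => (e k y.1 y.2.2 y.2.2).toReal)
    (fun k y => by
      rw [const_dotProduct_const, Nat.cast_one]
      nlinarith [he' k y.1 y.2.2 y.2.2, ENNReal.toReal_nonneg (a := e k y.1 y.2.2 y.2.2)])
    (fun k y => (e k y.1 y.2.2 y.2.2).toReal) (fun _ _ => ENNReal.toReal_nonneg)
    (fun _ _ => by rw [const_dotProduct_const, mul_one])
    (fun k y y' hyy => by
      obtain ⟨h1, h2⟩ := Prod.ext_iff.1 hyy
      simp only at h1 h2
      rw [const_dotProduct_const, mul_one, abs_of_nonneg ENNReal.toReal_nonneg, h1, h2]) (fun k y => by linarith [he' k y.1 y.2.2 y.2.2])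
  simp only [← ENNReal.toReal_pow, ENNReal.ofReal_toReal (hfin _ _ _ _),
    ENNReal.ofReal_toReal (ENNReal.pow_ne_top (hfin _ _ _ _)), mul_assoc] at h
  have hs : ∀ t (F : ℝ≥0∞ → ℝ≥0∞) k, hsum (π t) v (fun hist s =>
      ∑ m, ENNReal.ofReal (Ms.bel hist s m) * F (e k m (stAt v hist s) s))
      = ∑' y : Fin L × (List (S × A) × S), histWt (π t) v y.2
        * (ENNReal.ofReal (Ms.bel y.2.1 y.2.2 y.1) * F (e k y.1 y.2.2 y.2.2)) := by
    intro t F k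
    rw [hsum' t fun m hist s => ENNReal.ofReal (Ms.bel hist s m) * F (e k m s s)]
    refine hsum_congr fun hist s hl => ?_
    rw [stAt_eq hl]
  have hs1 := fun t k => hs t id k
  have hs2 := fun t k => hs t (fun x => x ^ 2) k
  simp only [id] at hs1
  simp only [hs1, hs2]
  simpa only [mul_assoc] using h

/-- The context is the index with the pairing state. Conditioning on the preceding state and action
leaves a mean over the next state, which is linear in the `d` spanner coefficients of that pair. -/
theorem sum_hsum_pair_le_succ (Ms : LMDP S A L) {d : ℕ} (hd0 : 0 < d) (hd : Ms.rank ≤ d) {B η : ℝ}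
    (hB : 0 < B) (hη : 0 < η) (K v i : ℕ) (π : ℕ → Policy S A)
    (e : ℕ → Fin L → S → S → ℝ≥0∞) (he : ∀ k m x s, e k m x s ≤ 2) :
    ∑ k ∈ Finset.range K, hsum (π k) (v + i + 1) (fun hist s =>
        ∑ m, ENNReal.ofReal (Ms.bel hist s m) * e k m (stAt v hist s) s) ≤
      ENNReal.ofReal (η * (4 * d ^ 2 * L * Real.log (1 + K * (4 * d) / B)))
        + ENNReal.ofReal η⁻¹ * ∑ k ∈ Finset.range K, (ENNReal.ofReal (16 + 16 * B)
          + ∑ t ∈ Finset.range k, hsum (π t) (v + i + 1) (fun hist s =>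
            ∑ m, ENNReal.ofReal (Ms.bel hist s m) * e k m (stAt v hist s) s ^ 2)) := by
  classical
  obtain ⟨w, hw1, hw2⟩ := Ms.exists_occupancy hd0 hd v
  choose c α hα hsp using Ms.exists_tr_spanner hd
  have hfin : ∀ k m x s, e k m x s ≠ ∞ := fun k m x s => ((he k m x s).trans_lt (by simp)).ne
  have he' : ∀ k m x s, (e k m x s).toReal ≤ 2 := fun k m x s =>
    ENNReal.toReal_le_of_le_ofReal (by norm_num) (by simpa using he k m x s)
  have hL : (1 : ℝ) ≤ L := by exact_mod_cast Ms.pos_latent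
  have hd1 : (1 : ℝ) ≤ d := by exact_mod_cast hd0
  have hsm : ∀ k m x (s : S) (a : A), Summable fun s' => Ms.tr m s a s' * (e k m x s').toReal := by
    intro k m x s a
    refine Summable.of_nonneg_of_le (fun s' => mul_nonneg ((Ms.isProb_tr m s a).1 s')
      ENNReal.toReal_nonneg) (fun s' => mul_le_mul_of_nonneg_left (he' k m x s')
      ((Ms.isProb_tr m s a).1 s')) ((Ms.isProb_tr m s a).2.summable.mul_right 2)
  -- `x` is the pairing state, while `s` and `a` are the state and action just before the error is
  -- made.
  set avg : ℕ → Fin L → S → S → A → ℝ := fun k m x s a =>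
    ∑' s', Ms.tr m s a s' * (e k m x s').toReal with havg
  have avg0 : ∀ k m x s a, 0 ≤ avg k m x s a := fun k m x s a =>
    tsum_nonneg fun s' => mul_nonneg ((Ms.isProb_tr m s a).1 s') ENNReal.toReal_nonneg
  have avg2 : ∀ k m x s a, avg k m x s a ≤ 2 := fun k m x s a => by
    have h := Summable.tsum_le_tsum (fun s' => mul_le_mul_of_nonneg_left (he' k m x s')
      ((Ms.isProb_tr m s a).1 s')) (hsm k m x s a) ((Ms.isProb_tr m s a).2.summable.mul_right 2)
    rw [((Ms.isProb_tr m s a).2.mul_right 2).tsum_eq, one_mul] at h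
    exact h
  have avgE : ∀ k m x s a, ENNReal.ofReal (avg k m x s a)
      = ∑' s', ENNReal.ofReal (Ms.tr m s a s') * e k m x s' := fun k m x s a => by
    rw [havg, ENNReal.ofReal_tsum_of_nonneg (fun s' => mul_nonneg ((Ms.isProb_tr m s a).1 s')
      ENNReal.toReal_nonneg) (hsm k m x s a)]
    refine tsum_congr fun s' => ?_
    rw [ENNReal.ofReal_mul ((Ms.isProb_tr m s a).1 s'), ENNReal.ofReal_toReal (hfin _ _ _ _)]
  have avgdot : ∀ k m x s a, (fun i => avg k m x (c m i).1 (c m i).2) ⬝ᵥ α m (s, a)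
      = avg k m x s a := fun k m x s a => by
    have h1 : ∀ s', Ms.tr m s a s' * (e k m x s').toReal
        = ∑ i, α m (s, a) i * (Ms.tr m (c m i).1 (c m i).2 s' * (e k m x s').toReal) := by
      intro s'
      rw [hsp m (s, a) s', Finset.sum_mul]
      exact Finset.sum_congr rfl fun i _ => by ring
    simp only [havg, dotProduct]
    simp only [h1]
    rw [Summable.tsum_finsetSum fun i _ => (hsm k m x _ _).mul_left _]
    refine Finset.sum_congr rfl fun i _ => ?_
    rw [tsum_mul_left, mul_comm]
  have hsum' : ∀ k (F : Fin L → List (S × A) → S → A → ℝ≥0∞),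
      ∑' y : Fin L × (List (S × A) × S) × A, histWt (π k) (v + i) y.2.1
          * (π k y.2.1.1 y.2.1.2 y.2.2 * F y.1 y.2.1.1 y.2.1.2 y.2.2)
        = hsum (π k) (v + i) (fun hist s => ∑ a, π k hist s a * ∑ m, F m hist s a) := by
    intro k F
    rw [ENNReal.tsum_prod', tsum_fintype]
    simp only [Finset.mul_sum]
    simp only [Finset.sum_comm (s := (Finset.univ : Finset A))]
    rw [hsum_finset_sum]
    refine Finset.sum_congr rfl fun m _ => ?_
    rw [hsum_eq_tsum, ENNReal.tsum_prod']
    refine tsum_congr fun y => ?_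
    simp only [tsum_fintype, Finset.mul_sum]
  have h := tsum_error_le_uniform (n := d) (L := L) (d := d) (D := 2 * d) (η := η) (B := B)
    hd0 hd0 hB (by positivity)
    (by
      have : (0 : ℝ) ≤ 2 * d ^ 2 := by positivity
      nlinarith [mul_le_mul_of_nonneg_left hL this]) hη K
    (fun y : Fin L × (List (S × A) × S) × A => (y.1, stAt v y.2.1.1 y.2.1.2))
    (fun k y => histWt (π k) (v + i) y.2.1 * (π k y.2.1.1 y.2.1.2 y.2.2
      * ENNReal.ofReal (Ms.bel y.2.1.1 y.2.1.2 y.1)))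
    (fun k => by
      rw [hsum' k fun m hist s _ => ENNReal.ofReal (Ms.bel hist s m), ← Ms.hsum_tot (π k) (v + i)]
      refine hsum_mono fun hist s _ => ?_
      rw [← Finset.sum_mul, sum_policy, one_mul, tot,
        ENNReal.ofReal_sum_of_nonneg fun l _ => Ms.bel_nonneg _ _ l])
    (fun z => w z.1 z.2) (fun k z => by
      have e1 : ∀ y : Fin L × (List (S × A) × S) × A, (if (y.1, stAt v y.2.1.1 y.2.1.2) = z then
          histWt (π k) (v + i) y.2.1 * (π k y.2.1.1 y.2.1.2 y.2.2
            * ENNReal.ofReal (Ms.bel y.2.1.1 y.2.1.2 y.1)) else 0)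
          = histWt (π k) (v + i) y.2.1 * (π k y.2.1.1 y.2.1.2 y.2.2
            * ((fun m hist s (_ : A) => (if m = z.1 then (if stAt v hist s = z.2 then 1 else 0)
            else 0) * ENNReal.ofReal (Ms.bel hist s m)) y.1 y.2.1.1 y.2.1.2 y.2.2)) := by
        intro y
        by_cases h1 : y.1 = z.1 <;> by_cases h2 : stAt v y.2.1.1 y.2.1.2 = z.2 <;>
          simp [Prod.ext_iff, h1, h2]
      refine (tsum_congr fun y => ?_).trans_le ((hsum' k fun m hist s _ => (if m = z.1 then
        (if stAt v hist s = z.2 then 1 else 0) else 0)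
          * ENNReal.ofReal (Ms.bel hist s m)).le.trans ?_)
      · convert e1 y
      · refine le_trans (le_of_eq ?_) (hw2 (π k) z.1 z.2)
        have h3 := Ms.hsum_prefix (π k) v i fun m _ s => if m = z.1 then
          (if s = z.2 then 1 else 0) else 0
        simp only [← Finset.sum_mul, sum_policy, one_mul]
        refine h3.trans ?_
        simp only [ite_mul, zero_mul, Finset.sum_ite_eq', Finset.mem_univ, if_true])
    (by rwa [ENNReal.tsum_prod', tsum_fintype]) (fun y => α y.1 (y.2.1.2, y.2.2))
    (fun y => by
      rw [dotProduct]
      refine (Finset.sum_le_card_nsmul _ _ 4 fun i _ => ?_).trans (by simp [mul_comm])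
      have := hα y.1 (y.2.1.2, y.2.2) i
      rw [← abs_mul_abs_self]
      nlinarith [abs_nonneg (α y.1 (y.2.1.2, y.2.2) i)])
    (fun k y i => avg k y.1 (stAt v y.2.1.1 y.2.1.2) (c y.1 i).1 (c y.1 i).2)
    (fun k y => by
      rw [dotProduct]
      refine (Finset.sum_le_card_nsmul _ _ (4 ^ 2) fun i _ => ?_).trans (by simp)
      nlinarith [avg0 k y.1 (stAt v y.2.1.1 y.2.1.2) (c y.1 i).1 (c y.1 i).2,
        avg2 k y.1 (stAt v y.2.1.1 y.2.1.2) (c y.1 i).1 (c y.1 i).2])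
    (fun k y => avg k y.1 (stAt v y.2.1.1 y.2.1.2) y.2.1.2 y.2.2) (fun _ _ => avg0 _ _ _ _ _)
    (fun k y => (avgdot k y.1 _ _ _).ge)
    (fun k y y' hyy => by
      obtain ⟨h1, h2⟩ := Prod.ext_iff.1 hyy
      simp only at h1 h2
      rw [h1, h2, avgdot, abs_of_nonneg (avg0 _ _ _ _ _)])
    (fun k y => by linarith [avg2 k y.1 (stAt v y.2.1.1 y.2.1.2) y.2.1.2 y.2.2])
  have hs : ∀ t k (F : ℝ≥0∞ → ℝ≥0∞), hsum (π t) (v + i + 1) (fun hist s =>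
      ∑ m, ENNReal.ofReal (Ms.bel hist s m) * F (e k m (stAt v hist s) s))
      = ∑' y : Fin L × (List (S × A) × S) × A, histWt (π t) (v + i) y.2.1
        * (π t y.2.1.1 y.2.1.2 y.2.2 * (ENNReal.ofReal (Ms.bel y.2.1.1 y.2.1.2 y.1)
          * ∑' s', ENNReal.ofReal (Ms.tr y.1 y.2.1.2 y.2.2 s')
            * F (e k y.1 (stAt v y.2.1.1 y.2.1.2) s'))) := by
    intro t k F
    rw [hsum' t fun m hist s a => ENNReal.ofReal (Ms.bel hist s m)
      * ∑' s', ENNReal.ofReal (Ms.tr m s a s') * F (e k m (stAt v hist s) s'), hsum_succ]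
    refine hsum_congr fun hist s hl => ?_
    have hv : v ≤ hist.length := by omega
    unfold step
    refine Finset.sum_congr rfl fun a _ => ?_
    congr 1
    rw [Summable.tsum_finsetSum fun _ _ => ENNReal.summable]
    refine Finset.sum_congr rfl fun m _ => ?_
    rw [← ENNReal.tsum_mul_left]
    refine tsum_congr fun s' => ?_
    rw [stAt_append hv, bel_append, ENNReal.ofReal_mul (Ms.bel_nonneg _ _ _), mul_assoc]
  have hs1 := fun t k => hs t k id
  have hs2 := fun t k => hs t k (fun x => x ^ 2)
  simp only [id] at hs1
  simp only [hs1, hs2]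
  simp only [← avgE]
  refine le_trans (le_of_eq ?_) (h.trans ?_)
  · simp only [mul_assoc]
  · refine add_le_add_right (mul_le_mul_right (Finset.sum_le_sum fun k _ => add_le_add_right
      (Finset.sum_le_sum fun t _ => ENNReal.tsum_le_tsum fun y => ?_) _) _) _
    rw [mul_assoc, mul_assoc]
    gcongr
    rw [ENNReal.ofReal_pow (avg0 _ _ _ _ _), avgE]
    -- Jensen returns from squared means to means of squares, which are what the data control.
    exact sq_tsum_le (Ms.isProb_tr _ _ _) _

theorem sum_hsum_pair_le (Ms : LMDP S A L) {d : ℕ} (hd0 : 0 < d) (hd : Ms.rank ≤ d) {B η : ℝ}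
    (hB : 0 < B) (hη : 0 < η) (K v i : ℕ) (π : ℕ → Policy S A)
    (e : ℕ → Fin L → S → S → ℝ≥0∞) (he : ∀ k m x s, e k m x s ≤ 2) :
    ∑ k ∈ Finset.range K, hsum (π k) (v + i) (fun hist s =>
        ∑ m, ENNReal.ofReal (Ms.bel hist s m) * e k m (stAt v hist s) s) ≤
      ENNReal.ofReal (η * (4 * d ^ 2 * L * Real.log (1 + K * (4 * d) / B)))
        + ENNReal.ofReal η⁻¹ * ∑ k ∈ Finset.range K, (ENNReal.ofReal (16 + 16 * B)
          + ∑ t ∈ Finset.range k, hsum (π t) (v + i) (fun hist s =>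
            ∑ m, ENNReal.ofReal (Ms.bel hist s m) * e k m (stAt v hist s) s ^ 2)) := by
  cases i with
  | zero => exact sum_hsum_pair_le_zero Ms hd0 hd hB hη K v π e he
  | succ i => exact sum_hsum_pair_le_succ Ms hd0 hd hB hη K v i π e he

end LMDP

end Regret

/-! ### Adding up over steps and rounds -/

section RegretSum

variable {S A : Type*} [Fintype A] [Nonempty A] {L : ℕ}

set_option linter.unusedSectionVars false

theorem sum_range_sum_add_le (C X Y : ℝ≥0∞) (K n : ℕ) (f d : ℕ → ℕ → ℝ≥0∞)
    (h : ∀ j < n, ∑ k ∈ Finset.range K, f j k ≤ X + Y * ∑ k ∈ Finset.range K, (C + d j k)) :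
    ∑ j ∈ Finset.range n, ∑ k ∈ Finset.range K, f j k
      ≤ n * X + Y * ∑ k ∈ Finset.range K, (n * C + ∑ j ∈ Finset.range n, d j k) := by
  refine (Finset.sum_le_sum fun j hj => h j (Finset.mem_range.1 hj)).trans (le_of_eq ?_)
  rw [Finset.sum_add_distrib, ← Finset.mul_sum, Finset.sum_comm, Finset.sum_const,
    Finset.card_range, nsmul_eq_mul]
  congr 2
  refine Finset.sum_congr rfl fun k _ => ?_
  rw [Finset.sum_add_distrib, Finset.sum_const, Finset.card_range, nsmul_eq_mul]

namespace LMDP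

/-- The sum of the distances of the models from the true one, in terms of the data budgets. -/
theorem sum_hsum_absDiff_le (Mk : ℕ → LMDP S A L) (Ms : LMDP S A L) (πexp : Policy S A)
    (π : ℕ → Policy S A) {d : ℕ} (hd0 : 0 < d) (hd : Ms.rank ≤ d) {B η : ℝ} (hB : 0 < B)
    (hη : 0 < η) (K v n : ℕ) {e b Φ : ℝ≥0∞}
    (hsep : ∀ k n', n ≤ n' → n' ≤ v + n → (Mk k).FutSeparated πexp n')
    (hM : ∀ k t, hsum (π t) v (fun hist s => ENNReal.ofReal ((Mk k).pairSum hist s)) ≤ e)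
    (hMs : ∀ t, hsum (π t) v (fun hist s => ENNReal.ofReal (Ms.pairSum hist s)) ≤ e)
    (hsw : ∀ k < K, ∑ t ∈ Finset.range k,
      (Mk k).trajHell Ms (v + n) (Policy.switch (v + 1) (π t) πexp) ≤ b)
    (hφ : ∀ k < K, ∑ t ∈ Finset.range k, ∑ h ∈ Finset.range (v + n + 1),
      (Mk k).trajHell Ms (v + n) (exploreAt πexp h (π t)) ≤ Φ) :
    ∑ k ∈ Finset.range K, hsum (π k) (v + n) ((Mk k).absDiff Ms) ≤ 292 * (K * e)
      + (290 * (v + 3) + n)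
        * ENNReal.ofReal (η * (4 * d ^ 2 * L * Real.log (1 + K * (4 * d) / B)))
      + ENNReal.ofReal η⁻¹ * (K * ((290 * (v + 3) + n) * ENNReal.ofReal (16 + 16 * B)
        + (290 * (8 * Φ + 64 * (Fintype.card A * Φ) + 36 * b)
          + (n * (616 * (K * e) + 576 * b) + 36 * (Fintype.card A * Φ))))) := by
  set X := ENNReal.ofReal (η * (4 * d ^ 2 * L * Real.log (1 + K * (4 * d) / B)))
  set Y := ENNReal.ofReal η⁻¹
  set C := ENNReal.ofReal (16 + 16 * B)
  set a : ℝ≥0∞ := (Fintype.card A : ℝ≥0∞)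
  set H : ℕ → ℕ → ℕ → ℝ≥0∞ := fun k t h => (Mk k).trajHell Ms (v + n) (exploreAt πexp h (π t))
    with hH
  have hΦ : ∀ k < K, ∀ h < v + n + 1, ∑ t ∈ Finset.range k, H k t h ≤ Φ := fun k hk h hh =>
    le_trans (Finset.sum_le_sum fun t _ => Finset.single_le_sum (f := fun h => H k t h)
      (fun _ _ => zero_le) (Finset.mem_range.2 hh)) (hφ k hk)
  -- `Φ` bounds the sum over all exploration steps, so errors at distinct steps share one budget;
  -- bounding them separately would lose a factor of the horizon.
  have hΦ' : ∀ k < K, ∀ (m : ℕ) (g : ℕ → ℕ), Set.InjOn g (Finset.range m : Set ℕ) →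
      (∀ j < m, g j < v + n + 1) →
      ∑ j ∈ Finset.range m, ∑ t ∈ Finset.range k, H k t (g j) ≤ Φ := by
    intro k hk m g hg hlt
    rw [Finset.sum_comm]
    refine le_trans (Finset.sum_le_sum fun t _ => ?_) (hφ k hk)
    rw [← Finset.sum_image (f := fun h => H k t h) hg]
    refine Finset.sum_le_sum_of_subset fun h hh => ?_
    obtain ⟨j, hj, rfl⟩ := Finset.mem_image.1 hh
    exact Finset.mem_range.2 (hlt j (Finset.mem_range.1 hj))
  have hzero : ∑ k ∈ Finset.range K, hsum (π k) 0 ((Mk k).futL1 Ms πexp (v + n)) ≤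
      X + Y * ∑ k ∈ Finset.range K, (C + 4 * Φ) := by
    refine (sum_hsum_futL1_zero_le Mk Ms πexp hd0 hB hη K (v + n) π).trans ?_
    gcongr with k hk
    rw [← Finset.mul_sum]
    gcongr
    exact hΦ k (Finset.mem_range.1 hk) 0 (by omega)
  have hstep : ∑ j ∈ Finset.range v, ∑ k ∈ Finset.range K, hsum (π k) j (fun hist s =>
        ENNReal.ofReal (Ms.tot hist s) * supAbs ((Mk k).stepErr Ms πexp (v + n - (j + 1)) s)
          (Ms.posterior hist s))
      ≤ v * X + Y * ∑ k ∈ Finset.range K, (v * C + 64 * (a * Φ)) := by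
    refine (sum_range_sum_add_le C X Y K v _ (fun j k => ∑ t ∈ Finset.range k,
      32 * (a * (H k t j + H k t (j + 1)))) fun j hj => ?_).trans ?_
    · refine (Ms.sum_hsum_supAbs_le hd0 hd hB hη K j π
        (fun k s => (Mk k).stepErr Ms πexp (v + n - (j + 1)) s) fun k x u =>
          (Mk k).supAbs_stepErr_le Ms (hsep k _ (by omega) (by omega))
            (hsep k _ (by omega) (by omega)) x u).trans ?_
      gcongr with k _ t _
      have := (Mk k).hsum_stepErr_sq_le Ms (hsep k (v + n - (j + 1) + 1) (by omega) (by omega))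
            (hsep k _ (by omega) (by omega)) (π t) j
      rwa [show j + 1 + (v + n - (j + 1)) = v + n by omega] at this
    · gcongr with k hk
      have hk := Finset.mem_range.1 hk
      have h1 := hΦ' k hk v id Function.injective_id.injOn (fun j hj => by simp; omega)
      have h2 := hΦ' k hk v (· + 1) (fun _ _ _ _ h => by simpa using h)
        (fun j hj => by simp; omega)
      simp only [id] at h1
      calc _ = 32 * (a * (∑ j ∈ Finset.range v, ∑ t ∈ Finset.range k, H k t j
            + ∑ j ∈ Finset.range v, ∑ t ∈ Finset.range k, H k t (j + 1))) := by
            simp only [← Finset.mul_sum, Finset.sum_add_distrib]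
        _ ≤ 32 * (a * (Φ + Φ)) := by gcongr
        _ = _ := by ring
  have hend : ∑ k ∈ Finset.range K, hsum (π k) v (fun hist s =>
        ENNReal.ofReal (Ms.tot hist s) * supAbs ((Mk k).endErr Ms πexp n s)
          (Ms.posterior hist s))
      ≤ X + Y * ∑ k ∈ Finset.range K, (C + 36 * b) := by
    refine (Ms.sum_hsum_supAbs_le hd0 hd hB hη K v π
        (fun k s => (Mk k).endErr Ms πexp n s) fun k x u =>
          (Mk k).supAbs_endErr_le Ms (hsep k _ le_rfl (by omega)) x u).trans ?_
    gcongr with k hk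
    refine le_trans (Finset.sum_le_sum fun t _ =>
      (Mk k).hsum_endErr_sq_le Ms (hsep k _ le_rfl (by omega)) (π t) v) ?_
    rw [← Finset.mul_sum]
    gcongr
    exact hsw k (Finset.mem_range.1 hk)
  have hpair : ∑ i ∈ Finset.range n, ∑ k ∈ Finset.range K, hsum (π k) (v + i) (fun hist s =>
        ∑ m, ENNReal.ofReal (Ms.bel hist s m) * (Mk k).trErr Ms πexp n m (stAt v hist s) s)
      ≤ n * X + Y * ∑ k ∈ Finset.range K, (n * C + (n * (616 * (K * e) + 576 * b)
        + 36 * (a * Φ))) := by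
    refine (sum_range_sum_add_le C X Y K n _ (fun i k => ∑ t ∈ Finset.range k,
      (616 * e + 576 * (Mk k).trajHell Ms (v + n) (Policy.switch (v + 1) (π t) πexp)
        + 36 * (a * H k t (v + i + 1)))) fun i hi => ?_).trans ?_
    · refine (Ms.sum_hsum_pair_le hd0 hd hB hη K v i π (fun k m x s => (Mk k).trErr Ms πexp n m x s)
        fun k m x s => (Mk k).trErr_le_two Ms πexp n m x s).trans ?_
      gcongr with k _ t _
      exact (Mk k).hsum_trErr_sq_le Ms (hsep k _ le_rfl (by omega))
        (show i + 1 + (n - (i + 1)) = n by omega) (hM k t) (hMs t)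
    · gcongr with k hk
      have hk := Finset.mem_range.1 hk
      have h1 := hΦ' k hk n (fun i => v + i + 1) (fun _ _ _ _ h => by simpa using h)
        (fun j hj => by simp; omega)
      have hkK : (k : ℝ≥0∞) ≤ K := by exact_mod_cast hk.le
      have h2 : ∀ i, ∑ t ∈ Finset.range k, (616 * e
          + 576 * (Mk k).trajHell Ms (v + n) (Policy.switch (v + 1) (π t) πexp)
          + 36 * (a * H k t (v + i + 1)))
          ≤ (616 * (K * e) + 576 * b) + 36 * (a * ∑ t ∈ Finset.range k, H k t (v + i + 1)) := by
        intro i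
        rw [Finset.sum_add_distrib, Finset.sum_add_distrib, Finset.sum_const, Finset.card_range,
          nsmul_eq_mul, ← Finset.mul_sum, ← Finset.mul_sum, ← Finset.mul_sum, mul_left_comm]
        gcongr
        exact hsw k hk
      refine (Finset.sum_le_sum fun i _ => h2 i).trans ?_
      rw [Finset.sum_add_distrib, Finset.sum_const, Finset.card_range, nsmul_eq_mul,
        ← Finset.mul_sum, ← Finset.mul_sum]
      gcongr
  calc _ ≤ ∑ k ∈ Finset.range K, (292 * e
        + 290 * (2 * hsum (π k) 0 ((Mk k).futL1 Ms πexp (v + n))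
          + ∑ j ∈ Finset.range v, hsum (π k) j (fun hist s => ENNReal.ofReal (Ms.tot hist s)
            * supAbs ((Mk k).stepErr Ms πexp (v + n - (j + 1)) s) (Ms.posterior hist s))
          + hsum (π k) v (fun hist s => ENNReal.ofReal (Ms.tot hist s)
            * supAbs ((Mk k).endErr Ms πexp n s) (Ms.posterior hist s)))
        + ∑ i ∈ Finset.range n, hsum (π k) (v + i) (fun hist s =>
          ∑ m, ENNReal.ofReal (Ms.bel hist s m)
            * (Mk k).trErr Ms πexp n m (stAt v hist s) s)) := by
        refine Finset.sum_le_sum fun k _ => ((Mk k).hsum_absDiff_le Ms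
          (hsep k _ le_rfl (by omega)) (hM k k) (hMs k)).trans ?_
        gcongr
        exact (Mk k).hsum_futL1_le Ms (hsep k _ (by omega) le_rfl) (π k)
    _ = 292 * (K * e) + 290 * (2 * ∑ k ∈ Finset.range K,
          hsum (π k) 0 ((Mk k).futL1 Ms πexp (v + n))
          + ∑ j ∈ Finset.range v, ∑ k ∈ Finset.range K, hsum (π k) j (fun hist s =>
            ENNReal.ofReal (Ms.tot hist s) * supAbs ((Mk k).stepErr Ms πexp (v + n - (j + 1)) s)
            (Ms.posterior hist s))
          + ∑ k ∈ Finset.range K, hsum (π k) v (fun hist s => ENNReal.ofReal (Ms.tot hist s)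
            * supAbs ((Mk k).endErr Ms πexp n s) (Ms.posterior hist s)))
        + ∑ i ∈ Finset.range n, ∑ k ∈ Finset.range K, hsum (π k) (v + i) (fun hist s =>
          ∑ m, ENNReal.ofReal (Ms.bel hist s m)
            * (Mk k).trErr Ms πexp n m (stAt v hist s) s) := by
        rw [Finset.sum_add_distrib, Finset.sum_add_distrib, Finset.sum_const, Finset.card_range,
          nsmul_eq_mul, ← Finset.mul_sum, Finset.sum_add_distrib, Finset.sum_add_distrib,
          ← Finset.mul_sum, mul_left_comm,
          Finset.sum_comm (s := Finset.range K) (t := Finset.range v),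
          Finset.sum_comm (s := Finset.range K) (t := Finset.range n)]
    -- `2 + v + 1` potential bounds enter with the factor `290` and `n` with the factor one.
    _ ≤ 292 * (K * e) + 290 * (2 * (X + Y * ∑ k ∈ Finset.range K, (C + 4 * Φ))
          + (v * X + Y * ∑ k ∈ Finset.range K, (v * C + 64 * (a * Φ)))
          + (X + Y * ∑ k ∈ Finset.range K, (C + 36 * b)))
        + (n * X + Y * ∑ k ∈ Finset.range K, (n * C + (n * (616 * (K * e) + 576 * b)
        + 36 * (a * Φ)))) := by gcongr
    _ = _ := by
        simp only [Finset.sum_const, Finset.card_range, nsmul_eq_mul]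
        ring

end LMDP

end RegretSum

/-! ### The choice of constants -/

section Numerics

/-- The regularization `a * β` cancels from `k`, leaving at most `8 * C₀ * z ^ 4` with `z = l * d *
h / ε`; as `log z ≥ 1 / 2`, the constants are absorbed into a multiple of `log z`. -/
theorem log_one_add_le {C₀ l d a h ε β k : ℝ} (hC : 1 ≤ C₀) (hl : 1 ≤ l) (hd : 1 ≤ d) (ha : 1 ≤ a)
    (hh : 2 ≤ h) (hε : 0 < ε) (hε1 : ε ≤ 1) (hβ : 2 ≤ β)
    (hk : k ≤ 2 * (C₀ * (l * d ^ 2 * a * h ^ 2 * Real.log (l * d * h / ε) * β / ε ^ 2)))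
    (hk0 : 0 ≤ k) :
    Real.log (1 + k * (4 * d) / (a * β))
      ≤ (2 * Real.log (16 * C₀) + 4) * Real.log (l * d * h / ε) := by
  set z := l * d * h / ε with hz
  have hldh : 2 ≤ l * d * h := by
    nlinarith [mul_le_mul hl hd zero_le_one (by linarith)]
  have hz2 : 2 ≤ z := by
    rw [hz, le_div_iff₀ hε]
    nlinarith
  have hι : 1 / 2 ≤ Real.log z := by
    have := Real.log_le_log (by norm_num) hz2
    linarith [Real.log_two_gt_d9]
  have hιz : Real.log z ≤ z := (Real.log_le_sub_one_of_pos (by linarith)).trans (by linarith)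
  have h1 : k * (4 * d) / (a * β) ≤ 8 * C₀ * z ^ 4 := by
    rw [div_le_iff₀ (by positivity)]
    have h2 : l * d ^ 3 * h ^ 2 / ε ^ 2 ≤ z ^ 3 := by
      have e : z ^ 3 = l ^ 2 * (h / ε) * (l * d ^ 3 * h ^ 2 / ε ^ 2) := by
        rw [hz]; field_simp
      rw [e]
      refine le_mul_of_one_le_left (by positivity) ?_
      refine one_le_mul_of_one_le_of_one_le (one_le_pow₀ hl) ?_
      rw [le_div_iff₀ hε]
      linarith
    calc k * (4 * d) ≤ 2 * (C₀ * (l * d ^ 2 * a * h ^ 2 * Real.log z * β / ε ^ 2)) * (4 * d) := by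
          gcongr
      _ = 8 * C₀ * (l * d ^ 3 * h ^ 2 / ε ^ 2 * Real.log z) * (a * β) := by ring
      _ ≤ 8 * C₀ * (z ^ 3 * z) * (a * β) := by gcongr
      _ = _ := by ring
  have hz4 : 1 ≤ z ^ 4 := one_le_pow₀ (by linarith)
  have h3 : 1 ≤ 8 * C₀ * z ^ 4 := by nlinarith [mul_le_mul hC hz4 zero_le_one (by linarith)]
  have h4 : Real.log (1 + k * (4 * d) / (a * β)) ≤ Real.log (16 * C₀ * z ^ 4) := by
    refine Real.log_le_log ?_ (by linarith)
    have : 0 ≤ k * (4 * d) / (a * β) := by positivity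
    linarith
  rw [Real.log_mul (by positivity) (by positivity), Real.log_pow] at h4
  have h5 : 0 ≤ Real.log (16 * C₀) := Real.log_nonneg (by linarith)
  push_cast at h4
  nlinarith [mul_le_mul_of_nonneg_left hι h5]

/-- `log C₀` is of smaller order than `C₀`, shown through `√C₀`. The factor is `9280 * 300000`, from
the choice of `η` and the bound of `Z`. -/
theorem log_coefficient_le {C₀ : ℝ} (hC : 10 ^ 24 ≤ C₀) :
    2784000000 * (2 * Real.log (16 * C₀) + 4) ≤ C₀ / 4 := by
  have hC0 : (0 : ℝ) < C₀ := by linarith [show (0 : ℝ) < 10 ^ 24 by positivity]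
  have hs : (10 : ℝ) ^ 12 ≤ √C₀ := Real.le_sqrt_of_sq_le (by norm_num; norm_num at hC; exact hC)
  have hsq := Real.sq_sqrt hC0.le
  have h1 : Real.log (16 * C₀) ≤ 2 * (4 * √C₀) := by
    have e : 16 * C₀ = (4 * √C₀) ^ 2 := by rw [mul_pow, hsq]; norm_num
    rw [e, Real.log_pow]
    have := Real.log_le_sub_one_of_pos (show 0 < 4 * √C₀ by positivity)
    push_cast
    linarith
  norm_num at hs
  nlinarith

/-- The numerical inequality behind the choice of the number of episodes. -/
theorem regret_bound_le {C₀ l d a h ε β v n εs k : ℝ} (hC : 10 ^ 24 ≤ C₀) (hl : 1 ≤ l) (hd : 1 ≤ d)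
    (ha : 1 ≤ a) (hh : 2 ≤ h) (hε : 0 < ε) (hε1 : ε ≤ 1) (hβ : 2 ≤ β)
    (hv : 0 ≤ v) (hn : 0 ≤ n) (hvn : v + n + 1 = h)
    (hεs : εs = ε ^ 2 / (C₀ * l * d ^ 2 * h ^ 2 * Real.log (l * d * h / ε)))
    (hk1 : C₀ * (l * d ^ 2 * a * h ^ 2 * Real.log (l * d * h / ε) * β / ε ^ 2) ≤ k)
    (hk2 : k ≤ C₀ * (l * d ^ 2 * a * h ^ 2 * Real.log (l * d * h / ε) * β / ε ^ 2) + 1) :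
    ∃ η : ℝ, 0 < η ∧ 292 * (k * εs)
      + (290 * (v + 3) + n) * (η * (4 * d ^ 2 * l * Real.log (1 + k * (4 * d) / (a * β))))
      + η⁻¹ * (k * ((290 * (v + 3) + n) * (16 + 16 * (a * β))
        + (290 * (8 * (8 * h * β) + 64 * (a * (8 * h * β)) + 36 * (8 * β))
          + (n * (616 * (k * εs) + 576 * (8 * β)) + 36 * (a * (8 * h * β)))))) ≤ k * ε := by
  have hC0 : (0 : ℝ) < C₀ := by linarith [show (0 : ℝ) < 10 ^ 24 by positivity]
  have hC1 : (1 : ℝ) ≤ C₀ := by linarith [show (1 : ℝ) ≤ 10 ^ 24 by norm_num]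
  have hldh : 2 ≤ l * d * h := by
    nlinarith [mul_le_mul hl hd zero_le_one (by linarith)]
  have hz2 : 2 ≤ l * d * h / ε := by
    rw [le_div_iff₀ hε]
    nlinarith
  set ι := Real.log (l * d * h / ε) with hι
  have hι2 : 1 / 2 ≤ ι := by
    have := Real.log_le_log (by norm_num) hz2
    linarith [Real.log_two_gt_d9]
  set q := l * d ^ 2 * h ^ 2 * ι / ε ^ 2 with hq
  have hld : 1 ≤ l * d ^ 2 := one_le_mul_of_one_le_of_one_le hl (one_le_pow₀ hd)
  have hh2 : 4 ≤ h ^ 2 := by nlinarith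
  have hldh2 : 4 ≤ l * d ^ 2 * h ^ 2 := by nlinarith
  have hq1 : 1 ≤ q := by
    rw [hq, le_div_iff₀ (by positivity)]
    have : ε ^ 2 ≤ 1 := pow_le_one₀ hε.le hε1
    nlinarith
  have haβ : 2 ≤ a * β := by nlinarith
  have hy : C₀ * (l * d ^ 2 * a * h ^ 2 * ι * β / ε ^ 2) = C₀ * q * (a * β) := by
    rw [hq]; ring
  rw [hy] at hk1 hk2
  have hy1 : 1 ≤ C₀ * q * (a * β) :=
    one_le_mul_of_one_le_of_one_le (one_le_mul_of_one_le_of_one_le hC1 hq1) (by linarith)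
  have hk0 : 0 < k := by linarith
  have hk2' : k ≤ 2 * (C₀ * q * (a * β)) := by linarith
  have hεq : εs * (C₀ * q) = 1 := by
    rw [hεs, hq]
    field_simp
  have hεs0 : 0 < εs := by
    rw [hεs]
    positivity
  -- `εs` is matched to `k`, so the accumulated decoding errors are no larger than the order of the
  -- data budgets.
  have hkεs : k * εs ≤ 2 * (a * β) := by
    calc k * εs ≤ 2 * (C₀ * q * (a * β)) * εs := by gcongr
      _ = 2 * (a * β) * (εs * (C₀ * q)) := by ring
      _ = _ := by rw [hεq, mul_one]
  have hlog := log_one_add_le hC1 hl hd ha hh hε hε1 hβ (k := k)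
    (by rw [← hι, hy]; exact hk2') hk0.le
  rw [← hι] at hlog
  set Λ := 2 * Real.log (16 * C₀) + 4
  set ι' := Real.log (1 + k * (4 * d) / (a * β)) with hι'
  have hι'0 : 0 < ι' := Real.log_pos (by
    have : 0 < k * (4 * d) / (a * β) := by positivity
    linarith)
  have hΛ : 2784000000 * Λ ≤ C₀ / 4 := log_coefficient_le hC
  -- This `η` makes the potential term at most a quarter of `k * ε`, as `580 * 4 / 9280 = 1 / 4`;
  -- the other two terms are also at most a quarter each.
  refine ⟨k * ε / (9280 * (h * d ^ 2 * l * ι')), by positivity, ?_⟩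
  have hT1 : 292 * (k * εs) ≤ k * ε / 4 := by
    have h1 : εs * 2000 ≤ ε := by
      rw [hεs, div_mul_eq_mul_div, div_le_iff₀ (by positivity)]
      have h2 : 2000 ≤ C₀ * l * d ^ 2 * h ^ 2 * ι := by
        have h3 : 2000 * (4 * (1 / 2)) ≤ C₀ * (l * d ^ 2 * h ^ 2 * ι) := by
          refine mul_le_mul (by linarith [show (2000 : ℝ) ≤ 10 ^ 24 by norm_num])
            (mul_le_mul hldh2 hι2 (by norm_num) (by linarith)) (by norm_num) hC0.le
        calc (2000 : ℝ) ≤ C₀ * (l * d ^ 2 * h ^ 2 * ι) := by linarith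
          _ = _ := by ring
      calc ε ^ 2 * 2000 = ε * (ε * 2000) := by ring
        _ ≤ ε * (1 * 2000) := by gcongr
        _ ≤ _ := by rw [one_mul]; exact mul_le_mul_of_nonneg_left h2 hε.le
    nlinarith
  have hcoef : 290 * (v + 3) + n ≤ 580 * h := by nlinarith
  have hcoef0 : 0 ≤ 290 * (v + 3) + n := by positivity
  have hT2 : (290 * (v + 3) + n) * (k * ε / (9280 * (h * d ^ 2 * l * ι'))
      * (4 * d ^ 2 * l * ι')) ≤ k * ε / 4 := by
    calc _ ≤ 580 * h * (k * ε / (9280 * (h * d ^ 2 * l * ι')) * (4 * d ^ 2 * l * ι')) := by gcongr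
      _ = _ := by field_simp; norm_num
  set Z := (290 * (v + 3) + n) * (16 + 16 * (a * β))
        + (290 * (8 * (8 * h * β) + 64 * (a * (8 * h * β)) + 36 * (8 * β))
          + (n * (616 * (k * εs) + 576 * (8 * β)) + 36 * (a * (8 * h * β)))) with hZ
  have hZle : Z ≤ 300000 * (h * (a * β)) := by
    have hβa : β ≤ a * β := le_mul_of_one_le_left (by linarith) ha
    have hhβ : h * β ≤ h * (a * β) := by gcongr
    have hβh : a * β ≤ h * (a * β) := le_mul_of_one_le_left (by linarith) (by linarith)
    have h1 : (290 * (v + 3) + n) * (16 + 16 * (a * β)) ≤ 580 * h * (24 * (a * β)) :=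
      mul_le_mul hcoef (by linarith) (by linarith) (by linarith)
    have h2 : n * (616 * (k * εs) + 576 * (8 * β)) ≤ h * (5840 * (a * β)) :=
      mul_le_mul (by linarith) (by linarith) (by positivity) (by linarith)
    rw [hZ]
    linarith
  have hZ0 : 0 ≤ Z := by positivity
  have hT3 : (k * ε / (9280 * (h * d ^ 2 * l * ι')))⁻¹ * (k * Z) ≤ k * ε / 4 := by
    calc _ = 9280 * (h * d ^ 2 * l) / ε * (ι' * Z) := by field_simp
      _ ≤ 9280 * (h * d ^ 2 * l) / ε * ((Λ * ι) * (300000 * (h * (a * β)))) :=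
          mul_le_mul_of_nonneg_left (mul_le_mul hlog hZle hZ0 (hι'0.le.trans hlog)) (by positivity)
      _ = (2784000000 * Λ) * (q * (a * β) * ε) := by rw [hq]; field_simp; ring
      _ ≤ C₀ / 4 * (q * (a * β) * ε) := by gcongr
      _ = C₀ * q * (a * β) * ε / 4 := by ring
      _ ≤ _ := by gcongr
  have : 0 < k * ε := by positivity
  linarith

end Numerics

/-! ### Affinities with an upper envelope -/

section Affinity

variable {X : Type*}

theorem tsum_sqrt_mul_sqrt_le {p q : X → ℝ} (hp0 : ∀ x, 0 ≤ p x) (hp : Summable p) (hq : IsProb q)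
    {r : ℝ} (hr : ∑' x, p x ≤ 1 + r) : ∑' x, √(p x) * √(q x) ≤ 1 + r / 2 := by
  have h : ∑' x, √(p x) * √(q x) ≤ ∑' x, (p x / 2 + q x / 2) := by
    refine Summable.tsum_le_tsum (fun x => ?_)
      (summable_sqrt_mul hp0 hq.1 hp hq.2.summable)
      ((hp.div_const 2).add (hq.2.summable.div_const 2))
    nlinarith [sq_nonneg (√(p x) - √(q x)), Real.sq_sqrt (hp0 x), Real.sq_sqrt (hq.1 x)]
  rw [Summable.tsum_add (hp.div_const 2) (hq.2.summable.div_const 2), tsum_div_const,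
    tsum_div_const, hq.2.tsum_eq] at h
  linarith

theorem hell_eq {p q : X → ℝ} (hp : IsProb p) (hq : IsProb q) :
    hell p q = ENNReal.ofReal (2 - 2 * ∑' x, √(p x) * √(q x)) := by
  have h := hell_scaled hp hq zero_le_one zero_le_one
  simp only [one_mul, Real.sqrt_one, mul_one] at h
  rw [h]
  norm_num

/-- The Hellinger distance in terms of the affinity with an upper bound of the first law. -/
theorem hell_le_of_le {p q ph : X → ℝ} (hp : IsProb p) (hq : IsProb q) (hle : ∀ x, p x ≤ ph x)
    (hs : Summable ph) {r : ℝ} (hr0 : 0 < r) (hr : ∑' x, ph x ≤ 1 + r ^ 2) :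
    hell p q ≤ ENNReal.ofReal (2 * (1 - ∑' x, √(ph x) * √(q x)) + 2 * r) := by
  have hph0 : ∀ x, 0 ≤ ph x := fun x => (hp.1 x).trans (hle x)
  rw [hell_eq hp hq]
  refine ENNReal.ofReal_le_ofReal ?_
  have s1 := summable_sqrt_mul hp.1 hq.1 hp.2.summable hq.2.summable
  have s2 := (hs.sub hp.2.summable).mul_left (1 / (2 * r))
  have s3 := hq.2.summable.mul_left (r / 2)
  have h : ∑' x, √(ph x) * √(q x)
      ≤ ∑' x, (√(p x) * √(q x) + 1 / (2 * r) * (ph x - p x) + r / 2 * q x) := by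
    refine Summable.tsum_le_tsum (fun x => ?_) (summable_sqrt_mul hph0 hq.1 hs hq.2.summable)
      ((s1.add s2).add s3)
    have h1 := Real.sqrt_le_sqrt (hle x)
    have h2 : (√(ph x) - √(p x)) ^ 2 ≤ ph x - p x :=
      (sq_sqrt_sub_sqrt_le (hph0 x) (hp.1 x)).trans_eq (abs_of_nonneg (sub_nonneg.2 (hle x)))
    -- Weighted AM–GM: the excess of the envelope, of mass at most `r ^ 2`, and the law `q`
    -- contribute `r / 2` each.
    have h3 : (√(ph x) - √(p x)) * √(q x)
        ≤ 1 / (2 * r) * (√(ph x) - √(p x)) ^ 2 + r / 2 * √(q x) ^ 2 := by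
      have e : 1 / (2 * r) * (√(ph x) - √(p x)) ^ 2 + r / 2 * √(q x) ^ 2
          - (√(ph x) - √(p x)) * √(q x)
          = 1 / (2 * r) * ((√(ph x) - √(p x)) - r * √(q x)) ^ 2 := by
        field_simp
        ring
      have : 0 ≤ 1 / (2 * r) * ((√(ph x) - √(p x)) - r * √(q x)) ^ 2 := by positivity
      linarith
    rw [Real.sq_sqrt (hq.1 x)] at h3
    have h4 : 1 / (2 * r) * (√(ph x) - √(p x)) ^ 2 ≤ 1 / (2 * r) * (ph x - p x) := by gcongr
    linarith
  rw [Summable.tsum_add (s1.add s2) s3, Summable.tsum_add s1 s2, tsum_mul_left, tsum_mul_left,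
    hq.2.tsum_eq, Summable.tsum_sub hs hp.2.summable, hp.2.tsum_eq] at h
  have h5 : 1 / (2 * r) * (∑' x, ph x - 1) ≤ 1 / (2 * r) * r ^ 2 := by
    gcongr
    linarith
  have h6 : 1 / (2 * r) * r ^ 2 = r / 2 := by field_simp
  linarith

end Affinity

/-! ### Ville's inequality along the run of the algorithm -/

section Run

variable {S A Θ : Type*} {L H : ℕ} [Fintype A] [Nonempty A] [NeZero H]

theorem tsum_omleRun_succ (M : Θ → LMDP S A L) (θstar : Θ) (W : ℕ) (πexp : Policy S A)
    (sel : (k : ℕ) → (Fin k → Round Θ S A H) → Θ × Policy S A) (k : ℕ)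
    (F : (Fin (k + 1) → Round Θ S A H) → ℝ≥0∞) :
    ∑' D, omleRun M θstar W πexp sel (k + 1) D * F D
      = ∑' D, omleRun M θstar W πexp sel k D *
        ∑' τ, (M θstar).mixLaw H (explore H W πexp (sel k D).2) τ
          * F (Fin.snoc D ⟨(sel k D).1, (sel k D).2, τ⟩ : Fin (k + 1) → Round Θ S A H) := by
  rw [omleRun, tsum_bind_mul]
  simp only [tsum_map_mul]

theorem snoc_comp_castLE {R : Type*} {k j : ℕ} (hj : j ≤ k) (D : Fin k → R) (r : R) :
    (fun i : Fin j => (Fin.snoc D r : Fin (k + 1) → R) (Fin.castLE (hj.trans k.le_succ) i))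
      = fun i => D (Fin.castLE hj i) := by
  funext i
  exact Fin.snoc_castSucc (α := fun _ => R) r D (Fin.castLE hj i)

theorem mem_support_omleRun (M : Θ → LMDP S A L) (θstar : Θ) (W : ℕ) (πexp : Policy S A)
    (sel : (k : ℕ) → (Fin k → Round Θ S A H) → Θ × Policy S A) {K : ℕ}
    {D : Fin K → Round Θ S A H} (hD : D ∈ (omleRun M θstar W πexp sel K).support) (k : ℕ)
    (hk : k < K) :
    (fun i => D (Fin.castLE hk.le i)) ∈ (omleRun M θstar W πexp sel k).support ∧
      (D ⟨k, hk⟩).model = (sel k fun i => D (Fin.castLE hk.le i)).1 ∧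
      (D ⟨k, hk⟩).policy = (sel k fun i => D (Fin.castLE hk.le i)).2 ∧
      (D ⟨k, hk⟩).traj ∈ ((M θstar).mixLaw H (explore H W πexp (D ⟨k, hk⟩).policy)).support := by
  induction K with
  | zero => omega
  | succ K ih =>
    rw [omleRun, PMF.mem_support_bind_iff] at hD
    obtain ⟨D', hD', h⟩ := hD
    rw [PMF.mem_support_map_iff] at h
    obtain ⟨τ, hτ, rfl⟩ := h
    rcases Nat.lt_succ_iff_lt_or_eq.1 hk with hlt | rfl
    · have e := snoc_comp_castLE hlt.le D'
        (⟨(sel K D').1, (sel K D').2, τ⟩ : Round Θ S A H)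
      have e2 : (Fin.snoc D' (⟨(sel K D').1, (sel K D').2, τ⟩ : Round Θ S A H) :
          Fin (K + 1) → Round Θ S A H) ⟨k, hk⟩ = D' ⟨k, hlt⟩ :=
        Fin.snoc_castSucc (α := fun _ => Round Θ S A H) _ D' ⟨k, hlt⟩
      rw [e, e2]
      exact ih hD' hlt
    · have e := snoc_comp_castLE le_rfl D'
        (⟨(sel k D').1, (sel k D').2, τ⟩ : Round Θ S A H)
      have e2 : (Fin.snoc D' (⟨(sel k D').1, (sel k D').2, τ⟩ : Round Θ S A H) :
          Fin (k + 1) → Round Θ S A H) ⟨k, hk⟩ = ⟨(sel k D').1, (sel k D').2, τ⟩ :=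
        Fin.snoc_last (α := fun _ => Round Θ S A H) _ D'
      rw [e, e2]
      exact ⟨hD', rfl, rfl, hτ⟩

/-- The product of the weights `z` of an initial segment of the records reaches the level `c`. -/
def Reaches {R : Type*} (z : R → ℝ≥0∞) (c : ℝ≥0∞) {k : ℕ} (D : Fin k → R) : Prop :=
  ∃ (j : ℕ) (hj : j ≤ k), c ≤ ∏ i : Fin j, z (D (Fin.castLE hj i))

open Classical in
/-- The value of the product of the weights, stopped at the level `c`. -/
def cappedProd {R : Type*} (z : R → ℝ≥0∞) (c : ℝ≥0∞) {k : ℕ} (D : Fin k → R) : ℝ≥0∞ :=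
  if Reaches z c D then c else ∏ i, z (D i)

/-- Only the full product can reach the level for the first time, and then it is at least `c`. -/
theorem cappedProd_snoc_le {R : Type*} (z : R → ℝ≥0∞) (c : ℝ≥0∞) {k : ℕ} (D : Fin k → R)
    (hD : ¬ Reaches z c D) (r : R) :
    cappedProd z c (Fin.snoc D r : Fin (k + 1) → R) ≤ (∏ i, z (D i)) * z r := by
  classical
  have hprod : ∏ i, z ((Fin.snoc D r : Fin (k + 1) → R) i) = (∏ i, z (D i)) * z r := by
    rw [Fin.prod_univ_castSucc]
    simp
  unfold cappedProd
  split_ifs with h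
  · obtain ⟨j, hj, hc⟩ := h
    rcases Nat.le_succ_iff.1 hj with hlt | rfl
    · refine absurd ⟨j, hlt, ?_⟩ hD
      have e := snoc_comp_castLE hlt D r
      simp only [funext_iff] at e
      simpa only [e] using hc
    · exact hc.trans_eq hprod
  · exact hprod.le

/-- Ville's inequality for products of weights along the run of the algorithm. -/
theorem tsum_omleRun_reaches_le (M : Θ → LMDP S A L) (θstar : Θ) (W : ℕ) (πexp : Policy S A)
    (sel : (k : ℕ) → (Fin k → Round Θ S A H) → Θ × Policy S A) {z : Round Θ S A H → ℝ≥0∞}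
    (hz : ∀ θ π, ∑' τ, (M θstar).mixLaw H (explore H W πexp π) τ * z ⟨θ, π, τ⟩ ≤ 1)
    {c : ℝ≥0∞} (hc0 : c ≠ 0) (hc : c ≠ ∞) (K : ℕ) :
    (omleRun M θstar W πexp sel K).toOuterMeasure {D | Reaches z c D} ≤ c⁻¹ := by
  classical
  -- The stopped and capped product has mean at most one: after stopping it is constant, before it
  -- is multiplied by a weight of conditional mean at most one.
  have key : ∀ k, ∑' D, omleRun M θstar W πexp sel k D * cappedProd z c D ≤ 1 := by
    intro k
    induction k with
    | zero =>
      have h1 : ∀ D : Fin 0 → Round Θ S A H, cappedProd z c D ≤ 1 := by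
        intro D
        unfold cappedProd
        split_ifs with h
        · obtain ⟨j, hj, h⟩ := h
          obtain rfl : j = 0 := by omega
          simpa using h
        · simp
      calc _ ≤ ∑' D, omleRun M θstar W πexp sel 0 D * 1 := by
            gcongr with D
            exact h1 D
        _ = 1 := by simp only [mul_one, PMF.tsum_coe]
    | succ k ih =>
      rw [tsum_omleRun_succ]
      refine le_trans ?_ ih
      gcongr with D
      by_cases hD : Reaches z c D
      · have h1 : ∀ r, cappedProd z c (Fin.snoc D r : Fin (k + 1) → Round Θ S A H) = c := by
          intro r
          unfold cappedProd
          obtain ⟨j, hj, h⟩ := hD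
          refine if_pos ⟨j, hj.trans k.le_succ, ?_⟩
          have e := snoc_comp_castLE hj D r
          simp only [funext_iff] at e
          simpa only [e] using h
        simp only [h1, ENNReal.tsum_mul_right, PMF.tsum_coe, one_mul]
        unfold cappedProd
        rw [if_pos hD]
      · have h2 : cappedProd z c D = ∏ i, z (D i) := by
          unfold cappedProd
          rw [if_neg hD]
        rw [h2]
        calc _ ≤ ∑' τ, (M θstar).mixLaw H (explore H W πexp (sel k D).2) τ
              * ((∏ i, z (D i)) * z ⟨(sel k D).1, (sel k D).2, τ⟩) := by
              gcongr with τ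
              exact cappedProd_snoc_le z c D hD _
          _ = (∏ i, z (D i)) * ∑' τ, (M θstar).mixLaw H (explore H W πexp (sel k D).2) τ
              * z ⟨(sel k D).1, (sel k D).2, τ⟩ := by
              rw [← ENNReal.tsum_mul_left]
              exact tsum_congr fun τ => by ring
          _ ≤ _ := mul_le_of_le_one_right zero_le (hz _ _)
  -- Markov's inequality for the stopped product.
  rw [PMF.toOuterMeasure_apply, ← one_div, ENNReal.le_div_iff_mul_le (Or.inl hc0) (Or.inl hc),
    ← ENNReal.tsum_mul_right]
  refine le_trans ?_ (key K)
  refine ENNReal.tsum_le_tsum fun D => ?_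
  rw [Set.indicator_apply]
  split_ifs with h
  · have h' : cappedProd z c D = c := if_pos h
    rw [h']
  · simp

end Run

/-! ### Normalized roots of likelihood ratios -/

section Weights

variable {X : Type*}

/-- The root of the likelihood ratio of `q` and `p`, scaled by a factor that makes its mean under
`p` at most one. -/
def rootRatio (p q : X → ℝ) (x : X) : ℝ :=
  √(q x / p x) * Real.exp (1 - ∑' y, √(q y) * √(p y))

/-- With `b` the affinity, the mean is `b * exp (1 - b) ≤ 1`. Points with `p x = 0` do not
contribute. -/
theorem tsum_mul_rootRatio_le (p : PMF X) {q : X → ℝ} (hq0 : ∀ x, 0 ≤ q x) (hq : Summable q) :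
    ∑' x, p x * ENNReal.ofReal (rootRatio (fun x => (p x).toReal) q x) ≤ 1 := by
  have hp := isProb_toReal p
  have hs := summable_sqrt_mul hq0 hp.1 hq hp.2.summable
  have h : ∀ x, p x * ENNReal.ofReal (rootRatio (fun x => (p x).toReal) q x)
      = ENNReal.ofReal (√(q x) * √((p x).toReal)
        * Real.exp (1 - ∑' y, √(q y) * √((p y).toReal))) := by
    intro x
    rw [← ENNReal.ofReal_toReal (p.apply_ne_top x), ← ENNReal.ofReal_mul ENNReal.toReal_nonneg,
      ENNReal.toReal_ofReal ENNReal.toReal_nonneg, rootRatio, ← mul_assoc]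
    congr 2
    rcases (hp.1 x).eq_or_lt with h0 | h0
    · simp only [← h0, zero_mul, Real.sqrt_zero, mul_zero]
    · rw [Real.sqrt_div (hq0 x), mul_div_assoc', div_eq_iff (Real.sqrt_pos.2 h0).ne', mul_assoc,
        Real.mul_self_sqrt h0.le, mul_comm]
  simp only [h]
  rw [← ENNReal.ofReal_tsum_of_nonneg (fun x => by positivity) (hs.mul_right _), tsum_mul_right]
  refine ENNReal.ofReal_le_one.2 ?_
  set b := ∑' y, √(q y) * √((p y).toReal)
  have h1 : b ≤ Real.exp (b - 1) := by linarith [Real.add_one_le_exp (b - 1)]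
  calc b * Real.exp (1 - b) ≤ Real.exp (b - 1) * Real.exp (1 - b) := by gcongr
    _ = 1 := by rw [← Real.exp_add]; simp

/-- Squaring undoes the roots, and the normalizing factors become the exponential of twice the
summed affinity defects, which will control the Hellinger distances. -/
theorem prod_mul_exp_lt {n : ℕ} {p q b : Fin n → ℝ} (hp : ∀ i, 0 < p i) (hq : ∀ i, 0 ≤ q i) {c : ℝ}
    (h : ∏ i, √(q i / p i) * Real.exp (1 - b i) < c) :
    (∏ i, q i) * Real.exp (2 * ∑ i, (1 - b i)) < c ^ 2 * ∏ i, p i := by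
  have h0 : 0 ≤ ∏ i, √(q i / p i) * Real.exp (1 - b i) := Finset.prod_nonneg fun i _ => by positivity
  have hP : 0 < ∏ i, p i := Finset.prod_pos fun i _ => hp i
  have h2 := pow_lt_pow_left₀ h h0 two_ne_zero
  have e : (∏ i, √(q i / p i) * Real.exp (1 - b i)) ^ 2
      = (∏ i, q i) / (∏ i, p i) * Real.exp (2 * ∑ i, (1 - b i)) := by
    rw [← Finset.prod_pow, ← Finset.prod_div_distrib, Finset.mul_sum, Real.exp_sum,
      ← Finset.prod_mul_distrib]
    refine Finset.prod_congr rfl fun i _ => ?_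
    rw [mul_pow, Real.sq_sqrt (div_nonneg (hq i) (hp i).le), ← Real.exp_nat_mul]
    norm_num
  rw [e, div_mul_eq_mul_div, div_lt_iff₀ hP] at h2
  exact h2

end Weights

/-! ### Optimistic covers -/

section Envelope

variable {S A Θ : Type*} {L H : ℕ}

/-- The mixture of the envelopes of the laws of a trajectory. -/
def envelope (P : Policy S A → Traj S A H → ℝ≥0) (q : PMF (Policy S A)) (τ : Traj S A H) : ℝ≥0∞ :=
  ∑' π, q π * P π τ

theorem tsum_envelope_le (M : LMDP S A L) (P : Policy S A → Traj S A H → ℝ≥0) {r : ℝ}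
    (h : ∀ π, ∑' τ, ENNReal.ofReal |(M.trajLaw H π τ).toReal - (P π τ : ℝ)|
      ≤ ENNReal.ofReal (r ^ 2)) (q : PMF (Policy S A)) :
    ∑' τ, envelope P q τ ≤ ENNReal.ofReal (1 + r ^ 2) := by
  have h1 : ∀ π, ∑' τ, (P π τ : ℝ≥0∞) ≤ ENNReal.ofReal (1 + r ^ 2) := by
    intro π
    rw [ENNReal.ofReal_add zero_le_one (sq_nonneg r), ENNReal.ofReal_one,
      ← (M.trajLaw H π).tsum_coe]
    refine le_trans ?_ (add_le_add le_rfl (h π))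
    rw [← ENNReal.tsum_add]
    refine ENNReal.tsum_le_tsum fun τ => ?_
    rw [← ENNReal.ofReal_coe_nnreal, ← ENNReal.ofReal_toReal (PMF.apply_ne_top _ τ),
      ← ENNReal.ofReal_add ENNReal.toReal_nonneg (abs_nonneg _),
      ENNReal.toReal_ofReal ENNReal.toReal_nonneg]
    refine ENNReal.ofReal_le_ofReal ?_
    linarith [neg_abs_le (((M.trajLaw H π) τ).toReal - (P π τ : ℝ))]
  unfold envelope
  rw [ENNReal.tsum_comm]
  simp only [ENNReal.tsum_mul_left]
  calc _ ≤ ∑' π, q π * ENNReal.ofReal (1 + r ^ 2) := by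
        gcongr with π
        exact h1 π
    _ = _ := by rw [ENNReal.tsum_mul_right, q.tsum_coe, one_mul]

theorem mixLaw_le_envelope (M : LMDP S A L) (P : Policy S A → Traj S A H → ℝ≥0)
    (h : ∀ τ π, M.trajLaw H π τ ≤ (P π τ : ℝ≥0∞)) (q : PMF (Policy S A)) (τ : Traj S A H) :
    M.mixLaw H q τ ≤ envelope P q τ := by
  rw [LMDP.mixLaw, PMF.bind_apply, envelope]
  gcongr with π
  exact h τ π

/-- An optimistic cover of minimal cardinality exists if the covering number is finite. -/
theorem exists_cover_card_le (M : Θ → LMDP S A L) (r : ℝ) (h : coveringNumber M H r ≠ ⊤) :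
    ∃ Θ₀ Phat, IsOptimisticCover M H r Θ₀ Phat ∧ (Θ₀.card : ℕ∞) = coveringNumber M H r := by
  unfold coveringNumber at h ⊢
  have hne : Nonempty {Θ₀ : Finset Θ // ∃ Phat, IsOptimisticCover M H r Θ₀ Phat} := by
    by_contra hn
    rw [not_nonempty_iff] at hn
    exact h (iInf_of_empty _)
  obtain ⟨⟨Θ₀, Phat, hP⟩, he⟩ := ciInf_mem
    fun Θ₀ : {Θ₀ : Finset Θ // ∃ Phat, IsOptimisticCover M H r Θ₀ Phat} => ((Θ₀ : Finset Θ).card : ℕ∞)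
  exact ⟨Θ₀, Phat, hP, he⟩

/-- A real `β` forces a finite covering number, and the inequality is the union bound at the level
`exp (β / 2 - 1)`. A cover is nonempty, so its logarithm is nonnegative and `β ≥ 2`. -/
theorem exists_cover_of_log_le (M : Θ → LMDP S A L) (θ : Θ) {r p β : ℝ} (hp : 0 < p) (hp1 : p < 1)
    (h : 2 * ENNReal.log (coveringNumber M H r : ℝ≥0∞)
      + ((2 * Real.log (1 / p) + 2 : ℝ) : EReal) ≤ (β : EReal)) :
    2 ≤ β ∧ ∃ Θ₀ Phat, IsOptimisticCover M H r Θ₀ Phat ∧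
      Θ₀.card * Real.exp (1 - β / 2) ≤ p := by
  have hN : coveringNumber M H r ≠ ⊤ := by
    intro hN
    rw [hN] at h
    simp only [ENat.toENNReal_top, ENNReal.log_top] at h
    rw [EReal.mul_top_of_pos (by norm_num), EReal.top_add_coe, top_le_iff] at h
    exact EReal.coe_ne_top _ h
  obtain ⟨Θ₀, Phat, hP, he⟩ := exists_cover_card_le M r hN
  have hcard : 0 < Θ₀.card := Finset.card_pos.2 (let ⟨θ₀, h₀, _⟩ := hP.1 θ; ⟨θ₀, h₀⟩)
  have hcard' : (0 : ℝ) < Θ₀.card := by exact_mod_cast hcard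
  rw [← he, ENat.toENNReal_coe, ← ENNReal.ofReal_natCast, ENNReal.log_ofReal_of_pos hcard'] at h
  have h2 : 2 * Real.log Θ₀.card + (2 * Real.log (1 / p) + 2) ≤ β := by
    rw [show (2 : EReal) = ((2 : ℝ) : EReal) from rfl, ← EReal.coe_mul, ← EReal.coe_add, EReal.coe_le_coe_iff] at h
    exact h
  have h3 : 0 ≤ Real.log Θ₀.card := Real.log_nonneg (by exact_mod_cast hcard)
  rw [one_div, Real.log_inv] at h2
  have h4 : Real.log p < 0 := Real.log_neg hp hp1
  refine ⟨by linarith, Θ₀, Phat, hP, ?_⟩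
  calc Θ₀.card * Real.exp (1 - β / 2) = Real.exp (Real.log Θ₀.card + (1 - β / 2)) := by
        rw [Real.exp_add, Real.exp_log hcard']
    _ ≤ Real.exp (Real.log p) := Real.exp_le_exp.2 (by linarith)
    _ = p := Real.exp_log hp

end Envelope

/-! ### Confidence sets -/

section Likelihood

variable {S A Θ : Type*} {L H : ℕ} [Fintype A] [Nonempty A] [NeZero H]

theorem dataLogLik_eq_log (M : Θ → LMDP S A L) (W : ℕ) (πexp : Policy S A) {k : ℕ}
    (D : Fin k → Round Θ S A H) (θ : Θ) : dataLogLik M W πexp D θ = ENNReal.log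
      (∏ t, (M θ).mixLaw H (explore H W πexp (D t).policy) (D t).traj) := by
  unfold dataLogLik
  induction (Finset.univ : Finset (Fin k)) using Finset.cons_induction with
  | empty => simp
  | cons a s ha ih => rw [Finset.sum_cons, Finset.prod_cons, ENNReal.log_mul_add, ih]

theorem log_ofReal_exp (β : ℝ) : ENNReal.log (ENNReal.ofReal (Real.exp β)) = β := by
  rw [ENNReal.log_ofReal_of_pos (Real.exp_pos _), Real.log_exp]

/-- The product form avoids logarithms of zero; as `β` is finite it can be moved across the
inequality in `EReal`. -/
theorem mem_confidenceSet_iff (M : Θ → LMDP S A L) (W : ℕ) (πexp : Policy S A) (β : ℝ) {k : ℕ}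
    (D : Fin k → Round Θ S A H) (θ : Θ) : θ ∈ confidenceSet M W πexp β D ↔ ∀ θ',
      ∏ t, ((M θ').mixLaw H (explore H W πexp (D t).policy) (D t).traj).toReal
        ≤ Real.exp β * ∏ t, ((M θ).mixLaw H (explore H W πexp (D t).policy) (D t).traj).toReal := by
  have hne : ∀ θ, ∏ t, (M θ).mixLaw H (explore H W πexp (D t).policy) (D t).traj ≠ ∞ :=
    fun θ => ENNReal.prod_ne_top fun t _ => PMF.apply_ne_top _ _
  rw [confidenceSet, Set.mem_ofPred_eq, EReal.sub_le_iff_le_add (Or.inl (EReal.coe_ne_bot β))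
    (Or.inl (EReal.coe_ne_top β)), iSup_le_iff]
  refine forall_congr' fun θ' => ?_
  rw [dataLogLik_eq_log, dataLogLik_eq_log, ← log_ofReal_exp β, ← ENNReal.log_mul_add,
    ENNReal.log_le_log_iff, ← ENNReal.toReal_le_toReal (hne θ')
      (ENNReal.mul_ne_top (hne θ) ENNReal.ofReal_ne_top), ENNReal.toReal_mul, ENNReal.toReal_prod,
    ENNReal.toReal_prod, ENNReal.toReal_ofReal (Real.exp_pos _).le, mul_comm]

/-- On the records whose weights do not reach `exp (β / 2 - 1)`, for any element of an optimistic
cover, the true model stays in the confidence sets, and the models in the confidence sets are close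
to it. -/
theorem confidenceSet_of_not_reaches (M : Θ → LMDP S A L) (θstar : Θ) (W : ℕ) (πexp : Policy S A)
    {β r : ℝ} (hr0 : 0 < r) (hr1 : r ≤ 1) {Θ₀ : Finset Θ}
    {Phat : Θ → Policy S A → Traj S A H → ℝ≥0} (hcov : IsOptimisticCover M H r Θ₀ Phat) {k : ℕ}
    (hkr : k * r ≤ 1) (D : Fin k → Round Θ S A H)
    (hD : ∀ t, (D t).traj ∈ ((M θstar).mixLaw H (explore H W πexp (D t).policy)).support)
    (h : ∀ θ₀ ∈ Θ₀, ∏ t, rootRatio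
        (fun τ => ((M θstar).mixLaw H (explore H W πexp (D t).policy) τ).toReal)
        (fun τ => (envelope (Phat θ₀) (explore H W πexp (D t).policy) τ).toReal) (D t).traj
      < Real.exp (β / 2 - 1)) :
    θstar ∈ confidenceSet M W πexp β D ∧ ∀ θ ∈ confidenceSet M W πexp β D,
      ∑ t, hell (fun τ => ((M θ).mixLaw H (explore H W πexp (D t).policy) τ).toReal)
        (fun τ => ((M θstar).mixLaw H (explore H W πexp (D t).policy) τ).toReal)
        ≤ ENNReal.ofReal (2 * β) := by
  set q : Fin k → PMF (Policy S A) := fun t => explore H W πexp (D t).policy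
  have hpos : ∀ t, 0 < ((M θstar).mixLaw H (q t) (D t).traj).toReal := fun t =>
    ENNReal.toReal_pos ((PMF.mem_support_iff _ _).1 (hD t)) (PMF.apply_ne_top _ _)
  have hPpos : 0 < ∏ t, ((M θstar).mixLaw H (q t) (D t).traj).toReal :=
    Finset.prod_pos fun t _ => hpos t
  -- `b t` is the affinity of the truth with the envelope that covers `θ`; it may exceed one,
  -- because the envelope has mass up to `1 + r ^ 2`.
  have hkey : ∀ θ, ∃ b : Fin k → ℝ, (∀ t, b t ≤ 1 + r ^ 2 / 2) ∧
      (∀ t, hell (fun τ => ((M θ).mixLaw H (q t) τ).toReal)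
        (fun τ => ((M θstar).mixLaw H (q t) τ).toReal)
        ≤ ENNReal.ofReal (2 * (1 - b t) + 2 * r)) ∧
      (∏ t, ((M θ).mixLaw H (q t) (D t).traj).toReal) * Real.exp (2 * ∑ t, (1 - b t))
        < Real.exp (β - 2) * ∏ t, ((M θstar).mixLaw H (q t) (D t).traj).toReal := by
    intro θ
    obtain ⟨θ₀, hθ₀, hle⟩ := hcov.1 θ
    have htop : ∀ t, ∑' τ, envelope (Phat θ₀) (q t) τ ≠ ∞ := fun t =>
      ne_top_of_le_ne_top ENNReal.ofReal_ne_top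
        (tsum_envelope_le (M θ₀) (Phat θ₀) (hcov.2 θ₀ hθ₀) (q t))
    have hs : ∀ t, Summable fun τ => (envelope (Phat θ₀) (q t) τ).toReal := fun t =>
      ENNReal.summable_toReal (htop t)
    have htop' : ∀ t τ, envelope (Phat θ₀) (q t) τ ≠ ∞ := fun t => ENNReal.ne_top_of_tsum_ne_top (htop t)
    have hsum : ∀ t, ∑' τ, (envelope (Phat θ₀) (q t) τ).toReal ≤ 1 + r ^ 2 := by
      intro t
      rw [← ENNReal.tsum_toReal_eq (htop' t)]
      exact ENNReal.toReal_le_of_le_ofReal (by positivity)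
        (tsum_envelope_le (M θ₀) (Phat θ₀) (hcov.2 θ₀ hθ₀) (q t))
    have hle' : ∀ t τ, ((M θ).mixLaw H (q t) τ).toReal ≤ (envelope (Phat θ₀) (q t) τ).toReal :=
      fun t τ => ENNReal.toReal_mono (htop' t τ) (mixLaw_le_envelope (M θ) (Phat θ₀) hle (q t) τ)
    refine ⟨fun t => ∑' τ, √((envelope (Phat θ₀) (q t) τ).toReal)
      * √(((M θstar).mixLaw H (q t) τ).toReal), fun t => ?_, fun t => ?_, ?_⟩
    · exact tsum_sqrt_mul_sqrt_le (fun _ => ENNReal.toReal_nonneg) (hs t) (isProb_toReal _) (hsum t)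
    · exact hell_le_of_le (isProb_toReal _) (isProb_toReal _) (hle' t) (hs t) hr0 (hsum t)
    · have := prod_mul_exp_lt hpos (fun t => ENNReal.toReal_nonneg) (h θ₀ hθ₀)
      rw [← Real.exp_nat_mul] at this
      refine lt_of_le_of_lt ?_ (this.trans_eq (by congr 2; push_cast; ring))
      exact mul_le_mul_of_nonneg_right (Finset.prod_le_prod (fun _ _ => ENNReal.toReal_nonneg)
        fun t _ => hle' t _) (Real.exp_pos _).le
  refine ⟨(mem_confidenceSet_iff _ _ _ _ _ _).2 fun θ => ?_, fun θ hθ => ?_⟩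
  · obtain ⟨b, hb, -, hlt⟩ := hkey θ
    -- The excess of the envelopes adds up to at most `k * r / 2`, which costs only a factor `exp 1`
    -- of the slack in `β`.
    have hsum : -(1 / 2 : ℝ) ≤ ∑ t, (1 - b t) := by
      calc -(1 / 2 : ℝ) ≤ ∑ t : Fin k, -(r / 2) := by
            rw [Finset.sum_const, Finset.card_univ, Fintype.card_fin, nsmul_eq_mul]
            linarith
        _ ≤ _ := Finset.sum_le_sum fun t _ => by nlinarith [hb t]
    have h0 : 0 ≤ ∏ t, ((M θ).mixLaw H (q t) (D t).traj).toReal :=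
      Finset.prod_nonneg fun _ _ => ENNReal.toReal_nonneg
    have h1 : (∏ t, ((M θ).mixLaw H (q t) (D t).traj).toReal) * Real.exp (-1)
        ≤ Real.exp (β - 2) * ∏ t, ((M θstar).mixLaw H (q t) (D t).traj).toReal :=
      le_trans (mul_le_mul_of_nonneg_left (Real.exp_le_exp.2 (by linarith)) h0) hlt.le
    calc ∏ t, ((M θ).mixLaw H (q t) (D t).traj).toReal
        = (∏ t, ((M θ).mixLaw H (q t) (D t).traj).toReal) * Real.exp (-1) * Real.exp 1 := by
          rw [mul_assoc, ← Real.exp_add]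
          simp
      _ ≤ Real.exp (β - 2) * (∏ t, ((M θstar).mixLaw H (q t) (D t).traj).toReal) * Real.exp 1 := by
          gcongr
      _ = Real.exp (β - 1) * ∏ t, ((M θstar).mixLaw H (q t) (D t).traj).toReal := by
          rw [mul_right_comm, ← Real.exp_add]
          ring_nf
      _ ≤ _ := by
          gcongr
          linarith
  · obtain ⟨b, hb, hhell, hlt⟩ := hkey θ
    have h1 := (mem_confidenceSet_iff _ _ _ _ _ _).1 hθ θstar
    -- Membership of `θ` allows the likelihood of the true model, positive on the observed data, to
    -- be cancelled. The remaining `2` pays for the terms `2 * r`.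
    have h2 : Real.exp (2 * ∑ t, (1 - b t)) < Real.exp (2 * β - 2) := by
      have h3 : (∏ t, ((M θstar).mixLaw H (q t) (D t).traj).toReal)
          * Real.exp (2 * ∑ t, (1 - b t))
          < (∏ t, ((M θstar).mixLaw H (q t) (D t).traj).toReal) * Real.exp (2 * β - 2) :=
        calc _ ≤ Real.exp β * (∏ t, ((M θ).mixLaw H (q t) (D t).traj).toReal)
              * Real.exp (2 * ∑ t, (1 - b t)) := by gcongr
          _ < Real.exp β * (Real.exp (β - 2)
              * ∏ t, ((M θstar).mixLaw H (q t) (D t).traj).toReal) := by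
              rw [mul_assoc]
              gcongr
          _ = _ := by
              rw [← mul_assoc, ← Real.exp_add, mul_comm]
              ring_nf
      exact lt_of_mul_lt_mul_left h3 hPpos.le
    rw [Real.exp_lt_exp] at h2
    calc _ ≤ ∑ t, ENNReal.ofReal (2 * (1 - b t) + 2 * r) := Finset.sum_le_sum fun t _ => hhell t
      _ = ENNReal.ofReal (∑ t, (2 * (1 - b t) + 2 * r)) :=
          (ENNReal.ofReal_sum_of_nonneg fun t _ => by nlinarith [hb t]).symm
      _ ≤ _ := by
          refine ENNReal.ofReal_le_ofReal ?_
          rw [Finset.sum_add_distrib, ← Finset.mul_sum, Finset.sum_const, Finset.card_univ,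
            Fintype.card_fin, nsmul_eq_mul]
          linarith

theorem toOuterMeasure_ge_of_compl_le {X : Type*} (P : PMF X) {G : Set X} {p : ℝ} (hp : 0 ≤ p)
    (h : P.toOuterMeasure Gᶜ ≤ ENNReal.ofReal p) : ENNReal.ofReal (1 - p) ≤ P.toOuterMeasure G := by
  have h1 : (1 : ℝ≥0∞) ≤ P.toOuterMeasure G + P.toOuterMeasure Gᶜ := by
    rw [← (P.toOuterMeasure_apply_eq_one_iff Set.univ).2 (Set.subset_univ _),
      ← Set.union_compl_self G]
    exact MeasureTheory.measure_union_le _ _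
  rw [ENNReal.ofReal_sub _ hp, ENNReal.ofReal_one]
  exact tsub_le_iff_right.2 (h1.trans (add_le_add le_rfl h))

/-- With high probability the true model stays in the confidence sets, and the models in the
confidence sets are close to it. -/
theorem exists_confidence_event (M : Θ → LMDP S A L) (θstar : Θ) (W : ℕ) (πexp : Policy S A)
    (sel : (k : ℕ) → (Fin k → Round Θ S A H) → Θ × Policy S A) {β p : ℝ} (hp : 0 ≤ p) {K : ℕ}
    (hK : 0 < K) {Θ₀ : Finset Θ} {Phat : Θ → Policy S A → Traj S A H → ℝ≥0}
    (hcov : IsOptimisticCover M H (1 / K) Θ₀ Phat)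
    (hβ : Θ₀.card * Real.exp (1 - β / 2) ≤ p) :
    ∃ G : Set (Fin K → Round Θ S A H),
      ENNReal.ofReal (1 - p) ≤ (omleRun M θstar W πexp sel K).toOuterMeasure G ∧
      ∀ D ∈ G, D ∈ (omleRun M θstar W πexp sel K).support → ∀ k (hk : k < K),
        θstar ∈ confidenceSet M W πexp β (fun t => D (Fin.castLE hk.le t)) ∧
        ∀ θ ∈ confidenceSet M W πexp β (fun t => D (Fin.castLE hk.le t)),
          ∑ t : Fin k, hell (fun τ => ((M θ).mixLaw H
              (explore H W πexp (D (Fin.castLE hk.le t)).policy) τ).toReal)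
            (fun τ => ((M θstar).mixLaw H
              (explore H W πexp (D (Fin.castLE hk.le t)).policy) τ).toReal)
            ≤ ENNReal.ofReal (2 * β) := by
  set c : ℝ≥0∞ := ENNReal.ofReal (Real.exp (β / 2 - 1)) with hc
  set z : Θ → Round Θ S A H → ℝ≥0∞ := fun θ₀ x => ENNReal.ofReal (rootRatio
    (fun τ => ((M θstar).mixLaw H (explore H W πexp x.policy) τ).toReal)
    (fun τ => (envelope (Phat θ₀) (explore H W πexp x.policy) τ).toReal) x.traj) with hz
  have hc0 : c ≠ 0 := (ENNReal.ofReal_pos.2 (Real.exp_pos _)).ne'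
  have hcinv : c⁻¹ = ENNReal.ofReal (Real.exp (1 - β / 2)) := by
    rw [hc, ← ENNReal.ofReal_inv_of_pos (Real.exp_pos _), ← Real.exp_neg]
    ring_nf
  -- The event concerns all initial segments of the records, so one union bound over the cover
  -- serves every round.
  refine ⟨{D | ∀ θ₀ ∈ Θ₀, ¬ Reaches (z θ₀) c D}, ?_, fun D hD hsupp k hk => ?_⟩
  · refine toOuterMeasure_ge_of_compl_le _ hp ?_
    have e : {D : Fin K → Round Θ S A H | ∀ θ₀ ∈ Θ₀, ¬ Reaches (z θ₀) c D}ᶜ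
        = ⋃ θ₀ ∈ Θ₀, {D | Reaches (z θ₀) c D} := by
      ext D
      simp
    rw [e]
    calc _ ≤ ∑ θ₀ ∈ Θ₀, (omleRun M θstar W πexp sel K).toOuterMeasure {D | Reaches (z θ₀) c D} :=
          MeasureTheory.measure_biUnion_finset_le _ _
      _ ≤ ∑ θ₀ ∈ Θ₀, c⁻¹ := by
          refine Finset.sum_le_sum fun θ₀ hθ₀ => ?_
          refine tsum_omleRun_reaches_le M θstar W πexp sel (fun θ π => ?_) hc0
            ENNReal.ofReal_ne_top K
          exact tsum_mul_rootRatio_le ((M θstar).mixLaw H (explore H W πexp π))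
            (q := fun τ => (envelope (Phat θ₀) (explore H W πexp π) τ).toReal)
            (fun _ => ENNReal.toReal_nonneg) (ENNReal.summable_toReal (ne_top_of_le_ne_top ENNReal.ofReal_ne_top
              (tsum_envelope_le (M θ₀) (Phat θ₀) (hcov.2 θ₀ hθ₀) _)))
      _ = ENNReal.ofReal (Θ₀.card * Real.exp (1 - β / 2)) := by
          rw [Finset.sum_const, hcinv, nsmul_eq_mul, ENNReal.ofReal_mul (Nat.cast_nonneg _),
            ENNReal.ofReal_natCast]
      _ ≤ _ := ENNReal.ofReal_le_ofReal hβ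
  · have hK' : (0 : ℝ) < K := by exact_mod_cast hK
    refine confidenceSet_of_not_reaches M θstar W πexp (r := 1 / K) (by positivity) ?_ hcov ?_ _
      (fun t => ?_) fun θ₀ hθ₀ => ?_
    · rw [div_le_one hK']
      exact_mod_cast hK
    · rw [mul_one_div, div_le_one hK']
      exact_mod_cast hk.le
    · exact (mem_support_omleRun M θstar W πexp sel hsupp t (t.2.trans hk)).2.2.2
    · have h1 := hD θ₀ hθ₀
      rw [Reaches] at h1
      push Not at h1
      have h2 := h1 k hk.le
      rw [hz, ← ENNReal.ofReal_prod_of_nonneg] at h2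
      · exact (ENNReal.ofReal_lt_ofReal_iff (Real.exp_pos _)).1 h2
      · exact fun t _ => mul_nonneg (Real.sqrt_nonneg _) (Real.exp_pos _).le

end Likelihood

/-! ### From distances of laws to suboptimality -/

section Returns

variable {S A Θ : Type*} {L H : ℕ} {R : Fin H → S → A → ℝ}

theorem return_mem_Icc (hR : ∀ h s a, R h s a ∈ Set.Icc (0 : ℝ) 1)
    (hsum : ∑ h, ⨆ x : S × A, R h x.1 x.2 ≤ 1) (τ : Traj S A H) :
    ∑ h, R h (τ h).1 (τ h).2 ∈ Set.Icc (0 : ℝ) 1 := by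
  refine ⟨Finset.sum_nonneg fun h _ => (hR h _ _).1, le_trans (Finset.sum_le_sum fun h _ => ?_) hsum⟩
  exact le_ciSup (f := fun x : S × A => R h x.1 x.2)
    ⟨1, by rintro _ ⟨x, rfl⟩; exact (hR h _ _).2⟩ (τ h)

theorem summable_mul_return (hR : ∀ h s a, R h s a ∈ Set.Icc (0 : ℝ) 1)
    (hsum : ∑ h, ⨆ x : S × A, R h x.1 x.2 ≤ 1) (P : PMF (Traj S A H)) :
    Summable fun τ => (P τ).toReal * ∑ h, R h (τ h).1 (τ h).2 :=
  Summable.of_nonneg_of_le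
    (fun τ => mul_nonneg ENNReal.toReal_nonneg (return_mem_Icc hR hsum τ).1)
    (fun τ => mul_le_of_le_one_right ENNReal.toReal_nonneg (return_mem_Icc hR hsum τ).2)
    (isProb_toReal P).2.summable

theorem expectedReturn_sub_le (hR : ∀ h s a, R h s a ∈ Set.Icc (0 : ℝ) 1)
    (hsum : ∑ h, ⨆ x : S × A, R h x.1 x.2 ≤ 1) (P Q : PMF (Traj S A H)) :
    ENNReal.ofReal (expectedReturn R P - expectedReturn R Q)
      ≤ l1 (fun τ => (P τ).toReal) (fun τ => (Q τ).toReal) := by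
  have hs := (isProb_toReal P).2.summable.sub (isProb_toReal Q).2.summable
  rw [expectedReturn, expectedReturn, ← Summable.tsum_sub (summable_mul_return hR hsum P)
    (summable_mul_return hR hsum Q), l1,
    ← ENNReal.ofReal_tsum_of_nonneg (fun _ => abs_nonneg _) hs.abs]
  refine ENNReal.ofReal_le_ofReal (Summable.tsum_le_tsum (fun τ => ?_)
    ((summable_mul_return hR hsum P).sub (summable_mul_return hR hsum Q)) hs.abs)
  have h := return_mem_Icc hR hsum τ
  rw [← sub_mul]
  calc _ ≤ |(P τ).toReal - (Q τ).toReal| * ∑ h, R h (τ h).1 (τ h).2 :=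
        mul_le_mul_of_nonneg_right (le_abs_self _) h.1
    _ ≤ _ := mul_le_of_le_one_right (abs_nonneg _) h.2

theorem mixValue_omleOutput (hR : ∀ h s a, R h s a ∈ Set.Icc (0 : ℝ) 1)
    (hsum : ∑ h, ⨆ x : S × A, R h x.1 x.2 ≤ 1) (M : LMDP S A L) {K : ℕ} [NeZero K]
    (D : Fin K → Round Θ S A H) :
    M.mixValue R (omleOutput D) = (K : ℝ)⁻¹ * ∑ k, M.value R (D k).policy := by
  have h : ∀ τ, (M.mixLaw H (omleOutput D) τ).toReal
      = (K : ℝ)⁻¹ * ∑ k, (M.trajLaw H (D k).policy τ).toReal := by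
    intro τ
    rw [LMDP.mixLaw, omleOutput, PMF.bind_apply, tsum_map_mul, tsum_fintype]
    simp only [PMF.uniformOfFintype_apply, Fintype.card_fin, ← Finset.mul_sum]
    rw [ENNReal.toReal_mul, ENNReal.toReal_inv, ENNReal.toReal_natCast,
      ENNReal.toReal_sum fun _ _ => PMF.apply_ne_top _ _]
  simp only [LMDP.mixValue, LMDP.value, expectedReturn, h]
  rw [← Summable.tsum_finsetSum fun k _ => summable_mul_return hR hsum _, ← tsum_mul_left]
  refine tsum_congr fun τ => ?_
  rw [mul_assoc, Finset.sum_mul]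

/-- Optimism: the mean of the differences of the optimistic and the true values bounds the
suboptimality. -/
theorem isEpsOptimal_of_sum_l1_le (hR : ∀ h s a, R h s a ∈ Set.Icc (0 : ℝ) 1)
    (hsum : ∑ h, ⨆ x : S × A, R h x.1 x.2 ≤ 1) (M : Θ → LMDP S A L) (θstar : Θ)
    {Pol : Set (Policy S A)} (hPol : Pol.Nonempty) {K : ℕ} [NeZero K] (D : Fin K → Round Θ S A H)
    {ε : ℝ} (hε : 0 ≤ ε)
    (hopt : ∀ k, ∀ π ∈ Pol, (M θstar).value R π ≤ (M (D k).model).value R (D k).policy)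
    (hl1 : ∑ k, l1 (fun τ => ((M (D k).model).trajLaw H (D k).policy τ).toReal)
      (fun τ => ((M θstar).trajLaw H (D k).policy τ).toReal) ≤ ENNReal.ofReal (K * ε)) :
    IsEpsOptimal (M θstar) R Pol ε (omleOutput D) := by
  have hK : (0 : ℝ) < K := by exact_mod_cast Nat.pos_of_ne_zero (NeZero.ne K)
  have h1 : ∑ k, ((M (D k).model).value R (D k).policy - (M θstar).value R (D k).policy) ≤ K * ε := by
    refine (ENNReal.ofReal_le_ofReal_iff (by positivity)).1 (le_trans ?_ hl1)
    -- Negative differences are replaced by zero, so that the sum can be taken in `ℝ≥0∞`.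
    refine (ENNReal.ofReal_le_ofReal (Finset.sum_le_sum fun k _ => le_max_left _ 0)).trans ?_
    rw [ENNReal.ofReal_sum_of_nonneg fun _ _ => le_max_right _ _]
    refine Finset.sum_le_sum fun k _ => ?_
    rw [ENNReal.ofReal_max, ENNReal.ofReal_zero, max_eq_left zero_le]
    exact expectedReturn_sub_le hR hsum _ _
  rw [IsEpsOptimal, sub_le_iff_le_add]
  refine csSup_le (hPol.image _) ?_
  rintro _ ⟨π, hπ, rfl⟩
  have h2 : (K : ℝ) * (M θstar).value R π ≤ ∑ k, (M (D k).model).value R (D k).policy := by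
    have := Finset.sum_le_sum fun k (_ : k ∈ (Finset.univ : Finset (Fin K))) => hopt k π hπ
    rwa [Finset.sum_const, Finset.card_univ, Fintype.card_fin, nsmul_eq_mul] at this
  rw [Finset.sum_sub_distrib] at h1
  rw [mixValue_omleOutput hR hsum]
  refine le_of_mul_le_mul_left ?_ hK
  rw [mul_add, mul_inv_cancel_left₀ hK.ne']
  linarith

end Returns

/-! ### Budgets of the components of the executed mixture -/

section Budgets

variable {S A : Type*} [Fintype A] [Nonempty A] {L : ℕ}

/-- The executed mixture gives this policy the weight one half, and the Hellinger distance is linear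
in the mixture. -/
theorem trajHell_switch_le_hell_mixLaw (M Ms : LMDP S A L) (N W : ℕ) [NeZero (N + 1)]
    (πexp π : Policy S A) :
    M.trajHell Ms N (Policy.switch W π πexp)
      ≤ 2 * hell (fun τ => (M.mixLaw (N + 1) (explore (N + 1) W πexp π) τ).toReal)
        (fun τ => (Ms.mixLaw (N + 1) (explore (N + 1) W πexp π) τ).toReal) := by
  rw [LMDP.hell_mixLaw, tsum_explore_mul, mul_add, ← mul_assoc,
    ENNReal.mul_inv_cancel two_ne_zero ENNReal.ofNat_ne_top, one_mul]
  exact le_self_add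

/-- Each exploration step has the weight `1 / (2 H)` with `H = N + 1`; the factor `2 H` is paid once
for the sum over all steps. -/
theorem sum_trajHell_exploreAt_le_hell_mixLaw (M Ms : LMDP S A L) (N W : ℕ) [NeZero (N + 1)]
    (πexp π : Policy S A) :
    ∑ h ∈ Finset.range (N + 1), M.trajHell Ms N (exploreAt πexp h π)
      ≤ ((N + 1 : ℕ) * 2) * hell (fun τ => (M.mixLaw (N + 1) (explore (N + 1) W πexp π) τ).toReal)
        (fun τ => (Ms.mixLaw (N + 1) (explore (N + 1) W πexp π) τ).toReal) := by
  have h0 : ((N + 1 : ℕ) : ℝ≥0∞) ≠ 0 := by simp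
  rw [LMDP.hell_mixLaw, tsum_explore_mul, mul_assoc, mul_add, ← mul_assoc 2 2⁻¹, ← mul_assoc 2 2⁻¹,
    ENNReal.mul_inv_cancel two_ne_zero ENNReal.ofNat_ne_top, one_mul, one_mul, mul_add,
    ← mul_assoc, ENNReal.mul_inv_cancel h0 (ENNReal.natCast_ne_top _), one_mul]
  exact le_add_self

theorem ofReal_regret_bound (K v n a : ℕ) {e b f w y z : ℝ} (he : 0 ≤ e) (hb : 0 ≤ b) (hf : 0 ≤ f)
    (hw : 0 ≤ w) (hy : 0 ≤ y) (hz : 0 ≤ z) :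
    292 * (K * ENNReal.ofReal e) + (290 * (v + 3) + n) * ENNReal.ofReal y
      + ENNReal.ofReal z * (K * ((290 * (v + 3) + n) * ENNReal.ofReal w
        + (290 * (8 * ENNReal.ofReal f + 64 * (a * ENNReal.ofReal f) + 36 * ENNReal.ofReal b)
          + (n * (616 * (K * ENNReal.ofReal e) + 576 * ENNReal.ofReal b)
            + 36 * (a * ENNReal.ofReal f)))))
      = ENNReal.ofReal (292 * (K * e) + (290 * (v + 3) + n) * y
      + z * (K * ((290 * (v + 3) + n) * w + (290 * (8 * f + 64 * (a * f) + 36 * b)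
          + (n * (616 * (K * e) + 576 * b) + 36 * (a * f)))))) := by
  simp (disch := positivity) only [ENNReal.ofReal_add, ENNReal.ofReal_mul, ENNReal.ofReal_natCast,
    ENNReal.ofReal_ofNat]

end Budgets

end LatentMDP

end

/-! ### Assembly of the theorem -/

open LatentMDP in
theorem theorem4p2 :
    ∃ C₁ : ℝ, 0 < C₁ ∧ ∀ C₀ : ℝ, C₁ ≤ C₀ →
      ∀ {S A Θ : Type*} [Countable S] [Fintype A] [Nonempty A] (L H : ℕ) [NeZero H]
        (M : Θ → LatentMDP.LMDP S A L) (θstar : Θ)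
        (R : Fin H → S → A → ℝ) (_ : ∀ h s a, R h s a ∈ Set.Icc (0 : ℝ) 1)
        (_ : ∑ h, ⨆ x : S × A, R h x.1 x.2 ≤ 1)
        (Pol : Set (LatentMDP.Policy S A))
        (d : ℕ) (_ : (M θstar).rank ≤ (d : ℕ∞))
        (ϖ : ℕ → EReal) (_ : Monotone ϖ)
        (_ : ∀ θ, ∀ π ∈ Pol, (M θ).SeparatedUnder H ϖ π)
        (πexp : LatentMDP.Policy S A) (_ : πexp ∈ Pol)
        (ε p β ι εs : ℝ) (_ : 0 < ε) (_ : ε ≤ 1) (_ : 0 < p) (_ : p < 1)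
        (_ : ι = Real.log (L * d * H / ε))
        (_ : εs = ε ^ 2 / (C₀ * L * d ^ 2 * H ^ 2 * ι))
        (K W : ℕ) [NeZero K]
        (_ : K = ⌈C₀ * (L * d ^ 2 * Fintype.card A * H ^ 2 * ι * β / ε ^ 2)⌉₊)
        (_ : 2 * ENNReal.log (LatentMDP.coveringNumber M H (1 / K) : ENNReal)
              + ((2 * Real.log (1 / p) + 2 : ℝ) : EReal) ≤ (β : EReal))
        (_ : LatentMDP.growthInv ϖ (Real.log (L / εs) : ℝ) ≤ (W : ℕ∞))
        (_ : (W : ℕ∞) + LatentMDP.growthInv ϖ (Real.log (2 * L) : ℝ) ≤ (H : ℕ∞))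
        (sel : (k : ℕ) → (Fin k → LatentMDP.Round Θ S A H) → Θ × LatentMDP.Policy S A)
        (_ : LatentMDP.IsOMLESelection M θstar R Pol W πexp β εs K sel),
        ENNReal.ofReal (1 - p) ≤
          (LatentMDP.omleRun M θstar W πexp sel K).toOuterMeasure
            {D | LatentMDP.IsEpsOptimal (M θstar) R Pol ε (LatentMDP.omleOutput D)} := by
  refine ⟨10 ^ 24, by positivity, fun C₀ hC₀ => ?_⟩
  intro S A Θ _ _ _ L H _ M θstar R hR hRsum Pol d hd ϖ hϖ hsep πexp hπexp ε p β ι εs hε hε1 hp hp1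
    hι hεs K W _ hK hβ hW hHW sel hsel
  have hL : 0 < L := (M θstar).pos_latent
  obtain ⟨hβ2, Θ₀, Phat, hcov, hcard⟩ := exists_cover_of_log_le M θstar hp hp1 hβ
  have hK0 : 0 < K := Nat.pos_of_ne_zero (NeZero.ne K)
  -- For `d = 0` the formula for the number of episodes would give `K = 0`.
  have hd0 : 0 < d := by
    rcases Nat.eq_zero_or_pos d with rfl | h
    · simp at hK
      omega
    · exact h
  obtain ⟨hW1, hϖW⟩ := le_of_growthInv_le hϖ hW
  -- Positions count from zero: `v` is the position of step `W`, and `n = H - W` is the length of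
  -- the future beyond it.
  obtain ⟨v, rfl⟩ : ∃ v, W = v + 1 := ⟨W - 1, by omega⟩
  obtain ⟨n, rfl, hn1, hϖn⟩ : ∃ n, H = v + n + 1 ∧ 1 ≤ n ∧
      ((Real.log (2 * L) : ℝ) : EReal) ≤ ϖ n := by
    have hWH : v + 1 ≤ H := by exact_mod_cast le_self_add.trans hHW
    have h : growthInv ϖ (Real.log (2 * L) : ℝ) ≤ ((H - (v + 1) : ℕ) : ℕ∞) := by
      refine (ENat.add_le_add_iff_left (ENat.natCast_ne_top (v + 1))).1 (hHW.trans_eq ?_)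
      rw [← Nat.cast_add, Nat.add_sub_cancel' hWH]
    obtain ⟨h1, h2⟩ := le_of_growthInv_le hϖ h
    exact ⟨H - (v + 1), by omega, h1, h2⟩
  have hl : (1 : ℝ) ≤ L := by exact_mod_cast hL
  have hd1 : (1 : ℝ) ≤ d := by exact_mod_cast hd0
  have ha : (1 : ℝ) ≤ Fintype.card A := by exact_mod_cast Fintype.card_pos (α := A)
  have hh : (2 : ℝ) ≤ ((v + n + 1 : ℕ) : ℝ) := by exact_mod_cast (by omega : 2 ≤ v + n + 1)
  have hι0 : 0 < ι := by
    rw [hι]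
    refine Real.log_pos ?_
    rw [lt_div_iff₀ hε]
    have : 1 ≤ (L : ℝ) * d := one_le_mul_of_one_le_of_one_le hl hd1
    nlinarith
  have hC0 : (0 : ℝ) < C₀ := lt_of_lt_of_le (by positivity) hC₀
  have hβ0 : 0 < β := by linarith
  have hεs0 : 0 < εs := by
    rw [hεs]
    positivity
  have hk1 : C₀ * (L * d ^ 2 * Fintype.card A * ((v + n + 1 : ℕ) : ℝ) ^ 2 * ι * β / ε ^ 2) ≤ K := by
    rw [hK]
    exact Nat.le_ceil _
  have hk2 : (K : ℝ)
      ≤ C₀ * (L * d ^ 2 * Fintype.card A * ((v + n + 1 : ℕ) : ℝ) ^ 2 * ι * β / ε ^ 2) + 1 := by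
    conv_lhs => rw [hK]
    exact (Nat.ceil_lt_add_one (by positivity)).le
  rw [hι] at hεs hk1 hk2
  obtain ⟨η, hη, hbound⟩ := regret_bound_le hC₀ hl hd1 ha hh hε hε1 hβ2 (Nat.cast_nonneg v)
    (Nat.cast_nonneg n) (by push_cast; ring) hεs hk1 hk2
  -- Separation of all models bounds the overlaps both in the optimistic models and in the true one.
  have hpair : ∀ θ, ∀ π ∈ Pol, hsum π v (fun hist s => ENNReal.ofReal ((M θ).pairSum hist s))
      ≤ ENNReal.ofReal εs := fun θ π hπ =>
    (M θ).hsum_pairSum_le (hsep θ π hπ) (by omega) hεs0 hL hϖW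
  obtain ⟨G, hG, hconf⟩ := exists_confidence_event M θstar (v + 1) πexp sel hp.le hK0 hcov hcard
  refine hG.trans (PMF.toOuterMeasure_mono _ ?_)
  rintro D ⟨hDG, hD⟩
  have hrun := mem_support_omleRun M θstar (v + 1) πexp sel hD
  have hfeas : ∀ k (hk : k < K), (D ⟨k, hk⟩).policy ∈ Pol ∧
      (D ⟨k, hk⟩).model ∈ confidenceSet M (v + 1) πexp β (fun t => D (Fin.castLE hk.le t)) ∧
      ∀ π ∈ Pol, (M θstar).value R π ≤ (M (D ⟨k, hk⟩).model).value R (D ⟨k, hk⟩).policy := by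
    intro k hk
    obtain ⟨h1, h2, h3, -⟩ := hrun k hk
    obtain ⟨⟨h4, h5, -⟩, h6⟩ := hsel k hk _ h1
    rw [h2, h3]
    refine ⟨h5, h4, fun π hπ => h6 (θstar, π) ⟨(hconf D hDG hD k hk).1, hπ, ?_⟩⟩
    exact (M θstar).decodingError_le (by omega) π hεs0.le (hpair θstar π hπ)
  refine isEpsOptimal_of_sum_l1_le hR hRsum M θstar ⟨πexp, hπexp⟩ D hε.le
    (fun k => (hfeas k k.2).2.2) ?_
  -- The last record is repeated beyond round `K`, so that the bounds required of every index in `ℕ`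
  -- hold.
  set f : ℕ → Round Θ S A (v + n + 1) := fun k => D ⟨min k (K - 1), by omega⟩ with hf
  have hfk : ∀ k (hk : k < K), f k = D ⟨k, hk⟩ := fun k hk => by
    simp only [hf]
    congr
    omega
  set δ : ℕ → ℕ → ℝ≥0∞ := fun k t => hell
    (fun τ => ((M (f k).model).mixLaw (v + n + 1)
      (explore (v + n + 1) (v + 1) πexp (f t).policy) τ).toReal)
    (fun τ => ((M θstar).mixLaw (v + n + 1)
      (explore (v + n + 1) (v + 1) πexp (f t).policy) τ).toReal) with hδ
  have hhell : ∀ k < K, ∑ t ∈ Finset.range k, δ k t ≤ ENNReal.ofReal (2 * β) := by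
    intro k hk
    rw [← Fin.sum_univ_eq_sum_range (δ k)]
    have h := (hconf D hDG hD k hk).2 _ (hfeas k hk).2.1
    rw [← hfk k hk] at h
    refine le_trans (le_of_eq (Finset.sum_congr rfl fun t _ => ?_)) h
    simp only [hδ, hfk t (t.2.trans hk)]
    rfl
  -- The regularization `A * β` is of the order of the budgets, so it neither dominates the errors
  -- nor enlarges the logarithm. Futures of length `n' ≥ n` are separated because `ϖ` is monotone.
  have hmain := LMDP.sum_hsum_absDiff_le (fun k => M (f k).model) (M θstar) πexp
    (fun k => (f k).policy) hd0 hd (B := Fintype.card A * β) (by positivity) hη K v n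
    (e := ENNReal.ofReal εs) (b := ENNReal.ofReal (8 * β))
    (Φ := ENNReal.ofReal (8 * ((v + n + 1 : ℕ) : ℝ) * β))
    (fun k n' h1 h2 => (hsep _ _ hπexp).futSeparated (by omega) hL
      (hϖn.trans (hϖ (by omega))))
    (fun k t => hpair _ _ (hfeas _ _).1) (fun t => hpair _ _ (hfeas _ _).1)
    (fun k hk => ?_) (fun k hk => ?_)
  · refine le_trans ?_ (hmain.trans ?_)
    · rw [← Fin.sum_univ_eq_sum_range
        (fun k => hsum (f k).policy (v + n) ((M (f k).model).absDiff (M θstar)))]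
      refine Finset.sum_le_sum fun k _ => ?_
      rw [hfk k k.2, LMDP.l1_trajLaw]
    · rw [ofReal_regret_bound K v n _ hεs0.le (by positivity) (by positivity) (by positivity)
        (mul_nonneg hη.le (mul_nonneg (by positivity) (Real.log_nonneg ?_))) (by positivity)]
      · exact ENNReal.ofReal_le_ofReal hbound
      · exact le_add_of_nonneg_right (by positivity)
  · calc _ ≤ ∑ t ∈ Finset.range k, 2 * δ k t :=
          Finset.sum_le_sum fun t _ => trajHell_switch_le_hell_mixLaw _ _ _ _ _ _
      _ ≤ 2 * ENNReal.ofReal (2 * β) := by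
          rw [← Finset.mul_sum]
          gcongr
          exact hhell k hk
      _ ≤ _ := by
          rw [← ENNReal.ofReal_ofNat, ← ENNReal.ofReal_mul (by norm_num)]
          exact ENNReal.ofReal_le_ofReal (by linarith)
  · calc _ ≤ ∑ t ∈ Finset.range k, ((v + n + 1 : ℕ) * 2) * δ k t :=
          Finset.sum_le_sum fun t _ => sum_trajHell_exploreAt_le_hell_mixLaw _ _ _ _ _ _
      _ ≤ ((v + n + 1 : ℕ) * 2) * ENNReal.ofReal (2 * β) := by
          rw [← Finset.mul_sum]
          gcongr
          exact hhell k hk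
      _ ≤ _ := by
          rw [← ENNReal.ofReal_ofNat 2, ← ENNReal.ofReal_natCast,
            ← ENNReal.ofReal_mul (by positivity), ← ENNReal.ofReal_mul (by positivity)]
          exact ENNReal.ofReal_le_ofReal (by nlinarith)
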